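/- Setting. Let $\nu\in(0,2)$ and $\ell\in\{1,2\}$. For $s>0$ define $G_s:[0,\infty)\to\mathbb R$ by $G_s(0)=0$ and, for $t>0$, $G_s(t)=t^{2s}$ if $s\notin\mathbb Z$ and $G_s(t)=t^{2s}\log t$ if $s\in\mathbb Z$. Let $(\beta_s^*)_{s\in(0,2)}$ be nonzero real constants. Let $X$ be a stationary, isotropic Gaussian random field on $\mathbb R^2$ with constant mean and covariance function $$K(x,y)=\sum_{j=0}^{\lfloor\nu\rfloor}\beta_j\|x-y\|^{2j}+\beta_\nu^*G_\nu(\|x-y\|)+r(x,y),\qquad x,y\in\mathbb R^2,$$ where the $\beta_j$ are real constants and, for some $\tau>0$, $r(x,y)=O(\|x-y\|^{2\nu+\tau})$ as $\|x-y\|\to0$ (including $x=y$, so $r(x,x)=0$). Write $\tilde K(x-y)=K(x,y)$. Let $\Omega\supset[0,1]^2$ be open in $\mathbb R^2$ and let $\tilde\varphi=(\varphi_1,\varphi_2):\Omega\to\mathbb R^2$ be an injective $C^2$ map whose inverse is $C^1$ on $\tilde\varphi(\Omega)$. Put $\Delta=\tilde\varphi([0,1]^2)$, $x^{i_1,i_2}=\tilde\varphi(i_1/n,i_2/n)$,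 $X_{i_1,i_2}=X(x^{i_1,i_2})$ and, for $\theta\in\{1,2\}$ and $1\le i_1,i_2\le n-\theta$, let $A_{\theta;i_1,i_2}$ be the $2\times2$ matrix with rows $x^{i_1+\theta,i_2}-x^{i_1,i_2}$ and $x^{i_1,i_2+\theta}-x^{i_1,i_2}$, and $B_{\theta;i_1,i_2}$ the one with rows $x^{i_1+\theta,i_2}-x^{i_1+\theta,i_2+\theta}$ and $x^{i_1,i_2+\theta}-x^{i_1+\theta,i_2+\theta}$. With $(\alpha^{j,l})=A_{\theta;i_1,i_2}^{-1}$ and $(\beta^{j,l})=B_{\theta;i_1,i_2}^{-1}$ let $$\bar\nabla_{\theta,\ell}X_{i_1,i_2}=\beta^{\ell,1}(X_{i_1+\theta,i_2}-X_{i_1+\theta,i_2+\theta})+\beta^{\ell,2}(X_{i_1,i_2+\theta}-X_{i_1+\theta,i_2+\theta})-\alpha^{\ell,1}(X_{i_1+\theta,i_2}-X_{i_1,i_2})-\alpha^{\ell,2}(X_{i_1,i_2+\theta}-X_{i_1,i_2}),$$ written as $\sum_{0\le k_1,k_2\le1}c^{k_1,k_2}_{\theta,\ell;i_1,i_2}X_{i_1+\theta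 k_1,i_2+\theta k_2}$, and let $\bar V_{\theta,\ell}=\sum_{1\le i_1,i_2\le n-\theta}(\bar\nabla_{\theta,\ell}X_{i_1,i_2})^2$. For $s\in(0,2)$ put $$\bar f_{\theta,\ell}(s)=\beta_s^*\sum_{1\le i_1,i_2\le n-\theta}\ \sum_{(k_1,k_2)\ne(l_1,l_2)\in\{0,1\}^2}c^{k_1,k_2}_{\theta,\ell;i_1,i_2}c^{l_1,l_2}_{\theta,\ell;i_1,i_2}G_s\bigl(\|x^{i_1+\theta k_1,i_2+\theta k_2}-x^{i_1+\theta l_1,i_2+\theta l_2}\|\bigr).$$ Let $\bar F_{\ell,n}(s)=\bar f_{2,\ell}(s)/\bar f_{1,\ell}(s)$ for $s\in(0,2)$ (the constants $\beta_s^*$ cancel), and let $\bar F_{\ell,n}(0)$, $\bar F_{\ell,n}(2)$ be its one-sided limits at $0$ and $2$. Assumptions. Let $\ell^c=3-\ell$ and write $\partial_1,\partial_2$ for the partial derivatives on $\Omega$. Assume that $$\mathcal J_{\nu,\ell}=\frac{(\partial_2\varphi_{\ell^c}-\partial_1\varphi_{\ell^c})^2}{(\partial_1\varphi_1\,\partial_2\varphi_2-\partial_2\varphi_1\,\partial_1\varphi_2)^2}\Bigl\{-2G_\nu(\|\partial_2\tilde\varphi\|)-2G_\nu(\|\partial_1\tilde\varphi\|)+G_\nu(\|\partial_1\tilde\varphi+\partial_2\tilde\varphi\|)+G_\nu(\|\partial_2\tilde\varphi-\partial_1\tilde\varphi\|)\Bigr\}$$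 is not identically $0$ on $[0,1]^2$. Assume also that, for all integers $a_1,a_2\ge0$ with $a_1+a_2=4$, the partial derivative $\tilde K^{(a_1,a_2)}$ exists and is continuous on an open set containing $\{x-y:x,y\in\Delta,\ x\ne y\}$, and that there is a constant $\tilde C$ with $|\tilde K^{(a_1,a_2)}(x-y)|\le\tilde C\|x-y\|^{2\nu-4}$ for all such $a_1,a_2$ and all $x\ne y$ in $\Delta$. Theorem. For all sufficiently large $n$, all the matrices $A_{\theta;i_1,i_2}$ and $B_{\theta;i_1,i_2}$ are invertible, $\bar f_{1,\ell}$ has no zero in $(0,2)$, and $\bar F_{\ell,n}$ is well defined and continuous on $[0,2]$; and almost surely $\bar V_{2,\ell}\ne0$ for all sufficiently large $n$. Moreover, if $\hat\nu_{c,\ell}=\hat\nu_{c,\ell}(n)\in[0,2]$ is any estimator which almost surely, for all sufficiently large $n$, satisfies $$\Bigl\{\frac{\bar V_{1,\ell}\bar F_{\ell,n}(\hat\nu_{c,\ell})}{\bar V_{2,\ell}}-1\Bigr\}^2=\min_{0\le s\le2}\Bigl\{\frac{\bar V_{1,\ell}\bar F_{\ell,n}(s)}{\bar V_{2,\ell}}-1\Bigr\}^2,$$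 then $\hat\nu_{c,\ell}\to\nu$ almost surely as $n\to\infty$. -/

import Mathlib

open MeasureTheory ProbabilityTheory Filter Set
open scoped Topology

noncomputable section

namespace DeformedLattice

/-- The plane with its Euclidean norm. The coordinates `1, 2` of the mathematical text are the
elements `0, 1` of `Fin 2`. -/
abbrev Plane : Type := EuclideanSpace ℝ (Fin 2)

/-! ### Partial derivatives -/

/-- The partial derivative of `f` in the `j`-th coordinate direction. -/
def partialDeriv (j : Fin 2) (f : Plane → ℝ) : Plane → ℝ :=
  fun x => lineDeriv ℝ f x (EuclideanSpace.single j 1)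

/-- The partial derivative of order `a₁` in the first and of order `a₂` in the second
coordinate. -/
def mixedPartial (a₁ a₂ : ℕ) (f : Plane → ℝ) : Plane → ℝ :=
  (partialDeriv 0)^[a₁] ((partialDeriv 1)^[a₂] f)

/-- The iterated partial derivative `mixedPartial a₁ a₂ f` really exists at every point of `U`:
each of the successive partial derivatives that enter its definition exists there. -/
def MixedPartialExistsOn (a₁ a₂ : ℕ) (f : Plane → ℝ) (U : Set Plane) : Prop :=
  (∀ k < a₂, ∀ x ∈ U,
    LineDifferentiableAt ℝ ((partialDeriv 1)^[k] f) x (EuclideanSpace.single 1 1)) ∧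
  (∀ k < a₁, ∀ x ∈ U,
    LineDifferentiableAt ℝ (mixedPartial k a₂ f) x (EuclideanSpace.single 0 1))

/-! ### The random field -/

open Classical in
/-- The function `G_ν` on `[0, ∞)`: it vanishes at `0`, and for `s > 0` it is `s ^ (2 ν)` if `ν` is
not an integer and `s ^ (2 ν) log s` if `ν` is an integer. -/
def irregularTerm (ν s : ℝ) : ℝ :=
  if s = 0 then 0
  else if ∃ k : ℤ, ν = k then s ^ (2 * ν) * Real.log s
  else s ^ (2 * ν)

/-- `X` is a stationary, isotropic Gaussian random field on the plane with mean `m` and covariance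
function `K`. -/
structure IsStationaryIsotropicGaussianField {S : Type*} [MeasurableSpace S]
    (X : Plane → S → ℝ) (P : Measure S) (m : ℝ) (K : Plane → Plane → ℝ) : Prop where
  gaussian : IsGaussianProcess X P
  mean_eq : ∀ x, ∫ ω, X x ω ∂P = m
  covariance_eq : ∀ x y, cov[X x, X y; P] = K x y
  isotropic : ∀ x y x' y', ‖x - y‖ = ‖x' - y'‖ → K x y = K x' y'

/-- The covariance function has the form
`K(x, y) = ∑_{j ≤ ⌊ν⌋} b_j ‖x - y‖ ^ (2 j) + β G_ν(‖x - y‖) + r(x, y)`, where, for some `τ > 0`,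
`r(x, y) = O(‖x - y‖ ^ (2 ν + τ))` as `‖x - y‖ → 0` (the diagonal `x = y` included). -/
def HasIrregularExpansion (K : Plane → Plane → ℝ) (ν β : ℝ) : Prop :=
  ∃ (b : ℕ → ℝ) (r : Plane → Plane → ℝ) (τ : ℝ), 0 < τ ∧
    (∀ x y, K x y = ∑ j ∈ Finset.range (⌊ν⌋₊ + 1), b j * ‖x - y‖ ^ (2 * j)
      + β * irregularTerm ν ‖x - y‖ + r x y) ∧
    ∃ C δ : ℝ, 0 < δ ∧ ∀ x y, ‖x - y‖ < δ → |r x y| ≤ C * ‖x - y‖ ^ (2 * ν + τ)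

/-- The smoothness of the covariance function off the diagonal: with `K̃(x - y) = K(x, y)`, that is
`K̃(z) = K(z, 0)`, every fourth-order partial derivative of `K̃` exists and is continuous on an open
set containing all differences `x - y` of distinct points of `D`, and at these differences it is
bounded by a constant times `‖x - y‖ ^ (2 ν - 4)`. -/
def HasFourthOrderBound (K : Plane → Plane → ℝ) (ν : ℝ) (D : Set Plane) : Prop :=
  (∀ a₁ a₂ : ℕ, a₁ + a₂ = 4 →
    ∃ U : Set Plane, IsOpen U ∧ (∀ x ∈ D, ∀ y ∈ D, x ≠ y → x - y ∈ U) ∧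
      MixedPartialExistsOn a₁ a₂ (fun z => K z 0) U ∧
      ContinuousOn (mixedPartial a₁ a₂ (fun z => K z 0)) U) ∧
  ∃ C : ℝ, ∀ a₁ a₂ : ℕ, a₁ + a₂ = 4 → ∀ x ∈ D, ∀ y ∈ D, x ≠ y →
    |mixedPartial a₁ a₂ (fun z => K z 0) (x - y)| ≤ C * ‖x - y‖ ^ (2 * ν - 4)

/-! ### The deformation and the sampling sites -/

/-- The closed unit square. -/
def unitSquare : Set Plane := {x | ∀ j, x j ∈ Icc (0 : ℝ) 1}

/-- `φ` is a `C²` diffeomorphism of the open set `O`, which contains the unit square, onto its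
range: `φ` is injective and of class `C²` on `O`, and its inverse is of class `C¹` on `φ '' O`. -/
structure IsDeformation (φ : Plane → Plane) (O : Set Plane) : Prop where
  isOpen : IsOpen O
  square_subset : unitSquare ⊆ O
  injOn : InjOn φ O
  contDiffOn : ContDiffOn ℝ 2 φ O
  contDiffOn_inverse : ∃ ψ : Plane → Plane, ContDiffOn ℝ 1 ψ (φ '' O) ∧ ∀ x ∈ O, ψ (φ x) = x

/-- The site `x^{i₁, i₂} = φ(i₁ / n, i₂ / n)`. -/
def site (φ : Plane → Plane) (n i₁ i₂ : ℕ) : Plane := φ !₂[(i₁ : ℝ) / n, (i₂ : ℝ) / n]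

/-- The matrix `A_{θ; i₁, i₂}`. -/
def matA (φ : Plane → Plane) (n θ i₁ i₂ : ℕ) : Matrix (Fin 2) (Fin 2) ℝ :=
  !![site φ n (i₁ + θ) i₂ 0 - site φ n i₁ i₂ 0, site φ n (i₁ + θ) i₂ 1 - site φ n i₁ i₂ 1;
     site φ n i₁ (i₂ + θ) 0 - site φ n i₁ i₂ 0, site φ n i₁ (i₂ + θ) 1 - site φ n i₁ i₂ 1]

/-- The matrix `B_{θ; i₁, i₂}`. -/
def matB (φ : Plane → Plane) (n θ i₁ i₂ : ℕ) : Matrix (Fin 2) (Fin 2) ℝ :=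
  !![site φ n (i₁ + θ) i₂ 0 - site φ n (i₁ + θ) (i₂ + θ) 0,
       site φ n (i₁ + θ) i₂ 1 - site φ n (i₁ + θ) (i₂ + θ) 1;
     site φ n i₁ (i₂ + θ) 0 - site φ n (i₁ + θ) (i₂ + θ) 0,
       site φ n i₁ (i₂ + θ) 1 - site φ n (i₁ + θ) (i₂ + θ) 1]

/-! ### Quadratic variations -/

/-- The second-order difference of a function `Y` on the plane at the lattice index `(i₁, i₂)`: the
difference of the two approximations, from the opposite corners `(i₁ + θ, i₂ + θ)` and `(i₁, i₂)`,
of the partial derivative of `Y` in direction `ℓ`. -/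
def nabla (φ : Plane → Plane) (Y : Plane → ℝ) (n θ : ℕ) (ℓ : Fin 2) (i₁ i₂ : ℕ) : ℝ :=
  (matB φ n θ i₁ i₂)⁻¹ ℓ 0 * (Y (site φ n (i₁ + θ) i₂) - Y (site φ n (i₁ + θ) (i₂ + θ)))
  + (matB φ n θ i₁ i₂)⁻¹ ℓ 1 * (Y (site φ n i₁ (i₂ + θ)) - Y (site φ n (i₁ + θ) (i₂ + θ)))
  - (matA φ n θ i₁ i₂)⁻¹ ℓ 0 * (Y (site φ n (i₁ + θ) i₂) - Y (site φ n i₁ i₂))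
  - (matA φ n θ i₁ i₂)⁻¹ ℓ 1 * (Y (site φ n i₁ (i₂ + θ)) - Y (site φ n i₁ i₂))

/-- The coefficient `c^{k₁, k₂}_{θ, ℓ; i₁, i₂}` of the value of `Y` at the site with index
`(i₁ + θ k₁, i₂ + θ k₂)` in the second-order difference `nabla`; see `nabla_eq_sum`. -/
def coeff (φ : Plane → Plane) (n θ : ℕ) (ℓ : Fin 2) (i₁ i₂ : ℕ) (k : Fin 2 × Fin 2) : ℝ :=
  !![(matA φ n θ i₁ i₂)⁻¹ ℓ 0 + (matA φ n θ i₁ i₂)⁻¹ ℓ 1,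
       (matB φ n θ i₁ i₂)⁻¹ ℓ 1 - (matA φ n θ i₁ i₂)⁻¹ ℓ 1;
     (matB φ n θ i₁ i₂)⁻¹ ℓ 0 - (matA φ n θ i₁ i₂)⁻¹ ℓ 0,
       -(matB φ n θ i₁ i₂)⁻¹ ℓ 0 - (matB φ n θ i₁ i₂)⁻¹ ℓ 1] k.1 k.2

/-- The corner of index `k` of the lattice cell of side `θ` at `(i₁, i₂)`. -/
def corner (φ : Plane → Plane) (n θ i₁ i₂ : ℕ) (k : Fin 2 × Fin 2) : Plane :=
  site φ n (i₁ + θ * (k.1 : ℕ)) (i₂ + θ * (k.2 : ℕ))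

theorem nabla_eq_sum (φ : Plane → Plane) (Y : Plane → ℝ) (n θ : ℕ) (ℓ : Fin 2) (i₁ i₂ : ℕ) :
    nabla φ Y n θ ℓ i₁ i₂ =
      ∑ k : Fin 2 × Fin 2, coeff φ n θ ℓ i₁ i₂ k * Y (corner φ n θ i₁ i₂ k) := by
  simp [Fintype.sum_prod_type, Fin.sum_univ_two, coeff, corner, nabla]
  ring

/-- The quadratic variation `V̄_{θ, ℓ}` of a function `Y` on the plane. -/
def quadVar (φ : Plane → Plane) (Y : Plane → ℝ) (n θ : ℕ) (ℓ : Fin 2) : ℝ :=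
  ∑ i₁ ∈ Finset.Icc 1 (n - θ), ∑ i₂ ∈ Finset.Icc 1 (n - θ), nabla φ Y n θ ℓ i₁ i₂ ^ 2

/-- The function `f̄_{θ, ℓ}`; `β s` stands for the constant `β_s^*`. -/
def fBar (β : ℝ → ℝ) (φ : Plane → Plane) (n θ : ℕ) (ℓ : Fin 2) (s : ℝ) : ℝ :=
  β s * ∑ i₁ ∈ Finset.Icc 1 (n - θ), ∑ i₂ ∈ Finset.Icc 1 (n - θ),
    ∑ k : Fin 2 × Fin 2, ∑ l ∈ Finset.univ.filter (fun l : Fin 2 × Fin 2 => k ≠ l),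
      coeff φ n θ ℓ i₁ i₂ k * coeff φ n θ ℓ i₁ i₂ l *
        irregularTerm s ‖corner φ n θ i₁ i₂ k - corner φ n θ i₁ i₂ l‖

/-- The function `F̄_{ℓ, n}` on `[0, 2]`: the ratio `f̄_{2, ℓ} / f̄_{1, ℓ}` on `(0, 2)`, extended to
the end points by its one-sided limits. -/
def ratioF (β : ℝ → ℝ) (φ : Plane → Plane) (n : ℕ) (ℓ : Fin 2) (s : ℝ) : ℝ :=
  if s = 0 then limUnder (𝓝[>] (0 : ℝ)) (fun t => fBar β φ n 2 ℓ t / fBar β φ n 1 ℓ t)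
  else if s = 2 then limUnder (𝓝[<] (2 : ℝ)) (fun t => fBar β φ n 2 ℓ t / fBar β φ n 1 ℓ t)
  else fBar β φ n 2 ℓ s / fBar β φ n 1 ℓ s

/-- The contrast `{V̄_{1, ℓ} F̄_{ℓ, n}(s) / V̄_{2, ℓ} - 1}²` computed from the observed field `Y`. -/
def contrast (β : ℝ → ℝ) (φ : Plane → Plane) (Y : Plane → ℝ) (n : ℕ) (ℓ : Fin 2) (s : ℝ) : ℝ :=
  (quadVar φ Y n 1 ℓ * ratioF β φ n ℓ s / quadVar φ Y n 2 ℓ - 1) ^ 2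

/-! ### The non-degeneracy function -/

/-- `dφ φ j k x` is the partial derivative of the `j`-th component of `φ` in the `k`-th coordinate
at `x`. -/
def dφ (φ : Plane → Plane) (j k : Fin 2) (x : Plane) : ℝ := partialDeriv k (fun y => φ y j) x

/-- The other element of `Fin 2`. -/
def other (ℓ : Fin 2) : Fin 2 := if ℓ = 0 then 1 else 0

/-- The function `𝒥_{ν, ℓ}`. -/
def scriptJ (φ : Plane → Plane) (ν : ℝ) (ℓ : Fin 2) (x : Plane) : ℝ :=
  (dφ φ (other ℓ) 1 x - dφ φ (other ℓ) 0 x) ^ 2 /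
      (dφ φ 0 0 x * dφ φ 1 1 x - dφ φ 0 1 x * dφ φ 1 0 x) ^ 2 *
    (-2 * irregularTerm ν (√(∑ j, dφ φ j 1 x ^ 2))
      - 2 * irregularTerm ν (√(∑ j, dφ φ j 0 x ^ 2))
      + irregularTerm ν (√(∑ j, (dφ φ j 0 x + dφ φ j 1 x) ^ 2))
      + irregularTerm ν (√(∑ j, (dφ φ j 1 x - dφ φ j 0 x) ^ 2)))

end DeformedLattice

end

open MeasureTheory ProbabilityTheory Filter Set
open scoped Topology

noncomputable section

namespace DeformedLattice

/-! The weights of the second-order difference on a lattice cell annihilate affine functions. In a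
double sum of weights against the covariance the terms in `‖x - y‖ ^ 0` and `‖x - y‖ ^ 2` therefore
vanish, and these are the only polynomial terms because `ν < 2`. What remains of the variance is the
energy of the irregular term plus a remainder of smaller order. Modulo multiples of `t ^ 2`, which
are invisible for the same reason, `G_s` is a nonzero multiple of the kernel `(t ^ (2 s) - t ^ 2) /
(s - 1)`. This kernel is continuous in `s` through the logarithmic case `s = 1` and homogeneous of
degree `2 s` modulo `t ^ 2`. Cells rescaled by `n` converge uniformly to parallelograms spanned by
the partial derivatives of `φ`, so the variances sum to about `γ n ^ (4 - 2 ν)` times a mean energy,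
with `γ = β ν * kernelFactor ν`.

Deterministic part. On a parallelogram the energy is a squared weight times a kernel combination
that is strictly positive for every `s` in `[0, 2]`, by convexity and the parallelogram law
(`kernel_parallelogram_pos`). Since the weight is nonzero near some point, the mean energies are
bounded below uniformly in `s` (`exists_meanEnergy_ge`). Doubling `θ` doubles the limit cells, so
`F̄_n(s)` converges to `2 ^ (2 s - 2)` uniformly on `[0, 2]` (`eventually_ratioF_sub`). This limit
is injective in `s`, and comparing the contrast at a minimiser with its value at `ν` gives
convergence (`tendsto_argmin`).

Probabilistic part. The quadratic variation is the squared norm of a centred Gaussian vector, and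
its fluctuations are controlled by the Hilbert–Schmidt norm of the covariance matrix
(`measureReal_sum_sq_sub_ge_le`). Pairs of cells within `√n` indices are few and are bounded by
Cauchy–Schwarz. For the other pairs, Taylor expansion in both variables and the fourth-order bound
give covariances of order `n ^ (-ν)` (`exists_abs_diffCov_far_le`). The Hilbert–Schmidt norm is then
smaller than `n ^ (4 - 2 ν)` by a power of `n`, and Borel–Cantelli gives almost sure convergence of
the normalised variations (`ae_tendsto_quadVar`). -/

/-! ### Concentration of the squared norm of a Gaussian vector -/

/-- With `y = 2 u v` this bounds the factor `(1 - 2 u v) ^ (-1/2)` in the Laplace transform of a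
squared Gaussian. For `y ≥ 0` the quadratic lower bound of the exponential is used, for `y ≤ 0` the
linear one. -/
theorem one_le_one_sub_mul_exp {y : ℝ} (hy : |y| ≤ 1 / 2) :
    1 ≤ (1 - y) * Real.exp (y + y ^ 2) := by
  obtain ⟨h1, h2⟩ := abs_le.1 hy
  have hpos : 0 < 1 - y := by linarith
  rcases le_total 0 y with h | h
  · have hz : 0 ≤ y + y ^ 2 := by positivity
    have := Real.quadratic_le_exp_of_nonneg hz
    refine le_trans ?_ (mul_le_mul_of_nonneg_left this hpos.le)
    have : 0 ≤ y ^ 2 * (1 - y - y ^ 2 - y ^ 3) := by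
      apply mul_nonneg (by positivity)
      have : y ^ 2 ≤ 1 / 4 := by nlinarith
      have : y ^ 3 ≤ 1 / 8 := by nlinarith
      linarith
    nlinarith
  · have := Real.add_one_le_exp (y + y ^ 2)
    refine le_trans ?_ (mul_le_mul_of_nonneg_left this hpos.le)
    have : 0 ≤ -y ^ 3 := by
      have : 0 ≤ (-y) ^ 3 := by apply pow_nonneg; linarith
      nlinarith
    nlinarith

/-- The Laplace transform of the centred square of a centred Gaussian variable. -/
theorem integral_exp_sq_gaussianReal (v : NNReal) (u : ℝ) (hu : |u| * v ≤ 1 / 4) :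
    Integrable (fun x : ℝ => Real.exp (u * (x ^ 2 - v))) (gaussianReal 0 v) ∧
      ∫ x, Real.exp (u * (x ^ 2 - v)) ∂(gaussianReal 0 v) ≤ Real.exp (2 * u ^ 2 * v ^ 2) := by
  -- Variance zero means a Dirac mass, which has no density.
  by_cases hv : v = 0
  · subst hv
    simp only [gaussianReal_zero_var]
    refine ⟨integrable_dirac (by simp), ?_⟩
    simp
  have hv0 : (0 : ℝ) < v := by positivity
  have huv : |2 * u * v| ≤ 1 / 2 := by
    rw [abs_mul, abs_mul, abs_of_pos hv0]; simp; nlinarith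
  have hb : 0 < 1 / (2 * v) - u := by
    have := (abs_le.1 huv).2
    rw [sub_pos, lt_div_iff₀ (by positivity)]; nlinarith
  have hfun : ∀ x : ℝ, gaussianPDFReal 0 v x • Real.exp (u * (x ^ 2 - v)) =
      (√(2 * Real.pi * v))⁻¹ * Real.exp (-(u * v)) * Real.exp (-(1 / (2 * v) - u) * x ^ 2) := by
    intro x
    rw [gaussianPDFReal, smul_eq_mul, mul_assoc _ (Real.exp _), mul_assoc _ (Real.exp _),
      ← Real.exp_add, ← Real.exp_add]
    congr 2
    field_simp
    ring
  have hint : Integrable (fun x : ℝ => gaussianPDFReal 0 v x • Real.exp (u * (x ^ 2 - v))) := by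
    simp_rw [hfun]
    exact (integrable_exp_neg_mul_sq hb).const_mul _
  constructor
  · rw [gaussianReal_of_var_ne_zero _ hv,
      integrable_withDensity_iff_integrable_smul' (measurable_gaussianPDF _ _)
        (ae_of_all _ fun x => by simp [gaussianPDF])]
    refine hint.congr (ae_of_all _ fun x => ?_)
    simp [toReal_gaussianPDF]
  · rw [integral_gaussianReal_eq_integral_smul hv]
    simp_rw [hfun]
    rw [integral_const_mul, integral_gaussian]
    have h1y : 0 < 1 - 2 * u * v := by have := (abs_le.1 huv).2; linarith
    have e1 : √(Real.pi / (1 / (2 * v) - u)) = √(2 * Real.pi * v) * √(1 / (1 - 2 * u * v)) := by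
      rw [← Real.sqrt_mul (by positivity)]
      congr 1
      field_simp
    rw [e1]
    have hs : √(2 * Real.pi * v) ≠ 0 := by positivity
    have e2 : (√(2 * Real.pi * v))⁻¹ * Real.exp (-(u * v)) *
        (√(2 * Real.pi * v) * √(1 / (1 - 2 * u * v))) =
        Real.exp (-(u * v)) * √(1 / (1 - 2 * u * v)) := by field_simp
    rw [e2]
    have h1 := one_le_one_sub_mul_exp huv
    have h2 : √(1 / (1 - 2 * u * v)) ≤ Real.exp (u * v + 2 * u ^ 2 * v ^ 2) := by
      apply Real.sqrt_le_iff.2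
      refine ⟨(Real.exp_pos _).le, ?_⟩
      rw [div_le_iff₀ h1y, ← Real.exp_nat_mul]
      calc (1 : ℝ) ≤ _ := h1
        _ = _ := by rw [mul_comm]; congr 2; push_cast; ring
    calc _ ≤ Real.exp (-(u * v)) * Real.exp (u * v + 2 * u ^ 2 * v ^ 2) := by gcongr
      _ = _ := by rw [← Real.exp_add]; congr 1; ring

variable {S : Type*} [MeasurableSpace S] {P : Measure S}

theorem mgf_sq_sub_variance_le [IsProbabilityMeasure P] {W : S → ℝ} (hW : HasGaussianLaw W P)
    (h0 : ∫ ω, W ω ∂P = 0) (u : ℝ) (hu : |u| * Var[W; P] ≤ 1 / 4) :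
    Integrable (fun ω => Real.exp (u * (W ω ^ 2 - Var[W; P]))) P ∧
      mgf (fun ω => W ω ^ 2 - Var[W; P]) P u ≤ Real.exp (2 * u ^ 2 * Var[W; P] ^ 2) := by
  have hlaw := hW.map_eq_gaussianReal
  rw [h0] at hlaw
  have hvar : ((Var[W; P]).toNNReal : ℝ) = Var[W; P] := Real.coe_toNNReal _ (variance_nonneg _ _)
  have key := integral_exp_sq_gaussianReal (Var[W; P]).toNNReal u (by rwa [hvar])
  rw [← hlaw, hvar] at key
  have hm : AEStronglyMeasurable (fun x : ℝ => Real.exp (u * (x ^ 2 - Var[W; P]))) (P.map W) := by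
    fun_prop
  refine ⟨?_, ?_⟩
  · exact (integrable_map_measure hm hW.aemeasurable).1 key.1
  · rw [integral_map hW.aemeasurable hm] at key
    exact key.2

theorem exists_orthogonal_diagonalization {ι : Type*} [Fintype ι] [DecidableEq ι]
    (Γ : Matrix ι ι ℝ) (hΓ : Γ.IsSymm) :
    ∃ (U : Matrix ι ι ℝ) (d : ι → ℝ), U * U.transpose = 1 ∧ U.transpose * U = 1 ∧
      U.transpose * Γ * U = Matrix.diagonal d := by
  have hH : Γ.IsHermitian := by
    rw [Matrix.IsHermitian, Matrix.conjTranspose_eq_transpose_of_trivial]; exact hΓ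
  refine ⟨hH.eigenvectorUnitary, hH.eigenvalues, ?_, ?_, ?_⟩
  · have := (Matrix.mem_unitaryGroup_iff).1 hH.eigenvectorUnitary.2
    rwa [Matrix.star_eq_conjTranspose, Matrix.conjTranspose_eq_transpose_of_trivial] at this
  · have := (Matrix.mem_unitaryGroup_iff').1 hH.eigenvectorUnitary.2
    rwa [Matrix.star_eq_conjTranspose, Matrix.conjTranspose_eq_transpose_of_trivial] at this
  · have := hH.conjStarAlgAut_star_eigenvectorUnitary
    rw [Unitary.conjStarAlgAut_apply] at this
    simpa [Matrix.star_eq_conjTranspose, Matrix.conjTranspose_eq_transpose_of_trivial] using this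

theorem sum_sq_eq_trace_mul_transpose {ι : Type*} [Fintype ι] (A : Matrix ι ι ℝ) :
    ∑ i, ∑ j, A i j ^ 2 = (A * A.transpose).trace := by
  simp [Matrix.trace, Matrix.mul_apply, pow_two]

/-- Sum of squares of a centred Gaussian vector: one-sided Laplace transform bound. -/
theorem mgf_sum_sq_le [IsProbabilityMeasure P] {ι : Type*} [Fintype ι]
    {Y : ι → S → ℝ} (hY : HasGaussianLaw (fun ω i => Y i ω) P) (h0 : ∀ i, ∫ ω, Y i ω ∂P = 0)
    {H : ℝ} (hH : 0 < H) (hΓ : ∑ i, ∑ j, cov[Y i, Y j; P] ^ 2 ≤ H ^ 2) {u : ℝ}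
    (hu : |u| * H = 1 / 4) :
    Integrable (fun ω => Real.exp (u * (∑ i, Y i ω ^ 2 - ∑ i, cov[Y i, Y i; P]))) P ∧
      mgf (fun ω => ∑ i, Y i ω ^ 2 - ∑ i, cov[Y i, Y i; P]) P u ≤ Real.exp (1 / 8) := by
  classical
  set Γ : Matrix ι ι ℝ := Matrix.of fun i j => cov[Y i, Y j; P] with hΓdef
  obtain ⟨U, d, hU1, hU2, hd⟩ := exists_orthogonal_diagonalization Γ
    (by ext i j; simp [hΓdef, covariance_comm])
  set W : ι → S → ℝ := fun j ω => ∑ i, U i j * Y i ω with hW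
  have hY2 : ∀ i, MemLp (Y i) 2 P := fun i => (hY.eval i).memLp_two
  have hWg : HasGaussianLaw (fun ω j => W j ω) P := by
    have := hY.map_fun (LinearMap.toContinuousLinearMap (Matrix.toLin' U.transpose))
    have he : (fun ω j => W j ω) = fun ω =>
        (LinearMap.toContinuousLinearMap (Matrix.toLin' U.transpose)) fun i => Y i ω := by
      funext ω j
      simp [hW, Matrix.toLin'_apply, Matrix.mulVec, dotProduct]
    rw [he]
    exact this
  have hcov : ∀ j l, cov[W j, W l; P] = Matrix.diagonal d j l := by
    intro j l
    rw [← hd, hW, covariance_fun_sum_fun_sum (fun i => (hY2 i).const_mul _)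
      (fun i => (hY2 i).const_mul _)]
    simp only [covariance_const_mul_left, covariance_const_mul_right, Matrix.mul_apply,
      Matrix.transpose_apply, hΓdef, Matrix.of_apply, Finset.sum_mul]
    rw [Finset.sum_comm]
    refine Finset.sum_congr rfl fun a _ => Finset.sum_congr rfl fun b _ => by ring
  -- In the eigenbasis of the covariance matrix the coordinates are uncorrelated and jointly
  -- Gaussian, hence independent.
  have hind : iIndepFun W P := hWg.iIndepFun_of_covariance_eq_zero fun i j hij => by
    rw [hcov, Matrix.diagonal_apply_ne _ hij]
  have hvar : ∀ j, Var[W j; P] = d j := fun j => by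
    rw [← covariance_self (hWg.eval j).aemeasurable, hcov, Matrix.diagonal_apply_eq]
  have hmean : ∀ j, ∫ ω, W j ω ∂P = 0 := fun j => by
    rw [integral_finsetSum _ fun i _ => ((hY.eval i).integrable).const_mul _]
    simp [integral_const_mul, h0]
  have hΓU : Γ = U * Matrix.diagonal d * U.transpose := by
    rw [← hd]
    calc Γ = (U * U.transpose) * Γ * (U * U.transpose) := by rw [hU1]; simp
      _ = _ := by simp only [Matrix.mul_assoc]
  have htr : ∑ i, cov[Y i, Y i; P] = ∑ j, d j := by
    have : Γ.trace = (Matrix.diagonal d).trace := by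
      rw [hΓU, Matrix.trace_mul_comm, ← Matrix.mul_assoc, hU2, Matrix.one_mul]
    simpa [Matrix.trace, hΓdef] using this
  -- The Hilbert–Schmidt norm is invariant under orthogonal conjugation.
  have hd2 : ∑ j, d j ^ 2 ≤ H ^ 2 := by
    refine le_trans (le_of_eq ?_) hΓ
    have h1 := sum_sq_eq_trace_mul_transpose Γ
    have h2 : Γ * Γ.transpose = U * (Matrix.diagonal d * Matrix.diagonal d) * U.transpose := by
      conv_lhs => rw [hΓU]
      simp only [Matrix.transpose_mul, Matrix.transpose_transpose, Matrix.diagonal_transpose]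
      calc _ = U * Matrix.diagonal d * (U.transpose * U) * (Matrix.diagonal d * U.transpose) := by
            simp only [Matrix.mul_assoc]
        _ = _ := by rw [hU2]; simp only [Matrix.mul_assoc, Matrix.one_mul]
    rw [h2, Matrix.trace_mul_comm, ← Matrix.mul_assoc, hU2, Matrix.one_mul,
      Matrix.diagonal_mul_diagonal, Matrix.trace_diagonal] at h1
    simp only [hΓdef, Matrix.of_apply] at h1
    rw [h1]
    exact Finset.sum_congr rfl fun j _ => by ring
  have hsum : ∀ ω, ∑ j, W j ω ^ 2 = ∑ i, Y i ω ^ 2 := by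
    intro ω
    have : ∀ x : ι → ℝ, (Matrix.mulVec U.transpose x) ⬝ᵥ (Matrix.mulVec U.transpose x) = x ⬝ᵥ x := by
      intro x
      rw [Matrix.dotProduct_mulVec, Matrix.vecMul_transpose, Matrix.mulVec_mulVec, hU1,
        Matrix.one_mulVec]
    have h := this (fun i => Y i ω)
    simp only [dotProduct, Matrix.mulVec, Matrix.transpose_apply] at h
    simp only [hW, pow_two]
    exact h
  -- A single eigenvalue is at most the Hilbert–Schmidt bound `H`, so the one-dimensional estimate
  -- applies to every coordinate with the same `u`.
  have hdu : ∀ j, |u| * Var[W j; P] ≤ 1 / 4 := by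
    intro j
    rw [← hu]
    refine mul_le_mul_of_nonneg_left ?_ (abs_nonneg _)
    rw [hvar]
    refine abs_le_of_sq_le_sq' ?_ hH.le |>.2
    exact le_trans (Finset.single_le_sum (f := fun j => d j ^ 2) (fun i _ => sq_nonneg _)
      (Finset.mem_univ j)) hd2
  have hone := fun j => mgf_sq_sub_variance_le (hWg.eval j) (hmean j) u (hdu j)
  have hZ : iIndepFun (fun j ω => W j ω ^ 2 - Var[W j; P]) P :=
    hind.comp (fun j x => x ^ 2 - Var[W j; P]) fun j => by fun_prop
  have hZm : ∀ j, AEMeasurable (fun ω => W j ω ^ 2 - Var[W j; P]) P := fun j =>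
    ((hWg.eval j).aemeasurable.pow_const 2).sub_const _
  have hfun : (fun ω => ∑ i, Y i ω ^ 2 - ∑ i, cov[Y i, Y i; P]) =
      ∑ j, fun ω => W j ω ^ 2 - Var[W j; P] := by
    funext ω
    simp only [Finset.sum_apply, Finset.sum_sub_distrib, hsum, hvar, htr]
  have hmgf : mgf (fun ω => ∑ i, Y i ω ^ 2 - ∑ i, cov[Y i, Y i; P]) P u =
      ∏ j, mgf (fun ω => W j ω ^ 2 - Var[W j; P]) P u := by
    rw [hfun, hZ.mgf_sum₀ hZm]
  -- A positive `mgf` forces integrability, because the integral of a non-integrable function is `0`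
  -- by convention.
  have hpos : 0 < mgf (fun ω => ∑ i, Y i ω ^ 2 - ∑ i, cov[Y i, Y i; P]) P u := by
    rw [hmgf]
    exact Finset.prod_pos fun j _ => mgf_pos (hone j).1
  refine ⟨mgf_pos_iff.1 hpos, ?_⟩
  rw [hmgf]
  calc _ ≤ ∏ j, Real.exp (2 * u ^ 2 * Var[W j; P] ^ 2) :=
        Finset.prod_le_prod (fun _ _ => mgf_nonneg) fun j _ => (hone j).2
    _ = Real.exp (2 * u ^ 2 * ∑ j, d j ^ 2) := by
        rw [← Real.exp_sum, Finset.mul_sum]; simp only [hvar]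
    -- From `|u| * H = 1 / 4` one gets `2 * u ^ 2 * H ^ 2 = 1 / 8`.
    _ ≤ Real.exp (1 / 8) := by
        apply Real.exp_le_exp.2
        have : u ^ 2 * H ^ 2 = 1 / 16 := by
          rw [← sq_abs u, ← mul_pow, hu]; norm_num
        nlinarith [mul_le_mul_of_nonneg_left hd2 (sq_nonneg u)]

/-- A Hanson–Wright type tail bound for the squared norm of a centred Gaussian vector. -/
theorem measureReal_sum_sq_sub_ge_le [IsProbabilityMeasure P] {ι : Type*} [Fintype ι]
    {Y : ι → S → ℝ} (hY : HasGaussianLaw (fun ω i => Y i ω) P) (h0 : ∀ i, ∫ ω, Y i ω ∂P = 0)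
    {H : ℝ} (hH : 0 < H) (hΓ : ∑ i, ∑ j, cov[Y i, Y j; P] ^ 2 ≤ H ^ 2) (t : ℝ) :
    P.real {ω | t ≤ |∑ i, Y i ω ^ 2 - ∑ i, cov[Y i, Y i; P]|} ≤
      2 * Real.exp (1 / 8 - t / (4 * H)) := by
  set Z : S → ℝ := fun ω => ∑ i, Y i ω ^ 2 - ∑ i, cov[Y i, Y i; P] with hZ
  -- Chernoff's bound for both tails, at the values `± 1 / (4 * H)` admitted by the Laplace
  -- estimate.
  have hu : (0 : ℝ) ≤ 1 / (4 * H) := by positivity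
  have h1 := mgf_sum_sq_le hY h0 hH hΓ (u := 1 / (4 * H))
    (by rw [abs_of_nonneg hu]; field_simp)
  have h2 := mgf_sum_sq_le hY h0 hH hΓ (u := -(1 / (4 * H)))
    (by rw [abs_neg, abs_of_nonneg hu]; field_simp)
  have t1 := measure_ge_le_exp_mul_mgf t hu h1.1
  have t2 := measure_le_le_exp_mul_mgf (-t) (neg_nonpos.2 hu) h2.1
  have e : ∀ m : ℝ, m ≤ Real.exp (1 / 8) →
      Real.exp (-(1 / (4 * H)) * t) * m ≤ Real.exp (1 / 8 - t / (4 * H)) := by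
    intro m hm
    calc _ ≤ Real.exp (-(1 / (4 * H)) * t) * Real.exp (1 / 8) := by gcongr
      _ = _ := by rw [← Real.exp_add]; congr 1; ring
  have hsub : {ω | t ≤ |Z ω|} ⊆ {ω | t ≤ Z ω} ∪ {ω | Z ω ≤ -t} := by
    intro ω hω
    rcases le_abs.1 (show t ≤ |Z ω| from hω) with h | h
    · exact Or.inl h
    · exact Or.inr (show Z ω ≤ -t by linarith)
  calc P.real {ω | t ≤ |Z ω|} ≤ P.real ({ω | t ≤ Z ω} ∪ {ω | Z ω ≤ -t}) :=
        measureReal_mono hsub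
    _ ≤ P.real {ω | t ≤ Z ω} + P.real {ω | Z ω ≤ -t} := measureReal_union_le _ _
    _ ≤ Real.exp (1 / 8 - t / (4 * H)) + Real.exp (1 / 8 - t / (4 * H)) := by
        refine add_le_add (t1.trans (e _ h1.2)) (t2.trans ?_)
        have := e _ h2.2
        simpa using this
    _ = _ := by ring

/-! ### The kernel and its positivity on parallelograms -/

/-- The function `(t ^ (2 s) - t ^ 2) / (s - 1)`, continuously extended to `s = 1`. -/
def kernel (s t : ℝ) : ℝ :=
  t ^ 2 * (2 * Real.log t) * dslope Real.exp 0 (2 * (s - 1) * Real.log t)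

/-- The factor by which `irregularTerm` and `kernel` differ, up to a multiple of `t ^ 2`. -/
def kernelFactor (s : ℝ) : ℝ := if s = 1 then 1 / 2 else s - 1

theorem kernelFactor_ne_zero (s : ℝ) : kernelFactor s ≠ 0 := by
  unfold kernelFactor
  split_ifs with h
  · norm_num
  · exact sub_ne_zero.2 h

theorem continuous_dslope_exp : Continuous (dslope Real.exp 0) := by
  rw [continuous_iff_continuousAt]
  intro b
  rcases eq_or_ne b 0 with rfl | h
  · exact continuousAt_dslope_same.2 Real.differentiable_exp.differentiableAt
  · exact (continuousAt_dslope_of_ne h).2 Real.continuous_exp.continuousAt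

theorem mul_dslope_exp (x : ℝ) : x * dslope Real.exp 0 x = Real.exp x - 1 := by
  have := sub_smul_dslope Real.exp 0 x
  simpa using this

theorem continuous_kernel_left (t : ℝ) : Continuous fun s => kernel s t := by
  unfold kernel
  exact continuous_const.mul (continuous_dslope_exp.comp (by fun_prop))

/-- The point `t = 0` has to be excluded: for `s = 0` the kernel is `t ^ 2 - 1` at `t > 0` but
vanishes at `t = 0`. -/
theorem continuousAt_kernel {s t : ℝ} (ht : t ≠ 0) :
    ContinuousAt (fun p : ℝ × ℝ => kernel p.1 p.2) (s, t) := by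
  unfold kernel
  have hl : ContinuousAt (fun p : ℝ × ℝ => Real.log p.2) (s, t) :=
    ContinuousAt.log continuousAt_snd ht
  have h2 : ContinuousAt (fun p : ℝ × ℝ => 2 * (p.1 - 1) * Real.log p.2) (s, t) :=
    ContinuousAt.mul (by fun_prop) hl
  exact (ContinuousAt.mul (by fun_prop) (continuousAt_const.mul hl)).mul
    (continuous_dslope_exp.continuousAt.comp h2)

@[simp] theorem kernel_zero (s : ℝ) : kernel s 0 = 0 := by simp [kernel]

theorem rpow_two_mul_eq {s t : ℝ} (ht : 0 < t) :
    t ^ (2 * s) = t ^ 2 * Real.exp (2 * (s - 1) * Real.log t) := by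
  rw [Real.rpow_def_of_pos ht, ← Real.rpow_natCast t 2, Real.rpow_def_of_pos ht, ← Real.exp_add]
  congr 1
  push_cast
  ring

theorem sub_one_mul_kernel {s t : ℝ} (ht : 0 < t) :
    (s - 1) * kernel s t = t ^ (2 * s) - t ^ 2 := by
  rw [rpow_two_mul_eq ht, kernel]
  have := mul_dslope_exp (2 * (s - 1) * Real.log t)
  linear_combination t ^ 2 * this

theorem kernel_one (t : ℝ) : kernel 1 t = 2 * (t ^ 2 * Real.log t) := by
  simp [kernel]; ring

/-- The kernel scales like `t ^ (2 s)` modulo multiples of `t ^ 2`. -/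
theorem kernel_mul {s h t : ℝ} (hh : 0 < h) (ht : 0 ≤ t) :
    kernel s (h * t) = h ^ (2 * s) * kernel s t + kernel s h * t ^ 2 := by
  rcases ht.eq_or_lt with rfl | ht
  · simp
  rcases eq_or_ne s 1 with rfl | hs
  · simp only [kernel_one, Real.log_mul hh.ne' ht.ne', mul_one]
    rw [Real.rpow_two]
    ring
  · apply mul_left_cancel₀ (sub_ne_zero.2 hs)
    rw [sub_one_mul_kernel (by positivity), mul_add, mul_left_comm, sub_one_mul_kernel ht,
      ← mul_assoc, sub_one_mul_kernel hh, Real.mul_rpow hh.le ht.le]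
    ring

/-- The only integer in `(0, 2)` is `1`, where the kernel is `2 t ^ 2 log t`. For other `s` the
power differs from `(s - 1)` times the kernel by `t ^ 2`, which the second-order differences do not
see. -/
theorem irregularTerm_eq_kernel {s t : ℝ} (hs : s ∈ Ioo (0 : ℝ) 2) (ht : 0 ≤ t) :
    irregularTerm s t = kernelFactor s * kernel s t + (if s = 1 then 0 else 1) * t ^ 2 := by
  unfold irregularTerm kernelFactor
  rcases ht.eq_or_lt with rfl | ht
  · simp
  rw [if_neg ht.ne']
  rcases eq_or_ne s 1 with rfl | h1
  · rw [if_pos ⟨1, by simp⟩, kernel_one]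
    simp only [if_true, mul_one]
    rw [Real.rpow_two]
    ring
  · rw [if_neg, if_neg h1, if_neg h1, sub_one_mul_kernel ht]
    · ring
    · rintro ⟨k, rfl⟩
      have h0 : (0 : ℤ) < k := by exact_mod_cast hs.1
      have h2 : k < (2 : ℤ) := by exact_mod_cast hs.2
      have : k = 1 := by lia
      exact h1 (by simp [this])

/-- The kernel combination attached to a parallelogram with sides of squared lengths `α`, `γ` and
diagonals of squared lengths `p`, `q` is positive. -/
theorem kernel_parallelogram_pos_aux {s α γ p q : ℝ} (hs : 0 ≤ s) (hα : 0 < α) (hγ : 0 < γ)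
    (hp : 0 < p) (hq : 0 < q) (h : p + q = 2 * (α + γ)) :
    0 < kernel s √p + kernel s √q - 2 * kernel s √α - 2 * kernel s √γ := by
  -- Let `f` be `x log x` for `s = 1` and `x ^ s` otherwise. Midpoint convexity gives `f p + f q ≥ 2
  -- f (α + γ)`. Monotonicity of `f x / x` gives the strict inequality `f (α + γ) > f α + f γ`. For
  -- `s < 1` both inequalities are reversed, and the negative factor `s - 1` restores the sign.
  have hmid : (2 : ℝ)⁻¹ * p + (2 : ℝ)⁻¹ * q = α + γ := by linarith
  have hαγ : 0 < α + γ := by positivity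
  rcases eq_or_ne s 1 with rfl | h1
  · simp only [kernel_one]
    rw [Real.sq_sqrt hp.le, Real.sq_sqrt hq.le, Real.sq_sqrt hα.le, Real.sq_sqrt hγ.le,
      Real.log_sqrt hp.le, Real.log_sqrt hq.le, Real.log_sqrt hα.le, Real.log_sqrt hγ.le]
    have hc := Real.convexOn_mul_log.2 hp.le hq.le (by norm_num : (0 : ℝ) ≤ 2⁻¹)
      (by norm_num : (0 : ℝ) ≤ 2⁻¹) (by norm_num)
    simp only [smul_eq_mul] at hc
    rw [hmid] at hc
    have l1 := mul_lt_mul_of_pos_left (Real.log_lt_log hα (by linarith : α < α + γ)) hα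
    have l2 := mul_lt_mul_of_pos_left (Real.log_lt_log hγ (by linarith : γ < α + γ)) hγ
    nlinarith
  · have hk : ∀ x : ℝ, 0 < x → (s - 1) * kernel s √x = x ^ s - x := by
      intro x hx
      rw [sub_one_mul_kernel (Real.sqrt_pos.2 hx), Real.sq_sqrt hx.le, Real.sqrt_eq_rpow,
        ← Real.rpow_mul hx.le]
      congr 2
      ring
    have hsplit : ∀ x : ℝ, 0 < x → x ^ s = x * x ^ (s - 1) := by
      intro x hx
      rw [Real.rpow_sub_one hx.ne']
      field_simp
    have hsum : (s - 1) * (kernel s √p + kernel s √q - 2 * kernel s √α - 2 * kernel s √γ) =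
        p ^ s + q ^ s - 2 * α ^ s - 2 * γ ^ s := by
      linear_combination hk p hp + hk q hq - 2 * hk α hα - 2 * hk γ hγ - h
    rcases lt_or_gt_of_ne h1 with hlt | hgt
    · have hc := (Real.concaveOn_rpow hs hlt.le).2 hp.le hq.le (by norm_num : (0 : ℝ) ≤ 2⁻¹)
        (by norm_num : (0 : ℝ) ≤ 2⁻¹) (by norm_num)
      simp only [smul_eq_mul] at hc
      rw [hmid] at hc
      have l1 := mul_lt_mul_of_pos_left
        (Real.rpow_lt_rpow_of_neg hα (by linarith : α < α + γ) (by linarith : s - 1 < 0)) hα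
      have l2 := mul_lt_mul_of_pos_left
        (Real.rpow_lt_rpow_of_neg hγ (by linarith : γ < α + γ) (by linarith : s - 1 < 0)) hγ
      rw [hsplit _ hαγ] at hc
      rw [hsplit _ hα, hsplit _ hγ] at hsum
      by_contra hcon
      push Not at hcon
      have := mul_nonneg_of_nonpos_of_nonpos (by linarith : s - 1 ≤ 0) hcon
      nlinarith
    · have hc := (convexOn_rpow hgt.le).2 hp.le hq.le (by norm_num : (0 : ℝ) ≤ 2⁻¹)
        (by norm_num : (0 : ℝ) ≤ 2⁻¹) (by norm_num)
      simp only [smul_eq_mul] at hc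
      rw [hmid] at hc
      have l1 := mul_lt_mul_of_pos_left
        (Real.rpow_lt_rpow hα.le (by linarith : α < α + γ) (by linarith : 0 < s - 1)) hα
      have l2 := mul_lt_mul_of_pos_left
        (Real.rpow_lt_rpow hγ.le (by linarith : γ < α + γ) (by linarith : 0 < s - 1)) hγ
      rw [hsplit _ hαγ] at hc
      rw [hsplit _ hα, hsplit _ hγ] at hsum
      by_contra hcon
      push Not at hcon
      have := mul_nonpos_of_nonneg_of_nonpos (by linarith : 0 ≤ s - 1) hcon
      nlinarith

theorem kernel_parallelogram_pos {s : ℝ} (hs : 0 ≤ s) {a b : Plane} (ha : a ≠ 0) (hb : b ≠ 0)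
    (hab : a + b ≠ 0) (hab' : a - b ≠ 0) :
    0 < kernel s ‖a + b‖ + kernel s ‖a - b‖ - 2 * kernel s ‖a‖ - 2 * kernel s ‖b‖ := by
  have h := kernel_parallelogram_pos_aux hs (α := ‖a‖ ^ 2) (γ := ‖b‖ ^ 2) (p := ‖a + b‖ ^ 2)
    (q := ‖a - b‖ ^ 2) (by positivity) (by positivity) (by positivity) (by positivity)
    (by have := parallelogram_law_with_norm ℝ a b; nlinarith)
  simpa [Real.sqrt_sq (norm_nonneg _)] using h

/-! ### Cells: four points, the weights of the second-order difference and its energy -/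

/-- The four corners of a deformed lattice cell. -/
abbrev Cell : Type := Fin 2 × Fin 2 → Plane

/-- The matrix of edge vectors at the corner `(0, 0)`. -/
def Cell.matA (y : Cell) : Matrix (Fin 2) (Fin 2) ℝ :=
  !![y (1, 0) 0 - y (0, 0) 0, y (1, 0) 1 - y (0, 0) 1;
     y (0, 1) 0 - y (0, 0) 0, y (0, 1) 1 - y (0, 0) 1]

/-- The matrix of edge vectors at the corner `(1, 1)`. -/
def Cell.matB (y : Cell) : Matrix (Fin 2) (Fin 2) ℝ :=
  !![y (1, 0) 0 - y (1, 1) 0, y (1, 0) 1 - y (1, 1) 1;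
     y (0, 1) 0 - y (1, 1) 0, y (0, 1) 1 - y (1, 1) 1]

/-- The weights of the second-order difference on a cell. -/
def Cell.weight (ℓ : Fin 2) (y : Cell) (k : Fin 2 × Fin 2) : ℝ :=
  !![y.matA⁻¹ ℓ 0 + y.matA⁻¹ ℓ 1, y.matB⁻¹ ℓ 1 - y.matA⁻¹ ℓ 1;
     y.matB⁻¹ ℓ 0 - y.matA⁻¹ ℓ 0, -y.matB⁻¹ ℓ 0 - y.matB⁻¹ ℓ 1] k.1 k.2

/-- A cell is regular if both matrices of edge vectors are invertible. -/
def Cell.Regular (y : Cell) : Prop := y.matA.det ≠ 0 ∧ y.matB.det ≠ 0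

/-- The quadratic form of the kernel at the weights of the second-order difference. -/
def Cell.energy (ℓ : Fin 2) (s : ℝ) (y : Cell) : ℝ :=
  ∑ k, ∑ l, y.weight ℓ k * y.weight ℓ l * kernel s ‖y k - y l‖

theorem matA_eq_cell (φ : Plane → Plane) (n θ i₁ i₂ : ℕ) :
    matA φ n θ i₁ i₂ = Cell.matA (corner φ n θ i₁ i₂) := by
  simp [matA, Cell.matA, corner]

theorem matB_eq_cell (φ : Plane → Plane) (n θ i₁ i₂ : ℕ) :
    matB φ n θ i₁ i₂ = Cell.matB (corner φ n θ i₁ i₂) := by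
  simp [matB, Cell.matB, corner]

theorem coeff_eq_weight (φ : Plane → Plane) (n θ : ℕ) (ℓ : Fin 2) (i₁ i₂ : ℕ) :
    coeff φ n θ ℓ i₁ i₂ = Cell.weight ℓ (corner φ n θ i₁ i₂) := by
  funext k
  simp only [coeff, Cell.weight, matA_eq_cell, matB_eq_cell]

theorem Cell.matA_scale (y : Cell) (r : ℝ) (p : Plane) :
    Cell.matA (fun k => r • (y k - p)) = r • y.matA := by
  ext i j
  fin_cases i <;> fin_cases j <;> simp [Cell.matA] <;> ring

theorem Cell.matB_scale (y : Cell) (r : ℝ) (p : Plane) :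
    Cell.matB (fun k => r • (y k - p)) = r • y.matB := by
  ext i j
  fin_cases i <;> fin_cases j <;> simp [Cell.matB] <;> ring

theorem inv_smul_fin_two (A : Matrix (Fin 2) (Fin 2) ℝ) {r : ℝ} (hr : r ≠ 0) :
    (r • A)⁻¹ = r⁻¹ • A⁻¹ := by
  rw [Matrix.inv_def, Matrix.inv_def, Matrix.adjugate_smul, Matrix.det_smul]
  simp only [Ring.inverse_eq_inv', smul_smul, Fintype.card_fin]
  congr 1
  simp only [mul_inv]
  field_simp
  simp

theorem Cell.weight_scale (ℓ : Fin 2) (y : Cell) {r : ℝ} (hr : r ≠ 0) (p : Plane)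
    (k : Fin 2 × Fin 2) : Cell.weight ℓ (fun k => r • (y k - p)) k = r⁻¹ * y.weight ℓ k := by
  obtain ⟨i, j⟩ := k
  fin_cases i <;> fin_cases j <;>
    simp [Cell.weight, Cell.matA_scale, Cell.matB_scale, inv_smul_fin_two _ hr] <;> ring

theorem Cell.regular_scale_iff (y : Cell) {r : ℝ} (hr : r ≠ 0) (p : Plane) :
    Cell.Regular (fun k => r • (y k - p)) ↔ y.Regular := by
  simp [Cell.Regular, Cell.matA_scale, Cell.matB_scale, hr]

theorem Cell.sum_weight (ℓ : Fin 2) (y : Cell) : ∑ k, y.weight ℓ k = 0 := by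
  simp [Fintype.sum_prod_type, Fin.sum_univ_two, Cell.weight]
  ring

/-- The identities `A⁻¹ A = 1 = B⁻¹ B` say that both gradient approximations are exact on linear
functions, so their difference annihilates the coordinates. -/
theorem Cell.sum_weight_smul (ℓ : Fin 2) {y : Cell} (hy : y.Regular) :
    ∑ k, y.weight ℓ k • y k = 0 := by
  have hA := Matrix.nonsing_inv_mul y.matA (isUnit_iff_ne_zero.2 hy.1)
  have hB := Matrix.nonsing_inv_mul y.matB (isUnit_iff_ne_zero.2 hy.2)
  ext j
  have hAj := congrFun (congrFun hA ℓ) j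
  have hBj := congrFun (congrFun hB ℓ) j
  have hAB := hAj.trans hBj.symm
  simp only [Matrix.mul_apply, Fin.sum_univ_two] at hAB
  simp only [Fintype.sum_prod_type, Fin.sum_univ_two, PiLp.add_apply, PiLp.smul_apply, smul_eq_mul,
    PiLp.zero_apply]
  fin_cases j <;> simp [Cell.matA, Cell.matB, Cell.weight] at hAB ⊢ <;> linarith

/-- Expanding the square, the terms `‖y k‖ ^ 2` and `‖y l‖ ^ 2` are killed by `∑ c = 0`, and the
inner product by `∑ c • y = 0`. -/
theorem sum_mul_norm_sub_sq {ι E : Type*} [Fintype ι] [NormedAddCommGroup E]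
    [InnerProductSpace ℝ E] (c : ι → ℝ) (y : ι → E) (h0 : ∑ k, c k = 0)
    (h1 : ∑ k, c k • y k = 0) : ∑ k, ∑ l, c k * c l * ‖y k - y l‖ ^ 2 = 0 := by
  have e : ∀ k l, c k * c l * ‖y k - y l‖ ^ 2 = c k * ‖y k‖ ^ 2 * c l +
      c k * (c l * ‖y l‖ ^ 2) - 2 * inner ℝ (c k • y k) (c l • y l) := by
    intro k l
    rw [norm_sub_sq_real, real_inner_smul_left, real_inner_smul_right]
    ring
  simp only [e, Finset.sum_sub_distrib, Finset.sum_add_distrib, ← Finset.mul_sum, h0, mul_zero,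
    ← inner_sum, h1, inner_zero_right]
  simp [← Finset.sum_mul, h0]

/-- Each of the two weights contributes `r⁻¹` and the kernel `r ^ (2 s)`. The anomalous `t ^ 2` term
in `kernel_mul`, which carries the logarithm when `s = 1`, is annihilated. -/
theorem Cell.energy_scale (ℓ : Fin 2) (s : ℝ) {y : Cell} (hy : y.Regular) {r : ℝ} (hr : 0 < r)
    (p : Plane) :
    Cell.energy ℓ s (fun k => r • (y k - p)) = r ^ (2 * s - 2) * y.energy ℓ s := by
  have h := sum_mul_norm_sub_sq _ y (y.sum_weight ℓ) (Cell.sum_weight_smul ℓ hy)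
  have hn : ∀ k l, ‖r • (y k - p) - r • (y l - p)‖ = r * ‖y k - y l‖ := by
    intro k l
    rw [← smul_sub, sub_sub_sub_cancel_right, norm_smul, Real.norm_of_nonneg hr.le]
  have e : ∀ k l, Cell.weight ℓ (fun k => r • (y k - p)) k *
      Cell.weight ℓ (fun k => r • (y k - p)) l * kernel s ‖r • (y k - p) - r • (y l - p)‖ =
      r ^ (2 * s - 2) * (y.weight ℓ k * y.weight ℓ l * kernel s ‖y k - y l‖) +
      r⁻¹ * r⁻¹ * kernel s r * (y.weight ℓ k * y.weight ℓ l * ‖y k - y l‖ ^ 2) := by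
    intro k l
    rw [hn, kernel_mul hr (norm_nonneg _), Cell.weight_scale ℓ y hr.ne',
      Cell.weight_scale ℓ y hr.ne', Real.rpow_sub hr, Real.rpow_two]
    field_simp
  simp only [Cell.energy, e, Finset.sum_add_distrib, ← Finset.mul_sum, h, mul_zero, add_zero]

theorem Cell.sum_irregularTerm (ℓ : Fin 2) {s : ℝ} (hs : s ∈ Ioo (0 : ℝ) 2) {y : Cell}
    (hy : y.Regular) :
    ∑ k, ∑ l, y.weight ℓ k * y.weight ℓ l * irregularTerm s ‖y k - y l‖ =
      kernelFactor s * y.energy ℓ s := by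
  have h := sum_mul_norm_sub_sq _ y (y.sum_weight ℓ) (Cell.sum_weight_smul ℓ hy)
  have e : ∀ k l, y.weight ℓ k * y.weight ℓ l * irregularTerm s ‖y k - y l‖ =
      kernelFactor s * (y.weight ℓ k * y.weight ℓ l * kernel s ‖y k - y l‖) +
      (if s = 1 then 0 else 1) * (y.weight ℓ k * y.weight ℓ l * ‖y k - y l‖ ^ 2) := by
    intro k l
    rw [irregularTerm_eq_kernel hs (norm_nonneg _)]
    ring
  simp only [Cell.energy, e, Finset.sum_add_distrib, ← Finset.mul_sum, h, mul_zero, add_zero]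

/-! ### Continuity -/

theorem Cell.continuous_matA : Continuous Cell.matA := by
  refine continuous_matrix fun i j => ?_
  fin_cases i <;> fin_cases j <;> simp only [Cell.matA] <;> simp <;> fun_prop

theorem Cell.continuous_matB : Continuous Cell.matB := by
  refine continuous_matrix fun i j => ?_
  fin_cases i <;> fin_cases j <;> simp only [Cell.matB] <;> simp <;> fun_prop

theorem continuousAt_inv_apply {X : Type*} [TopologicalSpace X]
    {A : X → Matrix (Fin 2) (Fin 2) ℝ} (hA : Continuous A) {x : X} (hx : (A x).det ≠ 0)
    (i j : Fin 2) : ContinuousAt (fun x => (A x)⁻¹ i j) x := by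
  simp only [Matrix.inv_def, Ring.inverse_eq_inv', Matrix.smul_apply, smul_eq_mul]
  exact (hA.matrix_det.continuousAt.inv₀ hx).mul
    (hA.matrix_adjugate.matrix_elem i j).continuousAt

theorem Cell.continuousAt_weight (ℓ : Fin 2) (k : Fin 2 × Fin 2) {y : Cell} (hy : y.Regular) :
    ContinuousAt (fun y : Cell => y.weight ℓ k) y := by
  have hA := fun j => continuousAt_inv_apply Cell.continuous_matA hy.1 ℓ j
  have hB := fun j => continuousAt_inv_apply Cell.continuous_matB hy.2 ℓ j
  obtain ⟨i, j⟩ := k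
  fin_cases i <;> fin_cases j <;> simp only [Cell.weight] <;> simp
  · exact (hA 0).add (hA 1)
  · exact (hB 1).sub (hA 1)
  · exact (hB 0).sub (hA 0)
  · exact (hB 0).neg.sub (hB 1)

/-- Injectivity keeps the off-diagonal distances away from `0`, where the kernel may be
discontinuous. The diagonal terms vanish identically. -/
theorem Cell.continuousAt_energy (ℓ : Fin 2) (s : ℝ) {y : Cell} (hy : y.Regular)
    (hinj : Function.Injective y) :
    ContinuousAt (fun p : ℝ × Cell => p.2.energy ℓ p.1) (s, y) := by
  unfold Cell.energy
  have hw : ∀ k, ContinuousAt (fun p : ℝ × Cell => p.2.weight ℓ k) (s, y) := fun k =>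
    ContinuousAt.comp (f := Prod.snd) (x := (s, y)) (Cell.continuousAt_weight ℓ k hy)
      continuousAt_snd
  refine tendsto_finsetSum _ fun k _ => tendsto_finsetSum _ fun l _ => ?_
  rcases eq_or_ne k l with rfl | hkl
  · simp
  · refine ((hw k).mul (hw l)).mul ?_
    have h1 : ContinuousAt (fun p : ℝ × Cell => (p.1, ‖p.2 k - p.2 l‖)) (s, y) := by fun_prop
    exact ContinuousAt.comp (f := fun p : ℝ × Cell => (p.1, ‖p.2 k - p.2 l‖))
      (g := fun p : ℝ × ℝ => kernel p.1 p.2)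
      (continuousAt_kernel (by simpa [sub_eq_zero] using hinj.ne hkl)) h1

theorem Cell.continuous_energy_left (ℓ : Fin 2) (y : Cell) : Continuous fun s => y.energy ℓ s := by
  unfold Cell.energy
  exact continuous_finsetSum _ fun k _ => continuous_finsetSum _ fun l _ =>
    continuous_const.mul (continuous_kernel_left _)

/-! ### The unit square and the deformation -/

theorem isCompact_unitSquare : IsCompact unitSquare := by
  have h : unitSquare =
      (EuclideanSpace.equiv (Fin 2) ℝ) ⁻¹' (Set.univ.pi fun _ => Icc (0 : ℝ) 1) := by
    ext x
    exact ⟨fun h j _ => h j, fun h j => h j trivial⟩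
  rw [h]
  exact (EuclideanSpace.equiv (Fin 2) ℝ).toHomeomorph.isCompact_preimage.2
    (isCompact_univ_pi fun _ => isCompact_Icc)

theorem convex_unitSquare : Convex ℝ unitSquare := by
  intro x hx y hy a b ha hb hab j
  simpa using (convex_Icc (0 : ℝ) 1) (hx j) (hy j) ha hb hab

/-- A function that is continuous at every point of a compact set is uniformly close to its values
there. -/
theorem exists_forall_dist_lt_of_isCompact {X Y : Type*} [PseudoMetricSpace X]
    [PseudoMetricSpace Y] {T : Set X} (hT : IsCompact T) {f : X → Y}
    (hf : ∀ x ∈ T, ContinuousAt f x) {ε : ℝ} (hε : 0 < ε) :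
    ∃ η > 0, ∀ x ∈ T, ∀ y, dist y x < η → dist (f y) (f x) < ε := by
  have h := hT.uniformContinuousAt_of_continuousAt f hf (Metric.dist_mem_uniformity hε)
  obtain ⟨η, hη, h⟩ := Metric.mem_uniformity_dist.1 h
  refine ⟨η, hη, fun x hx y hxy => ?_⟩
  rw [dist_comm]
  exact h (by rwa [dist_comm]) hx

/-- The corner of index `k` of the unit cell. -/
def cornerVec (k : Fin 2 × Fin 2) : Plane := !₂[((k.1 : ℕ) : ℝ), ((k.2 : ℕ) : ℝ)]

/-- The undeformed lattice point. -/
def latticePoint (n : ℕ) (i : ℕ × ℕ) : Plane := !₂[(i.1 : ℝ) / n, (i.2 : ℝ) / n]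

theorem corner_eq (φ : Plane → Plane) (n θ : ℕ) (i : ℕ × ℕ) (k : Fin 2 × Fin 2) :
    corner φ n θ i.1 i.2 k = φ (latticePoint n i + ((θ : ℝ) / n) • cornerVec k) := by
  unfold corner site
  congr 1
  ext j
  fin_cases j <;> simp [latticePoint, cornerVec] <;> ring

theorem norm_cornerVec_le (k : Fin 2 × Fin 2) : ‖cornerVec k‖ ≤ 2 := by
  obtain ⟨i, j⟩ := k
  rw [EuclideanSpace.norm_eq]
  apply Real.sqrt_le_iff.2
  fin_cases i <;> fin_cases j <;> (simp [cornerVec, Fin.sum_univ_two]; try norm_num)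

/-- The indices of the cells of side `θ`. -/
def cells (n θ : ℕ) : Finset (ℕ × ℕ) := Finset.Icc 1 (n - θ) ×ˢ Finset.Icc 1 (n - θ)

theorem latticePoint_add_mem {n θ : ℕ} {i : ℕ × ℕ} (hi : i ∈ cells n θ) (k : Fin 2 × Fin 2) :
    latticePoint n i + ((θ : ℝ) / n) • cornerVec k ∈ unitSquare := by
  simp only [cells, Finset.mem_product, Finset.mem_Icc] at hi
  obtain ⟨⟨h1, h2⟩, h3, h4⟩ := hi
  have hn : (0 : ℝ) < n := by exact_mod_cast (by lia : 0 < n)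
  have e1 : (i.1 : ℝ) + θ ≤ n := by exact_mod_cast (by lia : i.1 + θ ≤ n)
  have e2 : (i.2 : ℝ) + θ ≤ n := by exact_mod_cast (by lia : i.2 + θ ≤ n)
  have p1 : (0 : ℝ) ≤ i.1 := by positivity
  have p2 : (0 : ℝ) ≤ i.2 := by positivity
  have p3 : (0 : ℝ) ≤ θ := by positivity
  obtain ⟨a, b⟩ := k
  intro j
  fin_cases j <;> fin_cases a <;> fin_cases b <;>
    simp only [latticePoint, cornerVec] <;> simp <;> (try rw [← add_div]) <;>
    refine ⟨by positivity, ?_⟩ <;> rw [div_le_one hn] <;> linarith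

theorem latticePoint_mem {n θ : ℕ} {i : ℕ × ℕ} (hi : i ∈ cells n θ) :
    latticePoint n i ∈ unitSquare := by
  have := latticePoint_add_mem hi (0, 0)
  have h0 : cornerVec (0, 0) = 0 := by ext j; fin_cases j <;> simp [cornerVec]
  simpa [h0] using this

variable {φ : Plane → Plane} {O : Set Plane}

namespace IsDeformation

theorem differentiableAt (hφ : IsDeformation φ O) {x : Plane} (hx : x ∈ O) :
    DifferentiableAt ℝ φ x :=
  ((hφ.contDiffOn.contDiffAt (hφ.isOpen.mem_nhds hx)).differentiableAt (by norm_num))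

theorem continuousOn_fderiv (hφ : IsDeformation φ O) : ContinuousOn (fderiv ℝ φ) O :=
  hφ.contDiffOn.continuousOn_fderiv_of_isOpen hφ.isOpen (by norm_num)

theorem continuousOn (hφ : IsDeformation φ O) : ContinuousOn φ unitSquare :=
  hφ.contDiffOn.continuousOn.mono hφ.square_subset

/-- Chain rule for `ψ ∘ φ = id`. Differentiating `ψ` within the image suffices, since the composite
is a map on the open set `O`; openness of the image is not needed. -/
theorem fderiv_injective (hφ : IsDeformation φ O) {x : Plane} (hx : x ∈ O) :
    Function.Injective (fderiv ℝ φ x) := by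
  obtain ⟨ψ, hψ, hinv⟩ := hφ.contDiffOn_inverse
  have h1 : HasFDerivWithinAt φ (fderiv ℝ φ x) O x :=
    (hφ.differentiableAt hx).hasFDerivAt.hasFDerivWithinAt
  have h2 := ((hψ.differentiableOn (by norm_num)) (φ x) (mem_image_of_mem φ hx)).hasFDerivWithinAt
  have h3 := (h2.comp x h1 (mapsTo_image φ O)).hasFDerivAt (hφ.isOpen.mem_nhds hx)
  have h4 : HasFDerivAt (ψ ∘ φ) (ContinuousLinearMap.id ℝ Plane) x := by
    refine (hasFDerivAt_id x).congr_of_eventuallyEq ?_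
    filter_upwards [hφ.isOpen.mem_nhds hx] with y hy
    exact hinv y hy
  have h5 := h3.unique h4
  intro v w hvw
  have e : ∀ u, fderivWithin ℝ ψ (φ '' O) (φ x) (fderiv ℝ φ x u) = u := fun u => by
    have := congrArg (fun L : Plane →L[ℝ] Plane => L u) h5
    simpa using this
  rw [← e v, hvw, e w]

/-- The derivative is uniformly continuous near the compact square, and the mean value inequality
applies on the convex intersection of the square with a small ball. -/
theorem uniform_fderiv (hφ : IsDeformation φ O) {ε : ℝ} (hε : 0 < ε) :
    ∃ δ > 0, ∀ x ∈ unitSquare, ∀ y ∈ unitSquare, ‖y - x‖ < δ →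
      ‖φ y - φ x - fderiv ℝ φ x (y - x)‖ ≤ ε * ‖y - x‖ := by
  obtain ⟨δ, hδ, h⟩ := exists_forall_dist_lt_of_isCompact isCompact_unitSquare
    (f := fderiv ℝ φ) (fun x hx => hφ.continuousOn_fderiv.continuousAt
      (hφ.isOpen.mem_nhds (hφ.square_subset hx))) hε
  refine ⟨δ, hδ, fun x hx y hy hxy => ?_⟩
  have hconv : Convex ℝ (unitSquare ∩ Metric.ball x δ) :=
    convex_unitSquare.inter (convex_ball x δ)
  refine hconv.norm_image_sub_le_of_norm_fderiv_le' (fun z hz =>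
    hφ.differentiableAt (hφ.square_subset hz.1)) (fun z hz => ?_) ⟨hx, Metric.mem_ball_self hδ⟩
    ⟨hy, by rwa [Metric.mem_ball, dist_eq_norm]⟩
  rw [← dist_eq_norm]
  exact (h x hx z hz.2).le

theorem exists_norm_fderiv_ge (hφ : IsDeformation φ O) :
    ∃ c > 0, ∀ x ∈ unitSquare, ∀ v, c * ‖v‖ ≤ ‖fderiv ℝ φ x v‖ := by
  have hcont : ContinuousOn (fun p : Plane × Plane => ‖fderiv ℝ φ p.1 p.2‖)
      (unitSquare ×ˢ Metric.sphere 0 1) := by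
    refine ContinuousOn.norm (ContinuousOn.clm_apply ?_ continuousOn_snd)
    exact hφ.continuousOn_fderiv.comp continuousOn_fst fun p hp => hφ.square_subset hp.1
  have hne : (unitSquare ×ˢ Metric.sphere (0 : Plane) 1).Nonempty :=
    ⟨(0, EuclideanSpace.single 0 1), by intro j; simp, by simp⟩
  obtain ⟨p, hp, hmin⟩ := (isCompact_unitSquare.prod (isCompact_sphere 0 1)).exists_isMinOn hne hcont
  have hp0 : p.2 ≠ 0 := by
    intro h
    have := hp.2
    simp [h] at this
  refine ⟨‖fderiv ℝ φ p.1 p.2‖, norm_pos_iff.2 fun h => hp0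
    (hφ.fderiv_injective (hφ.square_subset hp.1) (by rw [h, map_zero])), fun x hx v => ?_⟩
  rcases eq_or_ne v 0 with rfl | hv
  · simp
  have hv' : 0 < ‖v‖ := norm_pos_iff.2 hv
  have := hmin (a := (x, ‖v‖⁻¹ • v)) ⟨hx, by simp [norm_smul, hv'.ne']⟩
  simp only [mem_ofPred_eq, map_smul, norm_smul, norm_inv, norm_norm] at this
  rwa [inv_mul_eq_div, le_div_iff₀ hv'] at this

/-- Close pairs are handled by linearisation and the lower bound on the derivative. On the compact
set of pairs at distance at least `δ`, injectivity makes the continuous quotient positive. -/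
theorem exists_norm_sub_ge (hφ : IsDeformation φ O) :
    ∃ c > 0, ∀ x ∈ unitSquare, ∀ y ∈ unitSquare, c * ‖y - x‖ ≤ ‖φ y - φ x‖ := by
  obtain ⟨c, hc, hder⟩ := hφ.exists_norm_fderiv_ge
  obtain ⟨δ, hδ, hu⟩ := hφ.uniform_fderiv (half_pos hc)
  set T : Set (Plane × Plane) := (unitSquare ×ˢ unitSquare) ∩ {p | δ ≤ ‖p.2 - p.1‖} with hT
  have hTc : IsCompact T := (isCompact_unitSquare.prod isCompact_unitSquare).inter_right
    (isClosed_le continuous_const (by fun_prop))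
  have hcont : ContinuousOn (fun p : Plane × Plane => ‖φ p.2 - φ p.1‖ / ‖p.2 - p.1‖) T := by
    refine ContinuousOn.div ?_ (by fun_prop) fun p hp => (hδ.trans_le hp.2).ne'
    exact ((hφ.continuousOn.comp continuousOn_snd fun p hp => hp.1.2).sub
      (hφ.continuousOn.comp continuousOn_fst fun p hp => hp.1.1)).norm
  have hfar : ∃ m > 0, ∀ p ∈ T, m ≤ ‖φ p.2 - φ p.1‖ / ‖p.2 - p.1‖ := by
    rcases T.eq_empty_or_nonempty with h | h
    · exact ⟨1, one_pos, by simp [h]⟩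
    obtain ⟨p, hp, hmin⟩ := hTc.exists_isMinOn h hcont
    have hne : p.2 ≠ p.1 := fun h => by
      have := hp.2
      simp [h] at this
      linarith
    refine ⟨_, div_pos (norm_pos_iff.2 (sub_ne_zero.2 fun h => hne ?_))
      (norm_pos_iff.2 (sub_ne_zero.2 hne)), fun q hq => hmin hq⟩
    exact hφ.injOn (hφ.square_subset hp.1.2) (hφ.square_subset hp.1.1) h
  obtain ⟨m, hm, hfar⟩ := hfar
  refine ⟨min (c / 2) m, lt_min (half_pos hc) hm, fun x hx y hy => ?_⟩
  rcases lt_or_ge ‖y - x‖ δ with h | h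
  · have h1 := hu x hx y hy h
    have h2 := hder x hx (y - x)
    have h3 : ‖fderiv ℝ φ x (y - x)‖ ≤ ‖φ y - φ x‖ + ‖φ y - φ x - fderiv ℝ φ x (y - x)‖ := by
      have := norm_sub_le (φ y - φ x) (φ y - φ x - fderiv ℝ φ x (y - x))
      simpa using this
    have h4 : min (c / 2) m * ‖y - x‖ ≤ c / 2 * ‖y - x‖ :=
      mul_le_mul_of_nonneg_right (min_le_left _ _) (norm_nonneg _)
    linarith
  · have h1 := hfar (x, y) ⟨⟨hx, hy⟩, h⟩
    rw [le_div_iff₀ (hδ.trans_le h)] at h1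
    exact (mul_le_mul_of_nonneg_right (min_le_right _ _) (norm_nonneg _)).trans h1

theorem exists_lipschitz (hφ : IsDeformation φ O) :
    ∃ C > 0, ∀ x ∈ unitSquare, ∀ y ∈ unitSquare, ‖φ y - φ x‖ ≤ C * ‖y - x‖ := by
  have h1 : ContinuousOn (fun x => ‖fderiv ℝ φ x‖) unitSquare :=
    (hφ.continuousOn_fderiv.mono hφ.square_subset).norm
  obtain ⟨C, hC⟩ := isCompact_unitSquare.bddAbove_image h1
  refine ⟨max C 1, by positivity, fun x hx y hy => ?_⟩
  exact convex_unitSquare.norm_image_sub_le_of_norm_fderiv_le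
    (fun z hz => hφ.differentiableAt (hφ.square_subset hz))
    (fun z hz => (hC (mem_image_of_mem _ hz)).trans (le_max_left _ _)) hx hy

end IsDeformation

/-! ### Scaled cells and their limits -/

/-- The cell of side `θ` at index `i`, rescaled by `n` about its corner. -/
def scaledCell (φ : Plane → Plane) (n θ : ℕ) (i : ℕ × ℕ) : Cell :=
  fun k => (n : ℝ) • (corner φ n θ i.1 i.2 k - φ (latticePoint n i))

/-- The parallelogram that approximates the rescaled cells at `x`. -/
def limitCell (φ : Plane → Plane) (θ : ℕ) (x : Plane) : Cell :=
  fun k => fderiv ℝ φ x ((θ : ℝ) • cornerVec k)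

theorem IsDeformation.dist_scaledCell_lt (hφ : IsDeformation φ O) (θ : ℕ) {η : ℝ} (hη : 0 < η) :
    ∀ᶠ n : ℕ in atTop, ∀ i ∈ cells n θ,
      dist (scaledCell φ n θ i) (limitCell φ θ (latticePoint n i)) < η := by
  -- A corner lies within `2 θ / n` of the base point, so after rescaling by `n` the linearisation
  -- error is at most `2 θ` times this number, which is below `η`.
  have hε : 0 < η / (2 * (2 * θ + 1)) := by positivity
  obtain ⟨δ, hδ, hu⟩ := hφ.uniform_fderiv hε
  have ht : Tendsto (fun n : ℕ => (2 * θ : ℝ) / n) atTop (𝓝 0) :=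
    tendsto_const_div_atTop_nhds_zero_nat _
  filter_upwards [ht.eventually (gt_mem_nhds hδ), eventually_gt_atTop 0] with n hn hn0 i hi
  have hn0' : (0 : ℝ) < n := by exact_mod_cast hn0
  rw [dist_pi_lt_iff hη]
  intro k
  have hd : ‖((θ : ℝ) / n) • cornerVec k‖ ≤ 2 * θ / n := by
    rw [norm_smul, Real.norm_of_nonneg (by positivity)]
    have := mul_le_mul_of_nonneg_left (norm_cornerVec_le k) (by positivity : 0 ≤ (θ : ℝ) / n)
    linarith [this, (by ring : (θ : ℝ) / n * 2 = 2 * θ / n)]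
  have h := hu _ (latticePoint_mem hi) _ (latticePoint_add_mem hi k)
    (by rw [add_sub_cancel_left]; exact hd.trans_lt hn)
  rw [add_sub_cancel_left] at h
  have e : scaledCell φ n θ i k - limitCell φ θ (latticePoint n i) k = (n : ℝ) •
      (φ (latticePoint n i + ((θ : ℝ) / n) • cornerVec k) - φ (latticePoint n i) -
        fderiv ℝ φ (latticePoint n i) (((θ : ℝ) / n) • cornerVec k)) := by
    rw [smul_sub, ← map_smul, smul_smul, scaledCell, corner_eq, limitCell]
    congr 3
    field_simp
  rw [dist_eq_norm, e, norm_smul, Real.norm_of_nonneg hn0'.le]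
  calc (n : ℝ) * _ ≤ n * (η / (2 * (2 * θ + 1)) * (2 * θ / n)) := by
        refine mul_le_mul_of_nonneg_left (h.trans ?_) hn0'.le
        exact mul_le_mul_of_nonneg_left hd hε.le
    _ = η / (2 * (2 * θ + 1)) * (2 * θ) := by field_simp
    _ < η := by
        rw [div_mul_eq_mul_div, div_lt_iff₀ (by positivity)]
        have : (0 : ℝ) ≤ θ := by positivity
        nlinarith [mul_nonneg hη.le this]

/-- The parallelogram with sides `a`, `b` at the origin. -/
def parallelogram (a b : Plane) : Cell := fun k => ((k.1 : ℕ) : ℝ) • a + ((k.2 : ℕ) : ℝ) • b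

/-- The determinant of the matrix with rows `a`, `b`. -/
def planeDet (a b : Plane) : ℝ := a 0 * b 1 - a 1 * b 0

/-- The common absolute value of the weights on a parallelogram, with its sign at the origin. -/
def parallelogramWeight (ℓ : Fin 2) (a b : Plane) : ℝ :=
  (if ℓ = 0 then b 1 - a 1 else a 0 - b 0) / planeDet a b

theorem det_matA_parallelogram (a b : Plane) : (parallelogram a b).matA.det = planeDet a b := by
  simp [Cell.matA, parallelogram, Matrix.det_fin_two, planeDet]

theorem det_matB_parallelogram (a b : Plane) : (parallelogram a b).matB.det = -planeDet a b := by
  simp [Cell.matB, parallelogram, Matrix.det_fin_two, planeDet]; ring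

theorem regular_parallelogram {a b : Plane} (h : planeDet a b ≠ 0) :
    (parallelogram a b).Regular :=
  ⟨by rwa [det_matA_parallelogram], by rwa [det_matB_parallelogram, neg_ne_zero]⟩

/-- The matrix `B` of a parallelogram is `-A` with its rows exchanged, so the second-order
difference is a multiple of the alternating sum over the four corners. -/
theorem weight_parallelogram (ℓ : Fin 2) (a b : Plane) (k : Fin 2 × Fin 2) :
    (parallelogram a b).weight ℓ k =
      (-1) ^ ((k.1 : ℕ) + (k.2 : ℕ)) * parallelogramWeight ℓ a b := by
  obtain ⟨i, j⟩ := k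
  simp only [Cell.weight, Matrix.inv_def, det_matA_parallelogram, det_matB_parallelogram,
    Ring.inverse_eq_inv', Matrix.adjugate_fin_two, parallelogramWeight]
  fin_cases ℓ <;> fin_cases i <;> fin_cases j <;>
    simp [Cell.matA, Cell.matB, parallelogram, div_eq_inv_mul, inv_neg] <;> ring

/-- Adjacent corners carry opposite weights and opposite corners equal ones; each side length occurs
twice and each diagonal once. -/
theorem energy_parallelogram (ℓ : Fin 2) (s : ℝ) (a b : Plane) :
    (parallelogram a b).energy ℓ s = 2 * parallelogramWeight ℓ a b ^ 2 *
      (kernel s ‖a + b‖ + kernel s ‖a - b‖ - 2 * kernel s ‖a‖ - 2 * kernel s ‖b‖) := by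
  simp only [Cell.energy, weight_parallelogram]
  simp only [Fintype.sum_prod_type, Fin.sum_univ_two, parallelogram]
  simp only [Fin.val_zero, Fin.val_one, Nat.cast_zero, Nat.cast_one, zero_smul, one_smul, add_zero,
    zero_add, sub_self, norm_zero, kernel_zero, zero_sub, norm_neg, sub_zero, add_sub_cancel_left,
    add_sub_cancel_right, sub_add_cancel_left, sub_add_cancel_right]
  have e : ‖b - a‖ = ‖a - b‖ := norm_sub_rev _ _
  rw [e]
  ring

theorem side_ne_zero_of_planeDet_ne_zero {a b : Plane} (h : planeDet a b ≠ 0) :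
    a ≠ 0 ∧ b ≠ 0 ∧ a + b ≠ 0 ∧ a - b ≠ 0 := by
  refine ⟨?_, ?_, fun h0 => h ?_, fun h0 => h ?_⟩
  · rintro rfl; simp [planeDet] at h
  · rintro rfl; simp [planeDet] at h
  · rw [eq_neg_of_add_eq_zero_left h0]; simp [planeDet]; ring
  · rw [sub_eq_zero.1 h0]; simp [planeDet]; ring

theorem injective_parallelogram {a b : Plane} (h : planeDet a b ≠ 0) :
    Function.Injective (parallelogram a b) := by
  obtain ⟨ha, hb, hab, hab'⟩ := side_ne_zero_of_planeDet_ne_zero h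
  have hab2 := sub_ne_zero.1 hab'
  rintro ⟨i, j⟩ ⟨i', j'⟩ hk
  fin_cases i <;> fin_cases j <;> fin_cases i' <;> fin_cases j' <;>
    simp_all [parallelogram, eq_comm]

theorem energy_parallelogram_pos_aux {s : ℝ} (hs : 0 ≤ s) {a b : Plane} (h : planeDet a b ≠ 0) :
    0 < kernel s ‖a + b‖ + kernel s ‖a - b‖ - 2 * kernel s ‖a‖ - 2 * kernel s ‖b‖ := by
  obtain ⟨ha, hb, hab, hab'⟩ := side_ne_zero_of_planeDet_ne_zero h
  exact kernel_parallelogram_pos hs ha hb hab hab'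

theorem energy_parallelogram_nonneg (ℓ : Fin 2) {s : ℝ} (hs : 0 ≤ s) {a b : Plane}
    (h : planeDet a b ≠ 0) : 0 ≤ (parallelogram a b).energy ℓ s := by
  rw [energy_parallelogram]
  exact mul_nonneg (by positivity) (energy_parallelogram_pos_aux hs h).le

theorem energy_parallelogram_pos (ℓ : Fin 2) {s : ℝ} (hs : 0 ≤ s) {a b : Plane}
    (h : planeDet a b ≠ 0) (hw : parallelogramWeight ℓ a b ≠ 0) :
    0 < (parallelogram a b).energy ℓ s := by
  rw [energy_parallelogram]
  exact mul_pos (by positivity) (energy_parallelogram_pos_aux hs h)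

variable {φ : Plane → Plane} {O : Set Plane}

/-- The directional derivative of `φ` along the `j`-th coordinate. -/
def tangent (φ : Plane → Plane) (j : Fin 2) (x : Plane) : Plane :=
  fderiv ℝ φ x (EuclideanSpace.single j 1)

theorem limitCell_eq_parallelogram (φ : Plane → Plane) (θ : ℕ) (x : Plane) :
    limitCell φ θ x = parallelogram ((θ : ℝ) • tangent φ 0 x) ((θ : ℝ) • tangent φ 1 x) := by
  funext k
  have e : cornerVec k = ((k.1 : ℕ) : ℝ) • EuclideanSpace.single 0 1 +
      ((k.2 : ℕ) : ℝ) • EuclideanSpace.single 1 1 := by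
    ext j; fin_cases j <;> simp [cornerVec]
  simp only [limitCell, e, parallelogram, tangent, map_smul, map_add, smul_add]
  simp only [smul_smul, mul_comm]

theorem limitCell_eq_scale (φ : Plane → Plane) (θ : ℕ) (x : Plane) :
    limitCell φ θ x = fun k => (θ : ℝ) • (limitCell φ 1 x k - 0) := by
  funext k
  simp [limitCell]

theorem planeDet_smul (r : ℝ) (a b : Plane) : planeDet (r • a) (r • b) = r ^ 2 * planeDet a b := by
  simp [planeDet]; ring

namespace IsDeformation

theorem planeDet_tangent_ne_zero (hφ : IsDeformation φ O) {x : Plane} (hx : x ∈ O) :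
    planeDet (tangent φ 0 x) (tangent φ 1 x) ≠ 0 := by
  intro h
  set a := tangent φ 0 x with ha
  set b := tangent φ 1 x with hb
  have hinj := hφ.fderiv_injective hx
  have key : ∀ u v : ℝ, u • a + v • b = 0 → u = 0 ∧ v = 0 := by
    intro u v huv
    have h1 : fderiv ℝ φ x (u • EuclideanSpace.single 0 1 + v • EuclideanSpace.single 1 1) =
        fderiv ℝ φ x 0 := by
      rw [map_add, map_smul, map_smul, map_zero]
      exact huv
    have h2 := hinj h1
    have h20 := congrArg (fun z : Plane => z 0) h2
    have h21 := congrArg (fun z : Plane => z 1) h2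
    simp at h20 h21
    exact ⟨h20, h21⟩
  unfold planeDet at h
  -- If the determinant vanishes, `b 1 • a - a 1 • b` and `b 0 • a - a 0 • b` are zero. Independence
  -- then forces `b = 0`, which is absurd.
  have h1 := key (b 1) (-a 1) (by
    ext j; fin_cases j <;> simp <;> linarith)
  have h2 := key (b 0) (-a 0) (by
    ext j; fin_cases j <;> simp <;> linarith)
  have hb0 : b = 0 := by
    ext j; fin_cases j
    · simpa using h2.1
    · simpa using h1.1
  have := key 0 1 (by simp [hb0])
  simp at this

theorem regular_limitCell (hφ : IsDeformation φ O) {θ : ℕ} (hθ : θ ≠ 0) {x : Plane} (hx : x ∈ O) :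
    (limitCell φ θ x).Regular := by
  rw [limitCell_eq_parallelogram]
  apply regular_parallelogram
  rw [planeDet_smul]
  have := hφ.planeDet_tangent_ne_zero hx
  positivity

theorem injective_limitCell (hφ : IsDeformation φ O) {θ : ℕ} (hθ : θ ≠ 0) {x : Plane}
    (hx : x ∈ O) : Function.Injective (limitCell φ θ x) := by
  rw [limitCell_eq_parallelogram]
  apply injective_parallelogram
  rw [planeDet_smul]
  have := hφ.planeDet_tangent_ne_zero hx
  positivity

theorem continuousOn_limitCell (hφ : IsDeformation φ O) (θ : ℕ) :
    ContinuousOn (limitCell φ θ) unitSquare := by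
  refine continuousOn_pi.2 fun k => ?_
  exact (hφ.continuousOn_fderiv.mono hφ.square_subset).clm_apply continuousOn_const

/-- The limit cells form a compact set. -/
theorem isCompact_image_limitCell (hφ : IsDeformation φ O) (θ : ℕ) :
    IsCompact (limitCell φ θ '' unitSquare) :=
  isCompact_unitSquare.image_of_continuousOn (hφ.continuousOn_limitCell θ)

/-- Uniform approximation of a continuous function of the rescaled cells. -/
theorem eventually_cells_of_continuousAt (hφ : IsDeformation φ O) (θ : ℕ) {T : Set ℝ}
    (hT : IsCompact T) {f : ℝ × Cell → ℝ}
    (hf : ∀ s ∈ T, ∀ x ∈ unitSquare, ContinuousAt f (s, limitCell φ θ x)) {ε : ℝ} (hε : 0 < ε) :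
    ∀ᶠ n : ℕ in atTop, ∀ i ∈ cells n θ, ∀ s ∈ T,
      |f (s, scaledCell φ n θ i) - f (s, limitCell φ θ (latticePoint n i))| < ε := by
  obtain ⟨η, hη, h⟩ := exists_forall_dist_lt_of_isCompact (hT.prod (hφ.isCompact_image_limitCell θ))
    (f := f) (by rintro ⟨s, y⟩ ⟨hs, x, hx, rfl⟩; exact hf s hs x hx) hε
  filter_upwards [hφ.dist_scaledCell_lt θ hη] with n hn i hi s hs
  have := h (s, limitCell φ θ (latticePoint n i)) ⟨hs, _, latticePoint_mem hi, rfl⟩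
    (s, scaledCell φ n θ i) (by rw [Prod.dist_eq]; simpa using hn i hi)
  rwa [Real.dist_eq] at this

theorem exists_bound_limitCell (hφ : IsDeformation φ O) (θ : ℕ) {T : Set ℝ}
    (hT : IsCompact T) {f : ℝ × Cell → ℝ}
    (hf : ∀ s ∈ T, ∀ x ∈ unitSquare, ContinuousAt f (s, limitCell φ θ x)) :
    ∃ M > 0, ∀ s ∈ T, ∀ x ∈ unitSquare, |f (s, limitCell φ θ x)| ≤ M := by
  obtain ⟨M, hM⟩ := ((hT.prod (hφ.isCompact_image_limitCell θ))).bddAbove_image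
    (f := fun p => |f p|) (ContinuousOn.abs (by
      rintro ⟨s, y⟩ ⟨hs, x, hx, rfl⟩
      exact (hf s hs x hx).continuousWithinAt))
  exact ⟨max M 1, by positivity, fun s hs x hx =>
    (hM ⟨(s, limitCell φ θ x), ⟨hs, x, hx, rfl⟩, rfl⟩).trans (le_max_left _ _)⟩

theorem exists_bound_cells (hφ : IsDeformation φ O) (θ : ℕ) {T : Set ℝ}
    (hT : IsCompact T) {f : ℝ × Cell → ℝ}
    (hf : ∀ s ∈ T, ∀ x ∈ unitSquare, ContinuousAt f (s, limitCell φ θ x)) :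
    ∃ M > 0, ∀ᶠ n : ℕ in atTop, ∀ i ∈ cells n θ, ∀ s ∈ T, |f (s, scaledCell φ n θ i)| ≤ M := by
  obtain ⟨M, hM, h⟩ := hφ.exists_bound_limitCell θ hT hf
  refine ⟨M + 1, by positivity, ?_⟩
  filter_upwards [hφ.eventually_cells_of_continuousAt θ hT hf one_pos] with n hn i hi s hs
  have h1 := hn i hi s hs
  have h2 := h s hs _ (latticePoint_mem hi)
  have := abs_sub_abs_le_abs_sub (f (s, scaledCell φ n θ i))
    (f (s, limitCell φ θ (latticePoint n i)))
  linarith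

/-- Regularity is an open condition that holds on the compact set of limit cells, hence on a
thickening of that set. -/
theorem eventually_regular_scaledCell (hφ : IsDeformation φ O) {θ : ℕ} (hθ : θ ≠ 0) :
    ∀ᶠ n : ℕ in atTop, ∀ i ∈ cells n θ, (scaledCell φ n θ i).Regular := by
  have hopen : IsOpen {y : Cell | y.Regular} :=
    (isOpen_ne_fun Cell.continuous_matA.matrix_det continuous_const).inter
      (isOpen_ne_fun Cell.continuous_matB.matrix_det continuous_const)
  obtain ⟨η, hη, h⟩ := (hφ.isCompact_image_limitCell θ).exists_thickening_subset_open hopen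
    (by rintro _ ⟨x, hx, rfl⟩; exact hφ.regular_limitCell hθ (hφ.square_subset hx))
  filter_upwards [hφ.dist_scaledCell_lt θ hη] with n hn i hi
  exact h (Metric.mem_thickening_iff.2 ⟨_, mem_image_of_mem _ (latticePoint_mem hi), hn i hi⟩)

theorem continuousAt_energy_limitCell (hφ : IsDeformation φ O) {θ : ℕ} (hθ : θ ≠ 0) (ℓ : Fin 2)
    (s : ℝ) {x : Plane} (hx : x ∈ unitSquare) :
    ContinuousAt (fun p : ℝ × Cell => p.2.energy ℓ p.1) (s, limitCell φ θ x) :=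
  Cell.continuousAt_energy ℓ s (hφ.regular_limitCell hθ (hφ.square_subset hx))
    (hφ.injective_limitCell hθ (hφ.square_subset hx))

theorem energy_limitCell_nonneg (hφ : IsDeformation φ O) {θ : ℕ} (hθ : θ ≠ 0) (ℓ : Fin 2) {s : ℝ}
    (hs : 0 ≤ s) {x : Plane} (hx : x ∈ unitSquare) : 0 ≤ (limitCell φ θ x).energy ℓ s := by
  rw [limitCell_eq_parallelogram]
  apply energy_parallelogram_nonneg ℓ hs
  rw [planeDet_smul]
  have := hφ.planeDet_tangent_ne_zero (hφ.square_subset hx)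
  positivity

theorem energy_limitCell_scale (hφ : IsDeformation φ O) {θ : ℕ} (hθ : θ ≠ 0) (ℓ : Fin 2) (s : ℝ)
    {x : Plane} (hx : x ∈ unitSquare) :
    (limitCell φ θ x).energy ℓ s = (θ : ℝ) ^ (2 * s - 2) * (limitCell φ 1 x).energy ℓ s := by
  rw [limitCell_eq_scale]
  exact Cell.energy_scale ℓ s (hφ.regular_limitCell one_ne_zero (hφ.square_subset hx))
    (by positivity) 0

end IsDeformation

/-! ### Counting cells, and uniform asymptotics of the mean energy -/

theorem exists_card_near_le (θ : ℕ) {p r : ℝ} (hp : p ∈ Icc (0 : ℝ) 1) (hr : 0 < r) :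
    ∃ κ > (0 : ℝ), ∀ᶠ n : ℕ in atTop,
      κ * n ≤ ((Finset.Icc 1 (n - θ)).filter fun i : ℕ => |(i : ℝ) / n - p| < r).card := by
  wlog hr1 : r ≤ 1 generalizing r
  · obtain ⟨κ, hκ, h⟩ := this one_pos le_rfl
    refine ⟨κ, hκ, h.mono fun n hn => hn.trans ?_⟩
    exact_mod_cast Finset.card_le_card (Finset.monotone_filter_right _ fun i _ hi =>
      lt_trans hi (not_le.1 hr1))
  refine ⟨r / 8, by positivity, ?_⟩
  have hN := tendsto_natCast_atTop_atTop (R := ℝ)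
  filter_upwards [hN.eventually_ge_atTop (4 * θ / r), hN.eventually_ge_atTop (8 / r),
    eventually_gt_atTop 0] with n h1 h2 h3
  have hn : (0 : ℝ) < n := by exact_mod_cast h3
  rw [div_le_iff₀ hr] at h1 h2
  -- The point is moved away from `1` by at most `r / 2`. The `m` indices after `n p'`, with `m`
  -- about `n r / 4`, then stay below `n - θ` and within `r` of `p`, even if `p` is an endpoint.
  set p' := p * (1 - r / 2) with hp'
  have hp'0 : 0 ≤ p' := mul_nonneg hp.1 (by linarith)
  have hp'1 : p' ≤ 1 - r / 2 := mul_le_of_le_one_left (by linarith) hp.2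
  have hp'2 : p - r / 2 ≤ p' := by nlinarith [hp.2]
  have hp'3 : p' ≤ p := by nlinarith [hp.1]
  set a := ⌊n * p'⌋₊ with ha
  set m := ⌊n * r / 4⌋₊ with hm
  have hm1 : (m : ℝ) ≤ n * r / 4 := Nat.floor_le (by positivity)
  have hm2 : n * r / 4 < m + 1 := Nat.lt_floor_add_one _
  have ha1 : (a : ℝ) ≤ n * p' := Nat.floor_le (by positivity)
  have ha2 : n * p' < a + 1 := Nat.lt_floor_add_one _
  have hsub : Finset.Ioc a (a + m) ⊆
      (Finset.Icc 1 (n - θ)).filter fun i : ℕ => |(i : ℝ) / n - p| < r := by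
    intro i hi
    rw [Finset.mem_Ioc] at hi
    have hi1 : (a : ℝ) + 1 ≤ i := by exact_mod_cast hi.1
    have hi2 : (i : ℝ) ≤ a + m := by exact_mod_cast hi.2
    have hup : (i : ℝ) ≤ n * (p' + r / 4) := by nlinarith
    have hlow : n * p' < i := by linarith
    rw [Finset.mem_filter, Finset.mem_Icc]
    refine ⟨⟨by lia, ?_⟩, ?_⟩
    · have : (i : ℝ) + θ ≤ n := by nlinarith
      have : i + θ ≤ n := by exact_mod_cast this
      lia
    · rw [abs_lt]
      have e1 : (i : ℝ) / n ≤ p' + r / 4 := by rw [div_le_iff₀ hn]; linarith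
      have e2 : p' < (i : ℝ) / n := by rw [lt_div_iff₀ hn]; linarith
      constructor <;> linarith
  have := Finset.card_le_card hsub
  rw [Nat.card_Ioc, add_tsub_cancel_left] at this
  refine le_trans ?_ (Nat.cast_le.2 this)
  linarith

theorem exists_card_cells_near_le (θ : ℕ) {x : Plane} (hx : x ∈ unitSquare) {r : ℝ}
    (hr : 0 < r) :
    ∃ κ > 0, ∀ᶠ n : ℕ in atTop,
      κ * (n : ℝ) ^ 2 ≤ ((cells n θ).filter fun i => dist (latticePoint n i) x < r).card := by
  obtain ⟨κ₀, hκ₀, h₀⟩ := exists_card_near_le θ (hx 0) (half_pos hr)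
  obtain ⟨κ₁, hκ₁, h₁⟩ := exists_card_near_le θ (hx 1) (half_pos hr)
  refine ⟨κ₀ * κ₁, by positivity, ?_⟩
  filter_upwards [h₀, h₁] with n hn₀ hn₁
  set s₀ := (Finset.Icc 1 (n - θ)).filter fun i : ℕ => |(i : ℝ) / n - x 0| < r / 2
  set s₁ := (Finset.Icc 1 (n - θ)).filter fun i : ℕ => |(i : ℝ) / n - x 1| < r / 2
  have hsub : s₀ ×ˢ s₁ ⊆ (cells n θ).filter fun i => dist (latticePoint n i) x < r := by
    intro i hi
    simp only [s₀, s₁, Finset.mem_product, Finset.mem_filter] at hi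
    obtain ⟨⟨h1, h2⟩, h3, h4⟩ := hi
    refine Finset.mem_filter.2 ⟨Finset.mem_product.2 ⟨h1, h3⟩, ?_⟩
    rw [EuclideanSpace.dist_eq, Real.sqrt_lt' hr, Fin.sum_univ_two, Real.dist_eq, Real.dist_eq]
    simp only [latticePoint, PiLp.toLp_apply, Matrix.cons_val_zero, Matrix.cons_val_one]
    have e1 := pow_lt_pow_left₀ h2 (abs_nonneg _) two_ne_zero
    have e2 := pow_lt_pow_left₀ h4 (abs_nonneg _) two_ne_zero
    nlinarith
  have hc := Finset.card_le_card hsub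
  rw [Finset.card_product] at hc
  calc κ₀ * κ₁ * (n : ℝ) ^ 2 = (κ₀ * n) * (κ₁ * n) := by ring
    _ ≤ (s₀.card : ℝ) * s₁.card := by gcongr
    _ ≤ _ := by exact_mod_cast hc

theorem card_cells_le (n θ : ℕ) : ((cells n θ).card : ℝ) ≤ (n : ℝ) ^ 2 := by
  have : (cells n θ).card ≤ n ^ 2 := by
    simp only [cells, Finset.card_product, Nat.card_Icc, add_tsub_cancel_right, pow_two]
    exact Nat.mul_le_mul (Nat.sub_le _ _) (Nat.sub_le _ _)
  exact_mod_cast this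

/-- The normalized sum of the energies of the rescaled cells. -/
def meanEnergy (φ : Plane → Plane) (ℓ : Fin 2) (n θ : ℕ) (s : ℝ) : ℝ :=
  (∑ i ∈ cells n θ, (scaledCell φ n θ i).energy ℓ s) / (n : ℝ) ^ 2

theorem continuous_meanEnergy (φ : Plane → Plane) (ℓ : Fin 2) (n θ : ℕ) :
    Continuous (meanEnergy φ ℓ n θ) :=
  (continuous_finsetSum _ fun _ _ => Cell.continuous_energy_left ℓ _).div_const _

variable {φ : Plane → Plane} {O : Set Plane}

namespace IsDeformation

theorem dφ_eq (hφ : IsDeformation φ O) {x : Plane} (hx : x ∈ O) (j k : Fin 2) :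
    dφ φ j k x = tangent φ k x j := by
  have hd := hφ.differentiableAt hx
  have h := ((EuclideanSpace.proj (𝕜 := ℝ) j).hasFDerivAt.comp x hd.hasFDerivAt)
  have := (h.hasLineDerivAt (EuclideanSpace.single k 1)).lineDeriv
  exact this

/-- Up to sign, the numerator of the weight is the difference of partial derivatives whose square
stands in front of the bracket in `scriptJ`. The bracket plays no role, since positivity of the
kernel combination is known for all `s`. -/
theorem weight_ne_zero_of_scriptJ_ne_zero (hφ : IsDeformation φ O) {ν : ℝ} {ℓ : Fin 2} {x : Plane}
    (hx : x ∈ O) (hJ : scriptJ φ ν ℓ x ≠ 0) :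
    parallelogramWeight ℓ (tangent φ 0 x) (tangent φ 1 x) ≠ 0 := by
  intro h
  apply hJ
  have hdet := hφ.planeDet_tangent_ne_zero hx
  rw [parallelogramWeight, div_eq_zero_iff, or_iff_left hdet] at h
  have : dφ φ (other ℓ) 1 x - dφ φ (other ℓ) 0 x = 0 := by
    rw [hφ.dφ_eq hx, hφ.dφ_eq hx]
    fin_cases ℓ <;> simp [other] at h ⊢ <;> linarith
  rw [scriptJ, this]
  simp

theorem energy_limitCell_pos (hφ : IsDeformation φ O) {ν : ℝ} {ℓ : Fin 2} {x : Plane}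
    (hx : x ∈ unitSquare) (hJ : scriptJ φ ν ℓ x ≠ 0) {θ : ℕ} (hθ : θ ≠ 0) {s : ℝ} (hs : 0 ≤ s) :
    0 < (limitCell φ θ x).energy ℓ s := by
  have hxO := hφ.square_subset hx
  rw [hφ.energy_limitCell_scale hθ ℓ s hx, limitCell_eq_parallelogram]
  refine mul_pos (by positivity) ?_
  simp only [Nat.cast_one, one_smul]
  exact energy_parallelogram_pos ℓ hs (hφ.planeDet_tangent_ne_zero hxO)
    (hφ.weight_ne_zero_of_scriptJ_ne_zero hxO hJ)

/-- At one point with `scriptJ ≠ 0` the limit energy is positive for every `s`, hence bounded below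
over the compact interval. The bound persists on a neighbourhood that contains a fixed fraction of
the `n ^ 2` cells, and the other cells contribute at worst a small negative amount because their
limit energies are nonnegative. -/
theorem exists_meanEnergy_ge (hφ : IsDeformation φ O) {ν : ℝ} {ℓ : Fin 2}
    (hJ : ∃ x ∈ unitSquare, scriptJ φ ν ℓ x ≠ 0) {θ : ℕ} (hθ : θ ≠ 0) :
    ∃ δ > 0, ∀ᶠ n : ℕ in atTop, ∀ s ∈ Icc (0 : ℝ) 2, δ ≤ meanEnergy φ ℓ n θ s := by
  obtain ⟨x, hx, hJx⟩ := hJ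
  have hTc : IsCompact (Icc (0 : ℝ) 2 ×ˢ {limitCell φ θ x}) := isCompact_Icc.prod isCompact_singleton
  have hcont : ∀ p ∈ Icc (0 : ℝ) 2 ×ˢ {limitCell φ θ x},
      ContinuousAt (fun p : ℝ × Cell => p.2.energy ℓ p.1) p := by
    rintro ⟨s, y⟩ ⟨_, hy⟩
    rw [mem_singleton_iff] at hy
    simp only at hy
    subst hy
    exact hφ.continuousAt_energy_limitCell hθ ℓ s hx
  obtain ⟨p, hp, hmin⟩ := hTc.exists_isMinOn ⟨(0, limitCell φ θ x), by simp⟩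
    (continuousOn_of_forall_continuousAt hcont)
  set m := p.2.energy ℓ p.1 with hm
  have hm0 : 0 < m := by
    have h2 : p.2 = limitCell φ θ x := hp.2
    rw [hm, h2]
    exact hφ.energy_limitCell_pos hx hJx hθ hp.1.1
  obtain ⟨η, hη, hnear⟩ := exists_forall_dist_lt_of_isCompact hTc hcont (half_pos hm0)
  obtain ⟨r, hr, hlim⟩ := Metric.continuousOn_iff.1 (hφ.continuousOn_limitCell θ) x hx (η / 2)
    (half_pos hη)
  obtain ⟨κ, hκ, hcard⟩ := exists_card_cells_near_le θ hx hr
  refine ⟨κ * m / 4, by positivity, ?_⟩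
  filter_upwards [hcard, hφ.dist_scaledCell_lt θ (half_pos hη), hφ.eventually_cells_of_continuousAt θ
    isCompact_Icc (fun s _ x hx => hφ.continuousAt_energy_limitCell hθ ℓ s hx)
    (show 0 < κ * m / 4 by positivity), eventually_gt_atTop 0] with n h1 h2 h3 h4 s hs
  have hn : (0 : ℝ) < n := by exact_mod_cast h4
  rw [meanEnergy, le_div_iff₀ (by positivity)]
  -- At least `κ n ^ 2` cells contribute `m / 2`, and a loss of `κ m / 4` is allowed on each of the
  -- at most `n ^ 2` cells. The balance is `κ m n ^ 2 / 4`.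
  have hlow : ∀ i ∈ cells n θ, (if dist (latticePoint n i) x < r then m / 2 else 0) - κ * m / 4 ≤
      (scaledCell φ n θ i).energy ℓ s := by
    intro i hi
    split_ifs with hd
    · have e1 := hlim _ (latticePoint_mem hi) hd
      have e2 := hnear (s, limitCell φ θ x) ⟨hs, rfl⟩ (s, scaledCell φ n θ i) (by
        rw [Prod.dist_eq, dist_self]
        refine max_lt hη ?_
        refine (dist_triangle _ (limitCell φ θ (latticePoint n i)) _).trans_lt ?_
        linarith [h2 i hi])
      have e3 : m ≤ (limitCell φ θ x).energy ℓ s := hmin (a := (s, limitCell φ θ x)) ⟨hs, rfl⟩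
      rw [Real.dist_eq, abs_lt] at e2
      have : 0 < κ * m / 4 := by positivity
      linarith [e2.1]
    · have e1 := (abs_lt.1 (h3 i hi s hs)).1
      have e2 := hφ.energy_limitCell_nonneg hθ ℓ hs.1 (latticePoint_mem hi)
      linarith
  refine le_trans ?_ (Finset.sum_le_sum hlow)
  rw [Finset.sum_sub_distrib, ← Finset.sum_filter, Finset.sum_const, Finset.sum_const, nsmul_eq_mul,
    nsmul_eq_mul]
  have e1 := mul_le_mul_of_nonneg_right h1 (half_pos hm0).le
  have e2 := mul_le_mul_of_nonneg_right (card_cells_le n θ) (show 0 ≤ κ * m / 4 by positivity)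
  linarith

theorem cells_two_subset (n : ℕ) : cells n 2 ⊆ cells n 1 := by
  intro i hi
  simp only [cells, Finset.mem_product, Finset.mem_Icc] at hi ⊢
  lia

theorem card_cells_sdiff_le (n : ℕ) : ((cells n 1 \ cells n 2).card : ℝ) ≤ 2 * n := by
  have h : (cells n 1 \ cells n 2).card ≤ 2 * n := by
    rw [Finset.card_sdiff_of_subset (cells_two_subset n)]
    simp only [cells, Finset.card_product, Nat.card_Icc, add_tsub_cancel_right]
    rcases n with _ | _ | n
    · simp
    · simp
    · simp only [show n + 1 + 1 - 2 = n by lia, show n + 1 + 1 - 1 = n + 1 by lia]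
      have : (n + 1) * (n + 1) = n * n + (2 * n + 1) := by ring
      lia
  exact_mod_cast h

/-- The limit cells for `θ = 2` are those for `θ = 1` doubled, so their energies differ by the
factor `2 ^ (2 s - 2)`. The two index sets differ by at most `2 n` cells of bounded energy, which is
negligible after division by `n ^ 2`. -/
theorem eventually_meanEnergy_two_sub (hφ : IsDeformation φ O) (ℓ : Fin 2) {ε : ℝ} (hε : 0 < ε) :
    ∀ᶠ n : ℕ in atTop, ∀ s ∈ Icc (0 : ℝ) 2,
      |meanEnergy φ ℓ n 2 s - 2 ^ (2 * s - 2) * meanEnergy φ ℓ n 1 s| ≤ ε := by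
  obtain ⟨M, hM, hbd⟩ := hφ.exists_bound_cells 1 (T := Icc (0 : ℝ) 2) isCompact_Icc
    (fun s _ x hx => hφ.continuousAt_energy_limitCell one_ne_zero ℓ s hx)
  have ht : Tendsto (fun n : ℕ => (8 * M : ℝ) / n) atTop (𝓝 0) :=
    tendsto_const_div_atTop_nhds_zero_nat _
  filter_upwards [hbd, hφ.eventually_cells_of_continuousAt 1
    isCompact_Icc (fun s _ x hx => hφ.continuousAt_energy_limitCell one_ne_zero ℓ s hx)
    (show 0 < ε / 10 by positivity), hφ.eventually_cells_of_continuousAt 2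
    isCompact_Icc (fun s _ x hx => hφ.continuousAt_energy_limitCell two_ne_zero ℓ s hx)
    (show 0 < ε / 10 by positivity), eventually_gt_atTop 0,
    ht.eventually (gt_mem_nhds (half_pos hε))] with n h0 h1 h2 h4 h5 s hs
  have hn : (0 : ℝ) < n := by exact_mod_cast h4
  rw [div_lt_iff₀ hn] at h5
  have hpow : (2 : ℝ) ^ (2 * s - 2) ≤ 4 := by
    calc (2 : ℝ) ^ (2 * s - 2) ≤ 2 ^ (2 : ℝ) :=
          Real.rpow_le_rpow_of_exponent_le (by norm_num) (by linarith [hs.2])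
      _ = 4 := by rw [Real.rpow_two]; norm_num
  have hpow0 : (0 : ℝ) < 2 ^ (2 * s - 2) := by positivity
  set c := (2 : ℝ) ^ (2 * s - 2) with hc
  rw [meanEnergy, meanEnergy, ← mul_div_assoc, ← sub_div, abs_div,
    abs_of_pos (by positivity : (0 : ℝ) < (n : ℝ) ^ 2), div_le_iff₀ (by positivity)]
  rw [← Finset.sum_sdiff (cells_two_subset n), mul_add, add_comm, ← sub_sub, Finset.mul_sum (cells n 2),
    ← Finset.sum_sub_distrib]
  have b1 : |∑ i ∈ cells n 2, ((scaledCell φ n 2 i).energy ℓ s -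
      c * (scaledCell φ n 1 i).energy ℓ s)| ≤ (n : ℝ) ^ 2 * (ε / 2) := by
    refine (Finset.abs_sum_le_sum_abs _ _).trans ?_
    refine (Finset.sum_le_card_nsmul _ _ (ε / 2) fun i hi => ?_).trans ?_
    -- As `c ≤ 4`, the two approximation errors add up to at most `ε / 10 + 4 * (ε / 10) = ε / 2`.
    · have e1 := abs_lt.1 (h1 i (cells_two_subset n hi) s hs)
      have e2 := abs_lt.1 (h2 i hi s hs)
      have e3 := hφ.energy_limitCell_scale two_ne_zero ℓ s (latticePoint_mem hi)
      simp only [Nat.cast_ofNat] at e1 e2 e3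
      rw [← hc] at e3
      rw [abs_le]
      constructor <;> nlinarith
    · rw [nsmul_eq_mul]
      exact mul_le_mul_of_nonneg_right (card_cells_le n 2) (by positivity)
  have b2 : |c * ∑ i ∈ cells n 1 \ cells n 2, (scaledCell φ n 1 i).energy ℓ s| ≤
      4 * (2 * n * M) := by
    rw [abs_mul, abs_of_pos hpow0]
    refine mul_le_mul hpow ?_ (abs_nonneg _) (by norm_num)
    refine (Finset.abs_sum_le_sum_abs _ _).trans ?_
    refine (Finset.sum_le_card_nsmul _ _ M fun i hi =>
      h0 i (Finset.mem_sdiff.1 hi).1 s hs).trans ?_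
    rw [nsmul_eq_mul]
    exact mul_le_mul_of_nonneg_right (card_cells_sdiff_le n) hM.le
  refine (abs_sub _ _).trans ((add_le_add b1 b2).trans ?_)
  nlinarith

end IsDeformation

/-! ### The functions `f̄` and `F̄` in terms of mean energies -/

theorem scaledCell_regular_iff {φ : Plane → Plane} {n : ℕ} (hn : n ≠ 0) (θ : ℕ) (i : ℕ × ℕ) :
    (scaledCell φ n θ i).Regular ↔ Cell.Regular (corner φ n θ i.1 i.2) :=
  Cell.regular_scale_iff _ (Nat.cast_ne_zero.2 hn) _

theorem energy_corner_eq {φ : Plane → Plane} {n : ℕ} (hn : n ≠ 0) (θ : ℕ) {i : ℕ × ℕ}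
    (h : (scaledCell φ n θ i).Regular) (ℓ : Fin 2) (s : ℝ) :
    Cell.energy ℓ s (corner φ n θ i.1 i.2) =
      (n : ℝ) ^ (2 - 2 * s) * (scaledCell φ n θ i).energy ℓ s := by
  have hn0 : (0 : ℝ) < n := by positivity
  have e : (scaledCell φ n θ i).energy ℓ s =
      (n : ℝ) ^ (2 * s - 2) * Cell.energy ℓ s (corner φ n θ i.1 i.2) :=
    Cell.energy_scale ℓ s ((scaledCell_regular_iff hn θ i).1 h) hn0 _
  rw [e, ← mul_assoc, ← Real.rpow_add hn0]
  simp

theorem fBar_eq_meanEnergy {φ : Plane → Plane} {n θ : ℕ} (hn : n ≠ 0) (β : ℝ → ℝ) (ℓ : Fin 2)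
    (hreg : ∀ i ∈ cells n θ, (scaledCell φ n θ i).Regular) {s : ℝ} (hs : s ∈ Ioo (0 : ℝ) 2) :
    fBar β φ n θ ℓ s =
      β s * (kernelFactor s * ((n : ℝ) ^ (4 - 2 * s) * meanEnergy φ ℓ n θ s)) := by
  have hn0 : (0 : ℝ) < n := by positivity
  rw [fBar, ← Finset.sum_product', meanEnergy]
  congr 1
  have e : (n : ℝ) ^ (4 - 2 * s) *
      ((∑ i ∈ cells n θ, (scaledCell φ n θ i).energy ℓ s) / (n : ℝ) ^ 2) =
      ∑ i ∈ cells n θ, (n : ℝ) ^ (2 - 2 * s) * (scaledCell φ n θ i).energy ℓ s := by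
    rw [← Finset.mul_sum, show (4 : ℝ) - 2 * s = (2 - 2 * s) + 2 by ring, Real.rpow_add hn0,
      Real.rpow_two]
    field_simp
  rw [e, Finset.mul_sum]
  refine Finset.sum_congr rfl fun i hi => ?_
  rw [← energy_corner_eq hn θ (hreg i hi), ← Cell.sum_irregularTerm ℓ hs
    ((scaledCell_regular_iff hn θ i).1 (hreg i hi))]
  refine Finset.sum_congr rfl fun k _ => ?_
  rw [Finset.sum_filter, coeff_eq_weight]
  refine Finset.sum_congr rfl fun l _ => ?_
  -- The diagonal terms left out of `fBar` vanish anyway, because `G_s(0) = 0`.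
  split_ifs with h
  · rfl
  · rw [not_not.1 h]
    simp [irregularTerm]

/-- The constants `β s`, the factor `kernelFactor s` and the power of `n` cancel. The remaining
quotient is continuous on the closed interval, so the one-sided limits at the end points are its
values there. -/
theorem ratioF_eq {φ : Plane → Plane} {n : ℕ} (hn : n ≠ 0) {β : ℝ → ℝ}
    (hβ : ∀ s ∈ Ioo (0 : ℝ) 2, β s ≠ 0) (ℓ : Fin 2)
    (hreg1 : ∀ i ∈ cells n 1, (scaledCell φ n 1 i).Regular)
    (hreg2 : ∀ i ∈ cells n 2, (scaledCell φ n 2 i).Regular)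
    (hpos : ∀ s ∈ Icc (0 : ℝ) 2, meanEnergy φ ℓ n 1 s ≠ 0) {s : ℝ} (hs : s ∈ Icc (0 : ℝ) 2) :
    ratioF β φ n ℓ s = meanEnergy φ ℓ n 2 s / meanEnergy φ ℓ n 1 s := by
  have hn0 : (0 : ℝ) < n := by positivity
  have hin : ∀ t ∈ Ioo (0 : ℝ) 2, fBar β φ n 2 ℓ t / fBar β φ n 1 ℓ t =
      meanEnergy φ ℓ n 2 t / meanEnergy φ ℓ n 1 t := by
    intro t ht
    rw [fBar_eq_meanEnergy hn β ℓ hreg1 ht, fBar_eq_meanEnergy hn β ℓ hreg2 ht,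
      mul_div_mul_left _ _ (hβ t ht), mul_div_mul_left _ _ (kernelFactor_ne_zero t),
      mul_div_mul_left _ _ (by positivity)]
  have hc : ∀ t ∈ Icc (0 : ℝ) 2, Tendsto (fun t => meanEnergy φ ℓ n 2 t / meanEnergy φ ℓ n 1 t)
      (𝓝 t) (𝓝 (meanEnergy φ ℓ n 2 t / meanEnergy φ ℓ n 1 t)) := fun t ht =>
    (continuous_meanEnergy φ ℓ n 2).continuousAt.div (continuous_meanEnergy φ ℓ n 1).continuousAt
      (hpos t ht)
  unfold ratioF
  split_ifs with h0 h2
  · subst h0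
    refine Tendsto.limUnder_eq (((hc 0 hs).mono_left nhdsWithin_le_nhds).congr' ?_)
    filter_upwards [Ioo_mem_nhdsGT (show (0 : ℝ) < 2 by norm_num)] with t ht
    exact (hin t ht).symm
  · subst h2
    refine Tendsto.limUnder_eq (((hc 2 hs).mono_left nhdsWithin_le_nhds).congr' ?_)
    filter_upwards [Ioo_mem_nhdsLT (show (0 : ℝ) < 2 by norm_num)] with t ht
    exact (hin t ht).symm
  · exact hin s ⟨lt_of_le_of_ne hs.1 (Ne.symm h0), lt_of_le_of_ne hs.2 h2⟩

namespace IsDeformation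

variable {φ : Plane → Plane} {O : Set Plane}

theorem eventually_ratioF_eq (hφ : IsDeformation φ O) {ν : ℝ} {ℓ : Fin 2}
    (hJ : ∃ x ∈ unitSquare, scriptJ φ ν ℓ x ≠ 0) {β : ℝ → ℝ}
    (hβ : ∀ s ∈ Ioo (0 : ℝ) 2, β s ≠ 0) :
    ∀ᶠ n : ℕ in atTop, ∀ s ∈ Icc (0 : ℝ) 2,
      ratioF β φ n ℓ s = meanEnergy φ ℓ n 2 s / meanEnergy φ ℓ n 1 s := by
  obtain ⟨δ, hδ, h⟩ := hφ.exists_meanEnergy_ge hJ one_ne_zero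
  filter_upwards [h, eventually_ne_atTop 0, hφ.eventually_regular_scaledCell one_ne_zero,
    hφ.eventually_regular_scaledCell two_ne_zero] with n h1 h2 h3 h4 s hs
  exact ratioF_eq h2 hβ ℓ h3 h4 (fun t ht => (hδ.trans_le (h1 t ht)).ne') hs

/-- The objects in the definition of the estimator are well defined for all large `n`. -/
theorem eventually_wellDefined (hφ : IsDeformation φ O) {ν : ℝ} {ℓ : Fin 2}
    (hJ : ∃ x ∈ unitSquare, scriptJ φ ν ℓ x ≠ 0) {β : ℝ → ℝ}
    (hβ : ∀ s ∈ Ioo (0 : ℝ) 2, β s ≠ 0) :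
    ∀ᶠ n : ℕ in atTop,
      (∀ θ ∈ ({1, 2} : Set ℕ), ∀ i₁ ∈ Finset.Icc 1 (n - θ), ∀ i₂ ∈ Finset.Icc 1 (n - θ),
        (matA φ n θ i₁ i₂).det ≠ 0 ∧ (matB φ n θ i₁ i₂).det ≠ 0) ∧
      (∀ s ∈ Ioo (0 : ℝ) 2, fBar β φ n 1 ℓ s ≠ 0) ∧
      ContinuousOn (ratioF β φ n ℓ) (Icc 0 2) := by
  obtain ⟨δ, hδ, h⟩ := hφ.exists_meanEnergy_ge hJ one_ne_zero
  filter_upwards [h, eventually_ne_atTop 0, hφ.eventually_regular_scaledCell one_ne_zero,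
    hφ.eventually_regular_scaledCell two_ne_zero, hφ.eventually_ratioF_eq hJ hβ]
    with n h1 h2 h3 h4 h5
  refine ⟨?_, fun s hs => ?_, ?_⟩
  · intro θ hθ i₁ hi₁ i₂ hi₂
    rw [matA_eq_cell, matB_eq_cell]
    rcases hθ with rfl | hθ
    · exact (scaledCell_regular_iff h2 1 (i₁, i₂)).1 (h3 (i₁, i₂) (Finset.mem_product.2 ⟨hi₁, hi₂⟩))
    · rw [mem_singleton_iff] at hθ
      subst hθ
      exact (scaledCell_regular_iff h2 2 (i₁, i₂)).1 (h4 (i₁, i₂) (Finset.mem_product.2 ⟨hi₁, hi₂⟩))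
  · rw [fBar_eq_meanEnergy h2 β ℓ h3 hs]
    have hn0 : (0 : ℝ) < n := by positivity
    exact mul_ne_zero (hβ s hs) (mul_ne_zero (kernelFactor_ne_zero s)
      (mul_ne_zero (by positivity) (hδ.trans_le (h1 s ⟨hs.1.le, hs.2.le⟩)).ne'))
  · refine ContinuousOn.congr ?_ h5
    exact (continuous_meanEnergy φ ℓ n 2).continuousOn.div
      (continuous_meanEnergy φ ℓ n 1).continuousOn fun t ht => (hδ.trans_le (h1 t ht)).ne'

theorem eventually_ratioF_sub (hφ : IsDeformation φ O) {ν : ℝ} {ℓ : Fin 2}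
    (hJ : ∃ x ∈ unitSquare, scriptJ φ ν ℓ x ≠ 0) {β : ℝ → ℝ}
    (hβ : ∀ s ∈ Ioo (0 : ℝ) 2, β s ≠ 0) {ε : ℝ} (hε : 0 < ε) :
    ∀ᶠ n : ℕ in atTop, ∀ s ∈ Icc (0 : ℝ) 2, |ratioF β φ n ℓ s - 2 ^ (2 * s - 2)| ≤ ε := by
  obtain ⟨δ, hδ, h⟩ := hφ.exists_meanEnergy_ge hJ one_ne_zero
  filter_upwards [h, hφ.eventually_ratioF_eq hJ hβ,
    hφ.eventually_meanEnergy_two_sub ℓ (mul_pos hε hδ)] with n h1 h2 h3 s hs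
  have hpos := hδ.trans_le (h1 s hs)
  have e : meanEnergy φ ℓ n 2 s / meanEnergy φ ℓ n 1 s - 2 ^ (2 * s - 2) =
      (meanEnergy φ ℓ n 2 s - 2 ^ (2 * s - 2) * meanEnergy φ ℓ n 1 s) / meanEnergy φ ℓ n 1 s := by
    field_simp
  rw [h2 s hs, e, abs_div, abs_of_pos hpos, div_le_iff₀ hpos]
  exact (h3 s hs).trans (mul_le_mul_of_nonneg_left (h1 s hs) hε.le)

/-! ### Convergence of the minimisers -/

/-- If the quadratic variations of `Y` have the right asymptotic size, they do not vanish and the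
minimisers of the contrast converge. -/
theorem tendsto_argmin (hφ : IsDeformation φ O) {ν : ℝ} (hν : ν ∈ Ioo (0 : ℝ) 2) {ℓ : Fin 2}
    (hJ : ∃ x ∈ unitSquare, scriptJ φ ν ℓ x ≠ 0) {β : ℝ → ℝ}
    (hβ : ∀ s ∈ Ioo (0 : ℝ) 2, β s ≠ 0) {Y : Plane → ℝ} {γ : ℝ} (hγ : γ ≠ 0)
    (hY : ∀ θ ∈ ({1, 2} : Set ℕ), Tendsto (fun n : ℕ => quadVar φ Y n θ ℓ / (n : ℝ) ^ (4 - 2 * ν) -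
      γ * meanEnergy φ ℓ n θ ν) atTop (𝓝 0)) :
    (∀ᶠ n : ℕ in atTop, quadVar φ Y n 2 ℓ ≠ 0) ∧
    ∀ u : ℕ → ℝ, (∀ᶠ n : ℕ in atTop, u n ∈ Icc (0 : ℝ) 2 ∧
      IsMinOn (contrast β φ Y n ℓ) (Icc 0 2) (u n)) → Tendsto u atTop (𝓝 ν) := by
  have hν' : ν ∈ Icc (0 : ℝ) 2 := ⟨hν.1.le, hν.2.le⟩
  -- Division by the mean energy is harmless because of its positive lower bound. The nonzero limit
  -- `γ` also excludes `quadVar = 0` for large `n`.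
  have hquot : ∀ θ ∈ ({1, 2} : Set ℕ), Tendsto (fun n : ℕ =>
      quadVar φ Y n θ ℓ / (n : ℝ) ^ (4 - 2 * ν) / meanEnergy φ ℓ n θ ν) atTop (𝓝 γ) := by
    intro θ hθ
    have hθ0 : θ ≠ 0 := by rcases hθ with rfl | rfl <;> norm_num
    obtain ⟨δ, hδ, h⟩ := hφ.exists_meanEnergy_ge hJ hθ0
    rw [← tendsto_sub_nhds_zero_iff]
    have hb : Tendsto (fun n : ℕ => ‖quadVar φ Y n θ ℓ / (n : ℝ) ^ (4 - 2 * ν) -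
        γ * meanEnergy φ ℓ n θ ν‖ / δ) atTop (𝓝 0) := by
      simpa using (hY θ hθ).norm.div_const δ
    refine squeeze_zero_norm' ?_ hb
    filter_upwards [h] with n hn
    have hpos := hδ.trans_le (hn ν hν')
    have e : quadVar φ Y n θ ℓ / (n : ℝ) ^ (4 - 2 * ν) / meanEnergy φ ℓ n θ ν - γ =
        (quadVar φ Y n θ ℓ / (n : ℝ) ^ (4 - 2 * ν) - γ * meanEnergy φ ℓ n θ ν) /
          meanEnergy φ ℓ n θ ν := by field_simp
    rw [e, norm_div, Real.norm_of_nonneg hpos.le]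
    exact div_le_div_of_nonneg_left (norm_nonneg _) hδ (hn ν hν')
  have h1 := hquot 1 (by simp)
  have h2 := hquot 2 (by simp)
  have hne : ∀ᶠ n : ℕ in atTop, quadVar φ Y n 2 ℓ ≠ 0 := by
    filter_upwards [h2.eventually_ne hγ] with n hn h0
    simp [h0] at hn
  refine ⟨hne, fun u hu => ?_⟩
  set w : ℕ → ℝ := fun n => quadVar φ Y n 1 ℓ / quadVar φ Y n 2 ℓ with hw
  have hcon : ∀ n s, contrast β φ Y n ℓ s = (w n * ratioF β φ n ℓ s - 1) ^ 2 := by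
    intro n s
    rw [contrast, hw]
    ring
  have hwF : Tendsto (fun n => w n * ratioF β φ n ℓ ν) atTop (𝓝 1) := by
    have := h1.div h2 hγ
    rw [div_self hγ] at this
    refine this.congr' ?_
    filter_upwards [hφ.eventually_ratioF_eq hJ hβ, eventually_ne_atTop 0] with n e1 e2
    have hn0 : (0 : ℝ) < n := by positivity
    have hN : (n : ℝ) ^ (4 - 2 * ν) ≠ 0 := by positivity
    rw [e1 ν hν', hw]
    simp only [Pi.div_apply]
    field_simp
  have hFu : ∀ v : ℕ → ℝ, (∀ᶠ n in atTop, v n ∈ Icc (0 : ℝ) 2) →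
      Tendsto (fun n => ratioF β φ n ℓ (v n) - 2 ^ (2 * v n - 2)) atTop (𝓝 0) := by
    intro v hv
    rw [Metric.tendsto_nhds]
    intro ε hε
    filter_upwards [hφ.eventually_ratioF_sub hJ hβ (half_pos hε), hv] with n e1 e2
    rw [Real.dist_eq, sub_zero]
    exact (e1 _ e2).trans_lt (half_lt_self hε)
  have hFν : Tendsto (fun n => ratioF β φ n ℓ ν) atTop (𝓝 (2 ^ (2 * ν - 2))) := by
    have := (hFu (fun _ => ν) (by simp [hν'.1, hν'.2])).add_const ((2 : ℝ) ^ (2 * ν - 2))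
    simpa using this
  have hpν : (2 : ℝ) ^ (2 * ν - 2) ≠ 0 := by positivity
  have hwlim : Tendsto w atTop (𝓝 (1 / 2 ^ (2 * ν - 2))) := by
    refine (hwF.div hFν hpν).congr' ?_
    filter_upwards [hFν.eventually_ne hpν] with n hn
    simp only [Pi.div_apply]
    field_simp
  -- Minimality bounds the distance to `1` at `u n` by the distance at `ν`, which tends to `0`.
  have hwFu : Tendsto (fun n => w n * ratioF β φ n ℓ (u n)) atTop (𝓝 1) := by
    rw [← tendsto_sub_nhds_zero_iff]
    have hb : Tendsto (fun n => ‖w n * ratioF β φ n ℓ ν - 1‖) atTop (𝓝 0) := by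
      simpa using (hwF.sub_const 1).norm
    refine squeeze_zero_norm' ?_ hb
    filter_upwards [hu] with n hn
    have := hn.2 hν'
    simp only [mem_ofPred_eq, hcon] at this
    exact sq_le_sq.1 this
  have hFu' : Tendsto (fun n => ratioF β φ n ℓ (u n)) atTop (𝓝 (2 ^ (2 * ν - 2))) := by
    have hp : (1 : ℝ) / 2 ^ (2 * ν - 2) ≠ 0 := one_div_ne_zero hpν
    have := hwFu.div hwlim hp
    rw [one_div_one_div] at this
    refine this.congr' ?_
    filter_upwards [hwlim.eventually_ne hp] with n hn
    simp only [Pi.div_apply]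
    field_simp
  have hpow : Tendsto (fun n => (2 : ℝ) ^ (2 * u n - 2)) atTop (𝓝 (2 ^ (2 * ν - 2))) := by
    have := hFu'.sub (hFu u (hu.mono fun n hn => hn.1))
    simpa using this
  have hlog := hpow.log hpν
  -- Taking logarithms inverts the limit function `2 ^ (2 x - 2)`.
  have e : ∀ x : ℝ, (Real.log (2 ^ (2 * x - 2)) / Real.log 2 + 2) / 2 = x := by
    intro x
    rw [Real.log_rpow (by norm_num), mul_div_assoc, div_self (Real.log_pos (by norm_num)).ne']
    ring
  have := ((hlog.div_const (Real.log 2)).add_const 2).div_const 2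
  simpa only [e] using this

end IsDeformation

/-! ### Radial functions on the plane: regularity of the profile -/

theorem contDiffOn_line_of_partialDeriv (j : Fin 2) {f : Plane → ℝ} {U : Set Plane} (hU : IsOpen U)
    {N : ℕ} (hd : ∀ k < N, ∀ x ∈ U,
      LineDifferentiableAt ℝ ((partialDeriv j)^[k] f) x (EuclideanSpace.single j 1))
    (hc : ContinuousOn ((partialDeriv j)^[N] f) U) (z : Plane) :
    ContDiffOn ℝ N (fun t : ℝ => f (z + t • EuclideanSpace.single j 1))
      {t : ℝ | z + t • EuclideanSpace.single j 1 ∈ U} := by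
  set T := {t : ℝ | z + t • EuclideanSpace.single j 1 ∈ U} with hT
  have hTo : IsOpen T := hU.preimage (by fun_prop : Continuous
    fun t : ℝ => z + t • (EuclideanSpace.single j 1 : Plane))
  have hder : ∀ k < N, ∀ t ∈ T, HasDerivAt
      (fun t : ℝ => (partialDeriv j)^[k] f (z + t • EuclideanSpace.single j 1))
      ((partialDeriv j)^[k + 1] f (z + t • EuclideanSpace.single j 1)) t := by
    intro k hk t ht
    have h1 : HasDerivAt (fun u : ℝ => (partialDeriv j)^[k] f
        (z + t • EuclideanSpace.single j 1 + u • EuclideanSpace.single j 1))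
        ((partialDeriv j)^[k + 1] f (z + t • EuclideanSpace.single j 1)) (t - t) := by
      rw [sub_self, Function.iterate_succ_apply']
      exact (hd k hk _ ht).hasLineDerivAt
    have h2 := HasDerivAt.comp_sub_const t t h1
    refine h2.congr_of_eventuallyEq (Eventually.of_forall fun u => ?_)
    simp only
    rw [show z + t • (EuclideanSpace.single j 1 : Plane) + (u - t) • EuclideanSpace.single j 1 =
      z + u • EuclideanSpace.single j 1 by module]
  -- Descending induction on the order of the derivative: the top one is continuous by assumption,
  -- and each lower one has the next as its derivative along the line.
  have key : ∀ m k : ℕ, k + m = N → ContDiffOn ℝ m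
      (fun t : ℝ => (partialDeriv j)^[k] f (z + t • EuclideanSpace.single j 1)) T := by
    intro m
    induction m with
    | zero =>
      intro k hk
      rw [add_zero] at hk
      subst hk
      simp only [Nat.cast_zero]
      exact contDiffOn_zero.2 (hc.comp (by fun_prop) fun t ht => ht)
    | succ m ih =>
      intro k hk
      rw [Nat.cast_add, Nat.cast_one, contDiffOn_succ_iff_deriv_of_isOpen hTo]
      refine ⟨fun t ht => (hder k (by lia) t ht).differentiableAt.differentiableWithinAt,
        fun h => by simp at h, ?_⟩
      exact (ih (k + 1) (by lia)).congr fun t ht => (hder k (by lia) t ht).deriv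
  exact key N 0 (by lia)

/-- A function of the norm only. -/
def IsRadial (F : Plane → ℝ) : Prop := ∀ z w, ‖z‖ = ‖w‖ → F z = F w

/-- The profile of a radial function, as a function of the squared norm. -/
def radialProfile (F : Plane → ℝ) (q : ℝ) : ℝ := F (EuclideanSpace.single 0 (√q))

theorem IsRadial.eq_profile {F : Plane → ℝ} (hF : IsRadial F) (z : Plane) {q : ℝ}
    (hq : ‖z‖ ^ 2 = q) : F z = radialProfile F q := by
  subst hq
  exact hF _ _ (by simp [Real.sqrt_sq])

theorem norm_sq_plane (z : Plane) : ‖z‖ ^ 2 = z 0 ^ 2 + z 1 ^ 2 := by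
  rw [EuclideanSpace.real_norm_sq_eq, Fin.sum_univ_two]

theorem norm_add_smul_single_sq (z : Plane) (j : Fin 2) (t : ℝ) :
    ‖z + t • (EuclideanSpace.single j 1 : Plane)‖ ^ 2 = ‖z‖ ^ 2 + 2 * t * z j + t ^ 2 := by
  rw [norm_sq_plane, norm_sq_plane]
  fin_cases j <;> simp <;> ring

/-- Along the line `z + t e_j` the squared norm is `‖z‖ ^ 2 + 2 t z_j + t ^ 2`. As `z_j ≠ 0`, this
can be solved for `t = τ q` smoothly near `q = ‖z‖ ^ 2`, and the profile is the restriction of `F`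
to the line composed with `τ`. -/
theorem IsRadial.contDiffAt_profile {F : Plane → ℝ} (hF : IsRadial F) (j : Fin 2) {z : Plane}
    (hz : z j ≠ 0) {N : ℕ}
    (hc : ContDiffAt ℝ N (fun t : ℝ => F (z + t • EuclideanSpace.single j 1)) 0) :
    ContDiffAt ℝ N (radialProfile F) (‖z‖ ^ 2) := by
  set τ : ℝ → ℝ := fun q => -z j + z j * √(1 + (q - ‖z‖ ^ 2) / z j ^ 2) with hτ
  have hτ0 : τ (‖z‖ ^ 2) = 0 := by simp [hτ]
  have hτc : ContDiffAt ℝ N τ (‖z‖ ^ 2) := by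
    refine contDiffAt_const.add (contDiffAt_const.mul (ContDiffAt.sqrt ?_ (by simp)))
    exact contDiffAt_const.add ((contDiffAt_id.sub contDiffAt_const).div_const _)
  have hcomp : ContDiffAt ℝ N (fun q => F (z + τ q • EuclideanSpace.single j 1)) (‖z‖ ^ 2) :=
    ContDiffAt.comp (g := fun t : ℝ => F (z + t • EuclideanSpace.single j 1)) _
      (by rw [hτ0]; exact hc) hτc
  refine hcomp.congr_of_eventuallyEq ?_
  have hcont : ContinuousAt (fun q : ℝ => 1 + (q - ‖z‖ ^ 2) / z j ^ 2) (‖z‖ ^ 2) := by fun_prop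
  filter_upwards [hcont.eventually_const_le (u := 0) (by simp)] with q hq
  refine (hF.eq_profile _ ?_).symm
  rw [norm_add_smul_single_sq]
  have hs := Real.sq_sqrt hq
  have e : 2 * τ q * z j + τ q ^ 2 = z j ^ 2 * √(1 + (q - ‖z‖ ^ 2) / z j ^ 2) ^ 2 - z j ^ 2 := by
    simp only [hτ]; ring
  rw [add_assoc, e, hs]
  field_simp
  ring

/-! ### Partial derivatives of fourth order of a radial function -/

theorem partialDeriv_zero_of_eqOn {f : Plane → ℝ} {G G' : ℝ → ℝ → ℝ} {V : Set Plane}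
    (hV : IsOpen V) (h : ∀ z ∈ V, f z = G (z 0) (z 1))
    (hG : ∀ z ∈ V, HasDerivAt (fun x => G x (z 1)) (G' (z 0) (z 1)) (z 0)) :
    ∀ z ∈ V, partialDeriv 0 f z = G' (z 0) (z 1) := by
  intro z hz
  have h1 : HasDerivAt (fun t : ℝ => G (z 0 + t) (z 1)) (G' (z 0) (z 1)) 0 :=
    HasDerivAt.comp_const_add (z 0) 0 (by simpa using hG z hz)
  have h2 : HasDerivAt (fun t : ℝ => f (z + t • EuclideanSpace.single 0 1)) (G' (z 0) (z 1)) 0 := by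
    refine h1.congr_of_eventuallyEq ?_
    have hc : ContinuousAt (fun t : ℝ => z + t • (EuclideanSpace.single 0 1 : Plane)) 0 := by
      fun_prop
    filter_upwards [hc.preimage_mem_nhds (hV.mem_nhds (by simpa using hz))] with t ht
    rw [h _ ht]
    simp
  exact h2.deriv

theorem partialDeriv_one_of_eqOn {f : Plane → ℝ} {G G' : ℝ → ℝ → ℝ} {V : Set Plane}
    (hV : IsOpen V) (h : ∀ z ∈ V, f z = G (z 0) (z 1))
    (hG : ∀ z ∈ V, HasDerivAt (fun y => G (z 0) y) (G' (z 0) (z 1)) (z 1)) :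
    ∀ z ∈ V, partialDeriv 1 f z = G' (z 0) (z 1) := by
  intro z hz
  have h1 : HasDerivAt (fun t : ℝ => G (z 0) (z 1 + t)) (G' (z 0) (z 1)) 0 :=
    HasDerivAt.comp_const_add (z 1) 0 (by simpa using hG z hz)
  have h2 : HasDerivAt (fun t : ℝ => f (z + t • EuclideanSpace.single 1 1)) (G' (z 0) (z 1)) 0 := by
    refine h1.congr_of_eventuallyEq ?_
    have hc : ContinuousAt (fun t : ℝ => z + t • (EuclideanSpace.single 1 1 : Plane)) 0 := by
      fun_prop
    filter_upwards [hc.preimage_mem_nhds (hV.mem_nhds (by simpa using hz))] with t ht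
    rw [h _ ht]
    simp
  exact h2.deriv

section Mixed

variable {k : ℕ → ℝ → ℝ} {W : Set ℝ}

theorem hasDerivAt_profile_comp_left (hk : ∀ i < 4, ∀ q ∈ W, HasDerivAt (k i) (k (i + 1) q) q)
    {i : ℕ} (hi : i < 4) {x y : ℝ} (h : x ^ 2 + y ^ 2 ∈ W) :
    HasDerivAt (fun x => k i (x ^ 2 + y ^ 2)) (k (i + 1) (x ^ 2 + y ^ 2) * (2 * x)) x := by
  have h1 : HasDerivAt (fun x : ℝ => x ^ 2 + y ^ 2) (2 * x) x := by
    simpa using (hasDerivAt_pow 2 x).add_const (y ^ 2)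
  exact (hk i hi _ h).comp x h1

theorem hasDerivAt_profile_comp_right (hk : ∀ i < 4, ∀ q ∈ W, HasDerivAt (k i) (k (i + 1) q) q)
    {i : ℕ} (hi : i < 4) {x y : ℝ} (h : x ^ 2 + y ^ 2 ∈ W) :
    HasDerivAt (fun y => k i (x ^ 2 + y ^ 2)) (k (i + 1) (x ^ 2 + y ^ 2) * (2 * y)) y := by
  have h1 : HasDerivAt (fun y : ℝ => x ^ 2 + y ^ 2) (2 * y) y := by
    simpa using (hasDerivAt_pow 2 y).const_add (x ^ 2)
  exact (hk i hi _ h).comp y h1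

theorem hasDerivAt_const_mul_pow (c x : ℝ) (m : ℕ) :
    HasDerivAt (fun x : ℝ => c * x ^ m) (c * (m * x ^ (m - 1))) x :=
  (hasDerivAt_pow m x).const_mul c

/-- The fourth-order partial derivatives of a radial function in terms of its profile. -/
theorem mixedPartial_radial {F : Plane → ℝ} (hW : IsOpen W)
    (hk : ∀ i < 4, ∀ q ∈ W, HasDerivAt (k i) (k (i + 1) q) q)
    (hF : ∀ z : Plane, F z = k 0 (‖z‖ ^ 2)) {z : Plane} (hz : ‖z‖ ^ 2 ∈ W) :
    mixedPartial 4 0 F z = 16 * z 0 ^ 4 * k 4 (‖z‖ ^ 2) + 48 * z 0 ^ 2 * k 3 (‖z‖ ^ 2) +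
        12 * k 2 (‖z‖ ^ 2) ∧
    mixedPartial 3 1 F z = 16 * z 0 ^ 3 * z 1 * k 4 (‖z‖ ^ 2) + 24 * z 0 * z 1 * k 3 (‖z‖ ^ 2) ∧
    mixedPartial 2 2 F z = 16 * z 0 ^ 2 * z 1 ^ 2 * k 4 (‖z‖ ^ 2) +
        8 * (z 0 ^ 2 + z 1 ^ 2) * k 3 (‖z‖ ^ 2) + 4 * k 2 (‖z‖ ^ 2) ∧
    mixedPartial 1 3 F z = 16 * z 0 * z 1 ^ 3 * k 4 (‖z‖ ^ 2) + 24 * z 0 * z 1 * k 3 (‖z‖ ^ 2) ∧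
    mixedPartial 0 4 F z = 16 * z 1 ^ 4 * k 4 (‖z‖ ^ 2) + 48 * z 1 ^ 2 * k 3 (‖z‖ ^ 2) +
        12 * k 2 (‖z‖ ^ 2) := by
  set V : Set Plane := {z | z 0 ^ 2 + z 1 ^ 2 ∈ W} with hVdef
  have hV : IsOpen V := hW.preimage (by fun_prop : Continuous fun z : Plane => z 0 ^ 2 + z 1 ^ 2)
  have hzV : z ∈ V := by rw [hVdef, mem_ofPred_eq, ← norm_sq_plane]; exact hz
  rw [norm_sq_plane]
  have L := fun {i : ℕ} (hi : i < 4) {z : Plane} (hz : z ∈ V) =>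
    hasDerivAt_profile_comp_left hk hi (x := z 0) (y := z 1) hz
  have R := fun {i : ℕ} (hi : i < 4) {z : Plane} (hz : z ∈ V) =>
    hasDerivAt_profile_comp_right hk hi (x := z 0) (y := z 1) hz
  have M := hasDerivAt_const_mul_pow
  -- Names: `a` for derivatives in the first coordinate, `b` in the second, and two-digit `c` for
  -- mixed ones with the order in each coordinate. The second coordinate is differentiated first, as
  -- in `mixedPartial`.
  have a1 := partialDeriv_zero_of_eqOn hV (f := F)
    (G := fun x y => k 0 (x ^ 2 + y ^ 2))
    (G' := fun x y => 2 * x ^ 1 * k 1 (x ^ 2 + y ^ 2))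
    (fun z _ => by rw [hF, norm_sq_plane]) fun z hz => by
      exact (L (i := 0) (by norm_num) hz).congr_deriv
        (by norm_num; ring)
  have a2 := partialDeriv_zero_of_eqOn hV
    (G := fun x y => 2 * x ^ 1 * k 1 (x ^ 2 + y ^ 2))
    (G' := fun x y => 4 * x ^ 2 * k 2 (x ^ 2 + y ^ 2) + 2 * k 1 (x ^ 2 + y ^ 2))
    a1 fun z hz => by
      exact ((M 2 (z 0) 1).mul (L (i := 1) (by norm_num) hz)).congr_deriv
        (by norm_num; ring)
  have a3 := partialDeriv_zero_of_eqOn hV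
    (G := fun x y => 4 * x ^ 2 * k 2 (x ^ 2 + y ^ 2) + 2 * k 1 (x ^ 2 + y ^ 2))
    (G' := fun x y => 8 * x ^ 3 * k 3 (x ^ 2 + y ^ 2) + 12 * x ^ 1 * k 2 (x ^ 2 + y ^ 2))
    a2 fun z hz => by
      exact (((M 4 (z 0) 2).mul (L (i := 2) (by norm_num) hz)).add ((L (i := 1) (by norm_num) hz).const_mul 2)).congr_deriv
        (by norm_num; ring)
  have a4 := partialDeriv_zero_of_eqOn hV
    (G := fun x y => 8 * x ^ 3 * k 3 (x ^ 2 + y ^ 2) + 12 * x ^ 1 * k 2 (x ^ 2 + y ^ 2))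
    (G' := fun x y => 16 * x ^ 4 * k 4 (x ^ 2 + y ^ 2) + 48 * x ^ 2 * k 3 (x ^ 2 + y ^ 2) + 12 * k 2 (x ^ 2 + y ^ 2))
    a3 fun z hz => by
      exact (((M 8 (z 0) 3).mul (L (i := 3) (by norm_num) hz)).add ((M 12 (z 0) 1).mul (L (i := 2) (by norm_num) hz))).congr_deriv
        (by norm_num; ring)
  have b1 := partialDeriv_one_of_eqOn hV (f := F)
    (G := fun x y => k 0 (x ^ 2 + y ^ 2))
    (G' := fun x y => 2 * y ^ 1 * k 1 (x ^ 2 + y ^ 2))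
    (fun z _ => by rw [hF, norm_sq_plane]) fun z hz => by
      exact (R (i := 0) (by norm_num) hz).congr_deriv
        (by norm_num; ring)
  have b2 := partialDeriv_one_of_eqOn hV
    (G := fun x y => 2 * y ^ 1 * k 1 (x ^ 2 + y ^ 2))
    (G' := fun x y => 4 * y ^ 2 * k 2 (x ^ 2 + y ^ 2) + 2 * k 1 (x ^ 2 + y ^ 2))
    b1 fun z hz => by
      exact ((M 2 (z 1) 1).mul (R (i := 1) (by norm_num) hz)).congr_deriv
        (by norm_num; ring)
  have b3 := partialDeriv_one_of_eqOn hV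
    (G := fun x y => 4 * y ^ 2 * k 2 (x ^ 2 + y ^ 2) + 2 * k 1 (x ^ 2 + y ^ 2))
    (G' := fun x y => 8 * y ^ 3 * k 3 (x ^ 2 + y ^ 2) + 12 * y ^ 1 * k 2 (x ^ 2 + y ^ 2))
    b2 fun z hz => by
      exact (((M 4 (z 1) 2).mul (R (i := 2) (by norm_num) hz)).add ((R (i := 1) (by norm_num) hz).const_mul 2)).congr_deriv
        (by norm_num; ring)
  have b4 := partialDeriv_one_of_eqOn hV
    (G := fun x y => 8 * y ^ 3 * k 3 (x ^ 2 + y ^ 2) + 12 * y ^ 1 * k 2 (x ^ 2 + y ^ 2))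
    (G' := fun x y => 16 * y ^ 4 * k 4 (x ^ 2 + y ^ 2) + 48 * y ^ 2 * k 3 (x ^ 2 + y ^ 2) + 12 * k 2 (x ^ 2 + y ^ 2))
    b3 fun z hz => by
      exact (((M 8 (z 1) 3).mul (R (i := 3) (by norm_num) hz)).add ((M 12 (z 1) 1).mul (R (i := 2) (by norm_num) hz))).congr_deriv
        (by norm_num; ring)
  have c13 := partialDeriv_zero_of_eqOn hV
    (G := fun x y => 8 * y ^ 3 * k 3 (x ^ 2 + y ^ 2) + 12 * y ^ 1 * k 2 (x ^ 2 + y ^ 2))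
    (G' := fun x y => 16 * x * y ^ 3 * k 4 (x ^ 2 + y ^ 2) + 24 * x * y * k 3 (x ^ 2 + y ^ 2))
    b3 fun z hz => by
      exact (((L (i := 3) (by norm_num) hz).const_mul (8 * z 1 ^ 3)).add ((L (i := 2) (by norm_num) hz).const_mul (12 * z 1 ^ 1))).congr_deriv
        (by norm_num; ring)
  have c12 := partialDeriv_zero_of_eqOn hV
    (G := fun x y => 4 * y ^ 2 * k 2 (x ^ 2 + y ^ 2) + 2 * k 1 (x ^ 2 + y ^ 2))
    (G' := fun x y => 8 * y ^ 2 * x ^ 1 * k 3 (x ^ 2 + y ^ 2) + 4 * x ^ 1 * k 2 (x ^ 2 + y ^ 2))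
    b2 fun z hz => by
      exact (((L (i := 2) (by norm_num) hz).const_mul (4 * z 1 ^ 2)).add ((L (i := 1) (by norm_num) hz).const_mul 2)).congr_deriv
        (by norm_num; ring)
  have c22 := partialDeriv_zero_of_eqOn hV
    (G := fun x y => 8 * y ^ 2 * x ^ 1 * k 3 (x ^ 2 + y ^ 2) + 4 * x ^ 1 * k 2 (x ^ 2 + y ^ 2))
    (G' := fun x y => 16 * x ^ 2 * y ^ 2 * k 4 (x ^ 2 + y ^ 2) + 8 * (x ^ 2 + y ^ 2) * k 3 (x ^ 2 + y ^ 2) + 4 * k 2 (x ^ 2 + y ^ 2))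
    c12 fun z hz => by
      exact (((M (8 * z 1 ^ 2) (z 0) 1).mul (L (i := 3) (by norm_num) hz)).add ((M 4 (z 0) 1).mul (L (i := 2) (by norm_num) hz))).congr_deriv
        (by norm_num; ring)
  have c11 := partialDeriv_zero_of_eqOn hV
    (G := fun x y => 2 * y ^ 1 * k 1 (x ^ 2 + y ^ 2))
    (G' := fun x y => 4 * y * x ^ 1 * k 2 (x ^ 2 + y ^ 2))
    b1 fun z hz => by
      exact ((L (i := 1) (by norm_num) hz).const_mul (2 * z 1 ^ 1)).congr_deriv
        (by norm_num; ring)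
  have c21 := partialDeriv_zero_of_eqOn hV
    (G := fun x y => 4 * y * x ^ 1 * k 2 (x ^ 2 + y ^ 2))
    (G' := fun x y => 8 * y * x ^ 2 * k 3 (x ^ 2 + y ^ 2) + 4 * y * k 2 (x ^ 2 + y ^ 2))
    c11 fun z hz => by
      exact ((M (4 * z 1) (z 0) 1).mul (L (i := 2) (by norm_num) hz)).congr_deriv
        (by norm_num; ring)
  have c31 := partialDeriv_zero_of_eqOn hV
    (G := fun x y => 8 * y * x ^ 2 * k 3 (x ^ 2 + y ^ 2) + 4 * y * k 2 (x ^ 2 + y ^ 2))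
    (G' := fun x y => 16 * x ^ 3 * y * k 4 (x ^ 2 + y ^ 2) + 24 * x * y * k 3 (x ^ 2 + y ^ 2))
    c21 fun z hz => by
      exact (((M (8 * z 1) (z 0) 2).mul (L (i := 3) (by norm_num) hz)).add ((L (i := 2) (by norm_num) hz).const_mul (4 * z 1))).congr_deriv
        (by norm_num; ring)
  exact ⟨a4 z hzV, c31 z hzV, c22 z hzV, c13 z hzV, b4 z hzV⟩

end Mixed

/-- Bounds on the derivatives of the profile from bounds on the fourth-order partial derivatives,
by evaluating the fourth derivative in radial and tangential directions. -/
theorem profile_bounds {x y q k₂ k₃ k₄ B : ℝ} (hq : q = x ^ 2 + y ^ 2) (hq0 : 0 < q)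
    (h40 : |16 * x ^ 4 * k₄ + 48 * x ^ 2 * k₃ + 12 * k₂| ≤ B)
    (h31 : |16 * x ^ 3 * y * k₄ + 24 * x * y * k₃| ≤ B)
    (h22 : |16 * x ^ 2 * y ^ 2 * k₄ + 8 * (x ^ 2 + y ^ 2) * k₃ + 4 * k₂| ≤ B)
    (h13 : |16 * x * y ^ 3 * k₄ + 24 * x * y * k₃| ≤ B)
    (h04 : |16 * y ^ 4 * k₄ + 48 * y ^ 2 * k₃ + 12 * k₂| ≤ B) :
    |k₂| ≤ 2 * B ∧ q * |k₃| ≤ 3 * B ∧ q ^ 2 * |k₄| ≤ 12 * B := by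
  set A₄ := 16 * x ^ 4 * k₄ + 48 * x ^ 2 * k₃ + 12 * k₂ with hA4
  set A₃ := 16 * x ^ 3 * y * k₄ + 24 * x * y * k₃ with hA3
  set A₂ := 16 * x ^ 2 * y ^ 2 * k₄ + 8 * (x ^ 2 + y ^ 2) * k₃ + 4 * k₂ with hA2
  set A₁ := 16 * x * y ^ 3 * k₄ + 24 * x * y * k₃ with hA1
  set A₀ := 16 * y ^ 4 * k₄ + 48 * y ^ 2 * k₃ + 12 * k₂ with hA0
  have hB : 0 ≤ B := (abs_nonneg _).trans h40
  have hx2 : x ^ 2 ≤ q := by nlinarith [sq_nonneg y]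
  have hy2 : y ^ 2 ≤ q := by nlinarith [sq_nonneg x]
  have hxy : |x * y| ≤ q := by
    rw [abs_le]; constructor <;> nlinarith [sq_nonneg (x + y), sq_nonneg (x - y)]
  have hq2 : 0 < q ^ 2 := by positivity
  have bd : ∀ {a b c : ℝ}, |a| ≤ q → |b| ≤ q → |c| ≤ B →
      -(q ^ 2 * B) ≤ a * b * c ∧ a * b * c ≤ q ^ 2 * B := by
    intro a b c ha hb hc
    rw [← abs_le, abs_mul, abs_mul, pow_two]
    gcongr
  have ax2 : |x ^ 2| ≤ q := by rwa [abs_of_nonneg (sq_nonneg x)]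
  have ay2 : |y ^ 2| ≤ q := by rwa [abs_of_nonneg (sq_nonneg y)]
  -- The fourth derivative is evaluated on four tangential vectors `(y, -x)` in `e1`, on two radial
  -- and two tangential ones in `e2`, and on four radial ones `(x, y)` in `e3`. This isolates `k₂`,
  -- then `k₃`, then `k₄`. In each identity the absolute values of the coefficients add up to `16`.
  have e1 : 12 * (q ^ 2 * k₂) = y ^ 2 * y ^ 2 * A₄ - 4 * (x * y * y ^ 2 * A₃) +
      6 * (x ^ 2 * y ^ 2 * A₂) - 4 * (x ^ 2 * (x * y) * A₁) + x ^ 2 * x ^ 2 * A₀ := by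
    rw [hq, hA0, hA1, hA2, hA3, hA4]; ring
  have e2 : 8 * (q ^ 2 * (q * k₃)) + 4 * (q ^ 2 * k₂) = x ^ 2 * y ^ 2 * A₄ +
      2 * (x * y * y ^ 2 * A₃) - 2 * (x ^ 2 * (x * y) * A₃) + x ^ 2 * x ^ 2 * A₂ +
      y ^ 2 * y ^ 2 * A₂ - 4 * (x ^ 2 * y ^ 2 * A₂) + 2 * (x ^ 2 * (x * y) * A₁) -
      2 * (x * y * y ^ 2 * A₁) + x ^ 2 * y ^ 2 * A₀ := by
    rw [hq, hA0, hA1, hA2, hA3, hA4]; ring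
  have e3 : 16 * (q ^ 2 * (q ^ 2 * k₄)) + 48 * (q ^ 2 * (q * k₃)) + 12 * (q ^ 2 * k₂) =
      x ^ 2 * x ^ 2 * A₄ + 4 * (x ^ 2 * (x * y) * A₃) +
      6 * (x ^ 2 * y ^ 2 * A₂) + 4 * (x * y * y ^ 2 * A₁) + y ^ 2 * y ^ 2 * A₀ := by
    rw [hq, hA0, hA1, hA2, hA3, hA4]; ring
  clear_value A₀ A₁ A₂ A₃ A₄
  have r2 : -(16 * (q ^ 2 * B)) ≤ 12 * (q ^ 2 * k₂) ∧ 12 * (q ^ 2 * k₂) ≤ 16 * (q ^ 2 * B) := by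
    have b1 := bd ay2 ay2 h40
    have b2 := bd hxy ay2 h31
    have b3 := bd ax2 ay2 h22
    have b4 := bd ax2 hxy h13
    have b5 := bd ax2 ax2 h04
    rw [e1]
    constructor <;> linarith [b1.1, b2.1, b3.1, b4.1, b5.1, b1.2, b2.2, b3.2, b4.2, b5.2]
  have r3 : -(16 * (q ^ 2 * B)) ≤ 8 * (q ^ 2 * (q * k₃)) + 4 * (q ^ 2 * k₂) ∧
      8 * (q ^ 2 * (q * k₃)) + 4 * (q ^ 2 * k₂) ≤ 16 * (q ^ 2 * B) := by
    have b1 := bd ax2 ay2 h40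
    have b2 := bd hxy ay2 h31
    have b3 := bd ax2 hxy h31
    have b4 := bd ax2 ax2 h22
    have b5 := bd ay2 ay2 h22
    have b6 := bd ax2 ay2 h22
    have b7 := bd ax2 hxy h13
    have b8 := bd hxy ay2 h13
    have b9 := bd ax2 ay2 h04
    rw [e2]
    constructor <;> linarith [b1.1, b2.1, b3.1, b4.1, b5.1, b1.2, b2.2, b3.2, b4.2, b5.2,
      b6.1, b7.1, b8.1, b9.1, b6.2, b7.2, b8.2, b9.2]
  have r4 : -(16 * (q ^ 2 * B)) ≤
      16 * (q ^ 2 * (q ^ 2 * k₄)) + 48 * (q ^ 2 * (q * k₃)) + 12 * (q ^ 2 * k₂) ∧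
      16 * (q ^ 2 * (q ^ 2 * k₄)) + 48 * (q ^ 2 * (q * k₃)) + 12 * (q ^ 2 * k₂) ≤
        16 * (q ^ 2 * B) := by
    have b1 := bd ax2 ax2 h40
    have b2 := bd ax2 hxy h31
    have b3 := bd ax2 ay2 h22
    have b4 := bd hxy ay2 h13
    have b5 := bd ay2 ay2 h04
    rw [e3]
    constructor <;> linarith [b1.1, b2.1, b3.1, b4.1, b5.1, b1.2, b2.2, b3.2, b4.2, b5.2]
  have cancel : ∀ {u c : ℝ}, -(c * (q ^ 2 * B)) ≤ q ^ 2 * u → q ^ 2 * u ≤ c * (q ^ 2 * B) →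
      |u| ≤ c * B := by
    intro u c h1 h2
    rw [abs_le]
    constructor
    · refine le_of_mul_le_mul_left ?_ hq2
      linarith
    · refine le_of_mul_le_mul_left ?_ hq2
      linarith
  have hqB : 0 ≤ q ^ 2 * B := by positivity
  have g3 : q * |k₃| = |q * k₃| := by rw [abs_mul, abs_of_pos hq0]
  have g4 : q ^ 2 * |k₄| = |q ^ 2 * k₄| := by rw [abs_mul, abs_of_pos hq2]
  rw [g3, g4]
  exact ⟨cancel (by linarith [r2.1]) (by linarith [r2.2]),
    cancel (by linarith [r2.1, r2.2, r3.1]) (by linarith [r2.1, r2.2, r3.2]),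
    cancel (by linarith [r2.1, r2.2, r3.1, r3.2, r4.1]) (by linarith [r2.1, r2.2, r3.1, r3.2, r4.2])⟩

theorem isOpen_contDiffAt {f : ℝ → ℝ} (N : ℕ) : IsOpen {q | ContDiffAt ℝ N f q} :=
  isOpen_iff_eventually.2 fun x hx =>
    ContDiffAt.eventually (show ContDiffAt ℝ N f x from hx) (by simp)

theorem contDiffOn_iterate_deriv {f : ℝ → ℝ} {W : Set ℝ} (hW : IsOpen W) {N : ℕ}
    (hf : ContDiffOn ℝ N f W) (i m : ℕ) (h : i + m = N) : ContDiffOn ℝ m (deriv^[i] f) W := by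
  induction i generalizing m with
  | zero => rw [zero_add] at h; subst h; exact hf
  | succ i ih =>
    rw [Function.iterate_succ_apply']
    exact (ih (m + 1) (by lia)).deriv_of_isOpen hW (by norm_cast)

theorem hasDerivAt_iterate_deriv {f : ℝ → ℝ} {W : Set ℝ} (hW : IsOpen W) {N : ℕ}
    (hf : ContDiffOn ℝ N f W) {i : ℕ} (hi : i < N) {q : ℝ} (hq : q ∈ W) :
    HasDerivAt (deriv^[i] f) (deriv^[i + 1] f q) q := by
  have h := contDiffOn_iterate_deriv hW hf i (N - i) (by lia)
  rw [Function.iterate_succ_apply']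
  refine ((h.differentiableOn ?_).differentiableAt (hW.mem_nhds hq)).hasDerivAt
  exact_mod_cast (by lia : N - i ≠ 0)

theorem rpow_norm_sq_eq (z : Plane) (ν : ℝ) : (‖z‖ ^ 2) ^ (ν - 2) = ‖z‖ ^ (2 * ν - 4) := by
  rw [← Real.rpow_natCast, ← Real.rpow_mul (norm_nonneg z)]
  congr 1
  push_cast
  ring

/-- Distances between points of a compact preconnected set fill an interval. -/
theorem exists_dist_range {D : Set Plane} (hDc : IsCompact D) (hDp : IsPreconnected D)
    (hD : ∃ x ∈ D, ∃ y ∈ D, x ≠ y) :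
    ∃ R > 0, (∀ x ∈ D, ∀ y ∈ D, ‖x - y‖ ≤ R) ∧
      ∀ r ∈ Icc 0 R, ∃ x ∈ D, ∃ y ∈ D, ‖x - y‖ = r := by
  obtain ⟨a, ha, b, hb, hab⟩ := hD
  have hcont : ContinuousOn (fun p : Plane × Plane => ‖p.1 - p.2‖) (D ×ˢ D) := by fun_prop
  obtain ⟨p, hp, hmax⟩ := (hDc.prod hDc).exists_isMaxOn ⟨(a, b), ha, hb⟩ hcont
  have hle : ∀ x ∈ D, ∀ y ∈ D, ‖x - y‖ ≤ ‖p.1 - p.2‖ := fun x hx y hy =>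
    hmax (a := (x, y)) ⟨hx, hy⟩
  refine ⟨‖p.1 - p.2‖, (norm_pos_iff.2 (sub_ne_zero.2 hab)).trans_le (hle a ha b hb), hle, ?_⟩
  intro r hr
  have := (hDp.prod hDp).intermediate_value (a := (a, a)) (b := p) ⟨ha, ha⟩ hp hcont
  simp only [sub_self, norm_zero] at this
  obtain ⟨q, hq, hqr⟩ := this hr
  exact ⟨q.1, hq.1, q.2, hq.2, hqr⟩

/-- Smoothness and bounds are given only at differences of points of `D`. Since `F` is radial only
the norms matter, and these fill an interval by connectedness. Everything thus passes to the
profile, for which derivatives in arbitrary directions are available. -/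
theorem IsRadial.exists_profile_bounds {F : Plane → ℝ} (hF : IsRadial F) {ν : ℝ} {D : Set Plane}
    (hDc : IsCompact D) (hDp : IsPreconnected D) (hD : ∃ x ∈ D, ∃ y ∈ D, x ≠ y)
    (hex : ∀ a₁ a₂ : ℕ, a₁ + a₂ = 4 →
      ∃ U : Set Plane, IsOpen U ∧ (∀ x ∈ D, ∀ y ∈ D, x ≠ y → x - y ∈ U) ∧
        MixedPartialExistsOn a₁ a₂ F U ∧ ContinuousOn (mixedPartial a₁ a₂ F) U)
    (hbd : ∃ C : ℝ, ∀ a₁ a₂ : ℕ, a₁ + a₂ = 4 → ∀ x ∈ D, ∀ y ∈ D, x ≠ y →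
      |mixedPartial a₁ a₂ F (x - y)| ≤ C * ‖x - y‖ ^ (2 * ν - 4)) :
    ∃ (k : ℕ → ℝ → ℝ) (R ρ C : ℝ), (∀ z, F z = k 0 (‖z‖ ^ 2)) ∧ 0 < R ∧ R ^ 2 < ρ ∧ 0 < C ∧
      (∀ x ∈ D, ∀ y ∈ D, ‖x - y‖ ≤ R) ∧
      (∀ i < 4, ∀ q ∈ Ioo 0 ρ, HasDerivAt (k i) (k (i + 1) q) q) ∧
      ∀ q ∈ Ioo 0 ρ, |k 2 q| ≤ C * q ^ (ν - 2) ∧ q * |k 3 q| ≤ C * q ^ (ν - 2) ∧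
        q ^ 2 * |k 4 q| ≤ C * q ^ (ν - 2) := by
  obtain ⟨R, hR, hle, hsurj⟩ := exists_dist_range hDc hDp hD
  obtain ⟨C₀, hC₀⟩ := hbd
  set k : ℕ → ℝ → ℝ := fun i => deriv^[i] (radialProfile F) with hk
  set W : Set ℝ := {q | ContDiffAt ℝ (4 : ℕ) (radialProfile F) q} with hW
  have hWo : IsOpen W := isOpen_contDiffAt 4
  have hWc : ContDiffOn ℝ (4 : ℕ) (radialProfile F) W := fun q hq => ContDiffAt.contDiffWithinAt hq
  have hFk : ∀ z, F z = k 0 (‖z‖ ^ 2) := fun z => hF.eq_profile z rfl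
  have hder : ∀ i < 4, ∀ q ∈ W, HasDerivAt (k i) (k (i + 1) q) q := fun i hi q hq =>
    hasDerivAt_iterate_deriv hWo hWc hi hq
  have hmemW : ∀ x ∈ D, ∀ y ∈ D, x ≠ y → ‖x - y‖ ^ 2 ∈ W := by
    intro x hx y hy hxy
    have hz : x - y ≠ 0 := sub_ne_zero.2 hxy
    have hreg : ∀ (j : Fin 2) (U : Set Plane), IsOpen U → x - y ∈ U → (x - y) j ≠ 0 →
        (∀ l < 4, ∀ w ∈ U,
          LineDifferentiableAt ℝ ((partialDeriv j)^[l] F) w (EuclideanSpace.single j 1)) →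
        ContinuousOn ((partialDeriv j)^[4] F) U → ‖x - y‖ ^ 2 ∈ W := by
      intro j U hU hzU hj hd hc
      refine hF.contDiffAt_profile j hj ?_
      refine (contDiffOn_line_of_partialDeriv j hU hd hc (x - y)).contDiffAt ?_
      refine (hU.preimage (by fun_prop : Continuous
        fun t : ℝ => x - y + t • (EuclideanSpace.single j 1 : Plane))).mem_nhds ?_
      simpa using hzU
    -- The pure fourth derivative along a coordinate in which `x - y` does not vanish already gives
    -- a profile of class `C⁴`.
    by_cases h0 : (x - y) 0 = 0
    · have h1 : (x - y) 1 ≠ 0 := fun h1 => hz (by ext j; fin_cases j; exacts [h0, h1])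
      obtain ⟨U, hU, hDU, hd, hc⟩ := hex 0 4 (by norm_num)
      exact hreg 1 U hU (hDU x hx y hy hxy) h1 (fun l hl => hd.1 l hl) hc
    · obtain ⟨U, hU, hDU, hd, hc⟩ := hex 4 0 (by norm_num)
      exact hreg 0 U hU (hDU x hx y hy hxy) h0 (fun l hl => hd.2 l hl) hc
  set C := 12 * |C₀| with hCdef
  have hC : 0 ≤ C := by positivity
  have hpt : ∀ q ∈ Ioc 0 (R ^ 2), q ∈ W ∧ |k 2 q| ≤ C * q ^ (ν - 2) ∧
      q * |k 3 q| ≤ C * q ^ (ν - 2) ∧ q ^ 2 * |k 4 q| ≤ C * q ^ (ν - 2) := by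
    intro q hq
    obtain ⟨x, hx, y, hy, hxy⟩ := hsurj (√q) ⟨Real.sqrt_nonneg q, Real.sqrt_le_iff.2 ⟨hR.le, hq.2⟩⟩
    have hq' : ‖x - y‖ ^ 2 = q := by rw [hxy, Real.sq_sqrt hq.1.le]
    have hne : x ≠ y := by
      rintro rfl
      simp at hq'
      exact hq.1.ne hq'
    have hqW : q ∈ W := hq' ▸ hmemW x hx y hy hne
    obtain ⟨m40, m31, m22, m13, m04⟩ := mixedPartial_radial hWo hder hFk (z := x - y)
      (by rw [hq']; exact hqW)
    have hB := fun a₁ a₂ h => hC₀ a₁ a₂ h x hx y hy hne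
    rw [← rpow_norm_sq_eq, hq'] at hB
    rw [hq'] at m40 m31 m22 m13 m04
    have hp : 0 ≤ q ^ (ν - 2) := Real.rpow_nonneg hq.1.le _
    obtain ⟨b2, b3, b4⟩ := profile_bounds (B := C₀ * q ^ (ν - 2)) (hq'.symm.trans (norm_sq_plane _)) hq.1
      (by rw [← m40]; exact hB 4 0 rfl) (by rw [← m31]; exact hB 3 1 rfl)
      (by rw [← m22]; exact hB 2 2 rfl) (by rw [← m13]; exact hB 1 3 rfl)
      (by rw [← m04]; exact hB 0 4 rfl)
    have hCC : C₀ * q ^ (ν - 2) ≤ |C₀| * q ^ (ν - 2) :=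
      mul_le_mul_of_nonneg_right (le_abs_self _) hp
    have hCp : 0 ≤ |C₀| * q ^ (ν - 2) := by positivity
    exact ⟨hqW, by rw [hCdef]; linarith, by rw [hCdef]; linarith, by rw [hCdef]; linarith⟩
  have hR2 : (0 : ℝ) < R ^ 2 := by positivity
  have hRW : R ^ 2 ∈ W := (hpt _ ⟨hR2, le_rfl⟩).1
  have hcontk : ∀ i ≤ 4, ContinuousAt (k i) (R ^ 2) := fun i hi =>
    (contDiffOn_iterate_deriv hWo hWc i (4 - i) (by lia)).continuousOn.continuousAt
      (hWo.mem_nhds hRW)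
  have hcontp : ContinuousAt (fun q : ℝ => (C + 1) * q ^ (ν - 2)) (R ^ 2) :=
    continuousAt_const.mul (Real.continuousAt_rpow_const _ _ (Or.inl hR2.ne'))
  have hlt : C * (R ^ 2) ^ (ν - 2) < (C + 1) * (R ^ 2) ^ (ν - 2) :=
    mul_lt_mul_of_pos_right (by linarith) (Real.rpow_pos_of_pos hR2 _)
  -- Segments between neighbouring differences may leave the set of differences, so the bounds are
  -- extended slightly beyond `R ^ 2` by continuity, at the price of replacing `C` by `C + 1`.
  have hev : ∀ᶠ q in 𝓝 (R ^ 2), q ∈ W ∧ |k 2 q| ≤ (C + 1) * q ^ (ν - 2) ∧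
      q * |k 3 q| ≤ (C + 1) * q ^ (ν - 2) ∧ q ^ 2 * |k 4 q| ≤ (C + 1) * q ^ (ν - 2) := by
    obtain ⟨_, c2, c3, c4⟩ := hpt _ ⟨hR2, le_rfl⟩
    have e2 := (hcontk 2 (by norm_num)).abs.eventually_lt hcontp (c2.trans_lt hlt)
    have e3 := ((continuousAt_id (x := R ^ 2)).mul (hcontk 3 (by norm_num)).abs).eventually_lt hcontp
      (c3.trans_lt hlt)
    have e4 := (((continuousAt_id (x := R ^ 2)).pow 2).mul
      (hcontk 4 (by norm_num)).abs).eventually_lt hcontp (c4.trans_lt hlt)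
    filter_upwards [hWo.mem_nhds hRW, e2, e3, e4] with q h1 h2 h3 h4
    exact ⟨h1, h2.le, h3.le, h4.le⟩
  obtain ⟨ε, hε, hball⟩ := Metric.eventually_nhds_iff.1 hev
  have hall : ∀ q ∈ Ioo 0 (R ^ 2 + ε), q ∈ W ∧ |k 2 q| ≤ (C + 1) * q ^ (ν - 2) ∧
      q * |k 3 q| ≤ (C + 1) * q ^ (ν - 2) ∧ q ^ 2 * |k 4 q| ≤ (C + 1) * q ^ (ν - 2) := by
    intro q hq
    rcases le_or_gt q (R ^ 2) with h | h
    · obtain ⟨c1, c2, c3, c4⟩ := hpt q ⟨hq.1, h⟩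
      have : C * q ^ (ν - 2) ≤ (C + 1) * q ^ (ν - 2) :=
        mul_le_mul_of_nonneg_right (by linarith) (Real.rpow_nonneg hq.1.le _)
      exact ⟨c1, c2.trans this, c3.trans this, c4.trans this⟩
    · refine hball ?_
      rw [Real.dist_eq, abs_of_pos (by linarith)]
      linarith [hq.2]
  exact ⟨k, R, R ^ 2 + ε, C + 1, hFk, hR, by linarith, by positivity, hle,
    fun i hi q hq => hder i hi q (hall q hq).1, fun q hq => (hall q hq).2⟩

/-! ### Double second-order differences of a radial function -/

theorem abs_sub_sub_deriv_le {g g' g'' : ℝ → ℝ} {M : ℝ}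
    (h1 : ∀ t ∈ Icc (0 : ℝ) 1, HasDerivAt g (g' t) t)
    (h2 : ∀ t ∈ Icc (0 : ℝ) 1, HasDerivAt g' (g'' t) t)
    (hM : ∀ t ∈ Icc (0 : ℝ) 1, |g'' t| ≤ M) : |g 1 - g 0 - g' 0| ≤ M := by
  have h0 : (0 : ℝ) ∈ Icc (0 : ℝ) 1 := by simp
  have hM0 : 0 ≤ M := (abs_nonneg _).trans (hM 0 h0)
  have b1 : ∀ t ∈ Icc (0 : ℝ) 1, ‖g' t - g' 0‖ ≤ M := by
    intro t ht
    have := (convex_Icc (0 : ℝ) 1).norm_image_sub_le_of_norm_hasDerivWithin_le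
      (fun x hx => (h2 x hx).hasDerivWithinAt) hM h0 ht
    refine this.trans ?_
    rw [sub_zero, Real.norm_of_nonneg ht.1]
    exact mul_le_of_le_one_right hM0 ht.2
  have := norm_image_sub_le_of_norm_deriv_le_segment_01' (f := fun t => g t - t * g' 0)
    (f' := fun t => g' t - g' 0) (C := M)
    (fun x hx => ((h1 x hx).sub (by simpa using (hasDerivAt_id x).mul_const (g' 0))).hasDerivWithinAt)
    (fun x hx => b1 x ⟨hx.1, hx.2.le⟩)
  simp only [one_mul, zero_mul, sub_zero, Real.norm_eq_abs] at this
  rwa [sub_right_comm]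

/-- The weights annihilate affine functions, so a first-order Taylor polynomial can be subtracted
and only its remainder counts. -/
theorem abs_sum_mul_le_of_taylor {ι : Type*} [Fintype ι] {c : ι → ℝ} {x : ι → Plane} {x₀ : Plane}
    (h0 : ∑ k, c k = 0) (h1 : ∑ k, c k • x k = 0) (f : Plane → ℝ) (L : Plane →ₗ[ℝ] ℝ) {M : ℝ}
    (h : ∀ k, |f (x k) - f x₀ - L (x k - x₀)| ≤ M) :
    |∑ k, c k * f (x k)| ≤ (∑ k, |c k|) * M := by
  have hL : ∑ k, c k * L (x k - x₀) = 0 := by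
    have : ∑ k, c k * L (x k - x₀) = L (∑ k, c k • x k - (∑ k, c k) • x₀) := by
      rw [map_sub, map_sum, Finset.sum_smul, map_sum, ← Finset.sum_sub_distrib]
      refine Finset.sum_congr rfl fun k _ => ?_
      simp only [map_sub, map_smul, smul_eq_mul]
      ring
    rw [this, h0, h1]
    simp
  have e : ∑ k, c k * f (x k) = ∑ k, c k * (f (x k) - f x₀ - L (x k - x₀)) := by
    have : ∑ k, c k * (f (x k) - f x₀ - L (x k - x₀)) =
        ∑ k, c k * f (x k) - (∑ k, c k) * f x₀ - ∑ k, c k * L (x k - x₀) := by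
      rw [Finset.sum_mul, ← Finset.sum_sub_distrib, ← Finset.sum_sub_distrib]
      exact Finset.sum_congr rfl fun k _ => by ring
    rw [this, h0, hL]
    ring
  rw [e, Finset.sum_mul]
  refine (Finset.abs_sum_le_sum_abs _ _).trans (Finset.sum_le_sum fun k _ => ?_)
  rw [abs_mul]
  exact mul_le_mul_of_nonneg_left (h k) (abs_nonneg _)

theorem hasDerivAt_line (a b : Plane) (t : ℝ) : HasDerivAt (fun t : ℝ => a + t • b) b t := by
  simpa using ((hasDerivAt_id t).smul_const b).const_add a

theorem hasDerivAt_inner_line (a b v : Plane) (t : ℝ) :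
    HasDerivAt (fun t : ℝ => inner ℝ (a + t • b) v) (inner ℝ b v) t := by
  simpa using (hasDerivAt_line a b t).inner ℝ (hasDerivAt_const t v)

theorem hasDerivAt_norm_sq_line (a b : Plane) (t : ℝ) :
    HasDerivAt (fun t : ℝ => ‖a + t • b‖ ^ 2) (2 * inner ℝ (a + t • b) b) t :=
  (hasDerivAt_line a b t).norm_sq

section DoubleTaylor

variable {k : ℕ → ℝ → ℝ} {ρ : ℝ}

/-- The second derivative in direction `v` of the radial function with profile `k 0`. -/
def hessianAt (k : ℕ → ℝ → ℝ) (v z : Plane) : ℝ :=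
  4 * k 2 (‖z‖ ^ 2) * inner ℝ z v ^ 2 + 2 * k 1 (‖z‖ ^ 2) * ‖v‖ ^ 2

theorem hasDerivAt_profile_line (hk : ∀ i < 4, ∀ q ∈ Ioo 0 ρ, HasDerivAt (k i) (k (i + 1) q) q)
    {i : ℕ} (hi : i < 4) {a b : Plane} {t : ℝ} (h : ‖a + t • b‖ ^ 2 ∈ Ioo 0 ρ) :
    HasDerivAt (fun t : ℝ => k i (‖a + t • b‖ ^ 2))
      (k (i + 1) (‖a + t • b‖ ^ 2) * (2 * inner ℝ (a + t • b) b)) t :=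
  (hk i hi _ h).comp t (hasDerivAt_norm_sq_line a b t)

/-- Remainder bound for the first-order Taylor expansion of the Hessian along a line. -/
theorem abs_hessian_remainder_le
    (hk : ∀ i < 4, ∀ q ∈ Ioo 0 ρ, HasDerivAt (k i) (k (i + 1) q) q) {v a b : Plane} {E : ℝ}
    (hρ : ∀ t ∈ Icc (0 : ℝ) 1, ‖a + t • b‖ ^ 2 ∈ Ioo 0 ρ)
    (hE : ∀ t ∈ Icc (0 : ℝ) 1, |k 2 (‖a + t • b‖ ^ 2)| ≤ E ∧
      ‖a + t • b‖ ^ 2 * |k 3 (‖a + t • b‖ ^ 2)| ≤ E ∧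
      (‖a + t • b‖ ^ 2) ^ 2 * |k 4 (‖a + t • b‖ ^ 2)| ≤ E) :
    |hessianAt k v (a + b) - hessianAt k v a -
      (8 * k 3 (‖a‖ ^ 2) * inner ℝ a v ^ 2 * inner ℝ a b +
        8 * k 2 (‖a‖ ^ 2) * inner ℝ a v * inner ℝ b v +
        4 * k 2 (‖a‖ ^ 2) * ‖v‖ ^ 2 * inner ℝ a b)| ≤ 76 * E * (‖v‖ ^ 2 * ‖b‖ ^ 2) := by
  set g : ℝ → ℝ := fun t => hessianAt k v (a + t • b) with hg
  set g' : ℝ → ℝ := fun t =>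
    8 * k 3 (‖a + t • b‖ ^ 2) * inner ℝ (a + t • b) v ^ 2 * inner ℝ (a + t • b) b +
      8 * k 2 (‖a + t • b‖ ^ 2) * inner ℝ (a + t • b) v * inner ℝ b v +
      4 * k 2 (‖a + t • b‖ ^ 2) * ‖v‖ ^ 2 * inner ℝ (a + t • b) b with hg'
  set g'' : ℝ → ℝ := fun t =>
    16 * k 4 (‖a + t • b‖ ^ 2) * inner ℝ (a + t • b) b ^ 2 * inner ℝ (a + t • b) v ^ 2 +
    8 * k 3 (‖a + t • b‖ ^ 2) * ‖b‖ ^ 2 * inner ℝ (a + t • b) v ^ 2 +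
    32 * k 3 (‖a + t • b‖ ^ 2) * inner ℝ (a + t • b) b * inner ℝ (a + t • b) v * inner ℝ b v +
    8 * k 3 (‖a + t • b‖ ^ 2) * inner ℝ (a + t • b) b ^ 2 * ‖v‖ ^ 2 +
    8 * k 2 (‖a + t • b‖ ^ 2) * inner ℝ b v ^ 2 +
    4 * k 2 (‖a + t • b‖ ^ 2) * ‖v‖ ^ 2 * ‖b‖ ^ 2 with hg''
  have d1 : ∀ t ∈ Icc (0 : ℝ) 1, HasDerivAt g (g' t) t := by
    intro t ht
    have K2 := hasDerivAt_profile_line hk (i := 2) (by norm_num) (hρ t ht)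
    have K1 := hasDerivAt_profile_line hk (i := 1) (by norm_num) (hρ t ht)
    have V := hasDerivAt_inner_line a b v t
    have := ((K2.const_mul 4).mul (V.pow 2)).add ((K1.const_mul 2).mul_const (‖v‖ ^ 2))
    refine this.congr_deriv ?_
    simp only [hg']
    norm_num
    ring
  have d2 : ∀ t ∈ Icc (0 : ℝ) 1, HasDerivAt g' (g'' t) t := by
    intro t ht
    have K3 := hasDerivAt_profile_line hk (i := 3) (by norm_num) (hρ t ht)
    have K2 := hasDerivAt_profile_line hk (i := 2) (by norm_num) (hρ t ht)
    have V := hasDerivAt_inner_line a b v t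
    have B := hasDerivAt_inner_line a b b t
    have := ((((K3.const_mul 8).mul (V.pow 2)).mul B).add
      (((K2.const_mul 8).mul V).mul_const (inner ℝ b v))).add
      (((K2.const_mul 4).mul_const (‖v‖ ^ 2)).mul B)
    refine this.congr_deriv ?_
    simp only [hg'', real_inner_self_eq_norm_sq]
    norm_num
    ring
  -- By Cauchy–Schwarz, every power of `‖z‖` produced by the inner products is absorbed by the
  -- weight in the bounds on `k 3` and `k 4`. The coefficients add up: `16 + 8 + 32 + 8 + 8 + 4 =
  -- 76`.
  have bd : ∀ t ∈ Icc (0 : ℝ) 1, |g'' t| ≤ 76 * E * (‖v‖ ^ 2 * ‖b‖ ^ 2) := by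
    intro t ht
    obtain ⟨e2, e3, e4⟩ := hE t ht
    set z := a + t • b
    have hE0 : 0 ≤ E := (abs_nonneg _).trans e2
    have i1 : |inner ℝ z v| ≤ ‖z‖ * ‖v‖ := abs_real_inner_le_norm z v
    have i2 : |inner ℝ z b| ≤ ‖z‖ * ‖b‖ := abs_real_inner_le_norm z b
    have i3 : |inner ℝ b v| ≤ ‖b‖ * ‖v‖ := abs_real_inner_le_norm b v
    have hN : 0 ≤ ‖v‖ ^ 2 * ‖b‖ ^ 2 := by positivity
    have t1 : |16 * k 4 (‖z‖ ^ 2) * inner ℝ z b ^ 2 * inner ℝ z v ^ 2| ≤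
        16 * (E * (‖v‖ ^ 2 * ‖b‖ ^ 2)) := by
      rw [abs_mul, abs_mul, abs_mul, abs_pow, abs_pow, abs_of_pos (by norm_num : (0 : ℝ) < 16)]
      calc _ ≤ 16 * |k 4 (‖z‖ ^ 2)| * (‖z‖ * ‖b‖) ^ 2 * (‖z‖ * ‖v‖) ^ 2 := by gcongr
        _ = 16 * (((‖z‖ ^ 2) ^ 2 * |k 4 (‖z‖ ^ 2)|) * (‖v‖ ^ 2 * ‖b‖ ^ 2)) := by ring
        _ ≤ _ := by gcongr
    have t2 : |8 * k 3 (‖z‖ ^ 2) * ‖b‖ ^ 2 * inner ℝ z v ^ 2| ≤ 8 * (E * (‖v‖ ^ 2 * ‖b‖ ^ 2)) := by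
      rw [abs_mul, abs_mul, abs_mul, abs_pow, abs_pow, abs_of_pos (by norm_num : (0 : ℝ) < 8),
        abs_norm]
      calc _ ≤ 8 * |k 3 (‖z‖ ^ 2)| * ‖b‖ ^ 2 * (‖z‖ * ‖v‖) ^ 2 := by gcongr
        _ = 8 * ((‖z‖ ^ 2 * |k 3 (‖z‖ ^ 2)|) * (‖v‖ ^ 2 * ‖b‖ ^ 2)) := by ring
        _ ≤ _ := by gcongr
    have t3 : |32 * k 3 (‖z‖ ^ 2) * inner ℝ z b * inner ℝ z v * inner ℝ b v| ≤
        32 * (E * (‖v‖ ^ 2 * ‖b‖ ^ 2)) := by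
      rw [abs_mul, abs_mul, abs_mul, abs_mul, abs_of_pos (by norm_num : (0 : ℝ) < 32)]
      calc _ ≤ 32 * |k 3 (‖z‖ ^ 2)| * (‖z‖ * ‖b‖) * (‖z‖ * ‖v‖) * (‖b‖ * ‖v‖) := by gcongr
        _ = 32 * ((‖z‖ ^ 2 * |k 3 (‖z‖ ^ 2)|) * (‖v‖ ^ 2 * ‖b‖ ^ 2)) := by ring
        _ ≤ _ := by gcongr
    have t4 : |8 * k 3 (‖z‖ ^ 2) * inner ℝ z b ^ 2 * ‖v‖ ^ 2| ≤ 8 * (E * (‖v‖ ^ 2 * ‖b‖ ^ 2)) := by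
      rw [abs_mul, abs_mul, abs_mul, abs_pow, abs_pow, abs_of_pos (by norm_num : (0 : ℝ) < 8),
        abs_norm]
      calc _ ≤ 8 * |k 3 (‖z‖ ^ 2)| * (‖z‖ * ‖b‖) ^ 2 * ‖v‖ ^ 2 := by gcongr
        _ = 8 * ((‖z‖ ^ 2 * |k 3 (‖z‖ ^ 2)|) * (‖v‖ ^ 2 * ‖b‖ ^ 2)) := by ring
        _ ≤ _ := by gcongr
    have t5 : |8 * k 2 (‖z‖ ^ 2) * inner ℝ b v ^ 2| ≤ 8 * (E * (‖v‖ ^ 2 * ‖b‖ ^ 2)) := by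
      rw [abs_mul, abs_mul, abs_pow, abs_of_pos (by norm_num : (0 : ℝ) < 8)]
      calc _ ≤ 8 * E * (‖b‖ * ‖v‖) ^ 2 := by gcongr
        _ = _ := by ring
    have t6 : |4 * k 2 (‖z‖ ^ 2) * ‖v‖ ^ 2 * ‖b‖ ^ 2| ≤ 4 * (E * (‖v‖ ^ 2 * ‖b‖ ^ 2)) := by
      rw [abs_mul, abs_mul, abs_mul, abs_pow, abs_pow, abs_of_pos (by norm_num : (0 : ℝ) < 4),
        abs_norm, abs_norm]
      calc _ ≤ 4 * E * ‖v‖ ^ 2 * ‖b‖ ^ 2 := by gcongr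
        _ = _ := by ring
    rw [abs_le] at t1 t2 t3 t4 t5 t6 ⊢
    simp only [hg'']
    constructor <;> linarith [t1.1, t2.1, t3.1, t4.1, t5.1, t6.1, t1.2, t2.2, t3.2, t4.2, t5.2, t6.2]
  have := abs_sub_sub_deriv_le d1 d2 bd
  simpa [hg, hg'] using this

/-- Bound for the double second-order difference of a radial function of `x - y`. -/
theorem abs_sum_sum_radial_le
    (hk : ∀ i < 4, ∀ q ∈ Ioo 0 ρ, HasDerivAt (k i) (k (i + 1) q) q) {ι : Type*} [Fintype ι]
    {c d : ι → ℝ} {x y : ι → Plane} {x₀ y₀ : Plane} {E h : ℝ}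
    (hc0 : ∑ i, c i = 0) (hc1 : ∑ i, c i • x i = 0)
    (hd0 : ∑ i, d i = 0) (hd1 : ∑ i, d i • y i = 0)
    (hx : ∀ i, ‖x i - x₀‖ ≤ h) (hy : ∀ i, ‖y i - y₀‖ ≤ h)
    (hz : ∀ z, ‖z - (x₀ - y₀)‖ ≤ 2 * h → ‖z‖ ^ 2 ∈ Ioo 0 ρ ∧ |k 2 (‖z‖ ^ 2)| ≤ E ∧
      ‖z‖ ^ 2 * |k 3 (‖z‖ ^ 2)| ≤ E ∧ (‖z‖ ^ 2) ^ 2 * |k 4 (‖z‖ ^ 2)| ≤ E) :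
    |∑ i, ∑ j, c i * d j * k 0 (‖x i - y j‖ ^ 2)| ≤
      (∑ i, |c i|) * ((∑ j, |d j|) * (76 * E * h ^ 4)) := by
  rcases isEmpty_or_nonempty ι with hι | ⟨⟨i₀⟩⟩
  · simp
  have hh : 0 ≤ h := (norm_nonneg _).trans (hx i₀)
  have hE0 : 0 ≤ E := (abs_nonneg _).trans (hz (x₀ - y₀) (by simp [hh])).2.1
  have seg : ∀ i j, ∀ s ∈ Icc (0 : ℝ) 1, ∀ t ∈ Icc (0 : ℝ) 1,
      ‖(x₀ + s • (x i - x₀) - y₀) + t • (-(y j - y₀)) - (x₀ - y₀)‖ ≤ 2 * h := by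
    intro i j s hs t ht
    have e : (x₀ + s • (x i - x₀) - y₀) + t • (-(y j - y₀)) - (x₀ - y₀) =
        s • (x i - x₀) - t • (y j - y₀) := by module
    rw [e]
    refine (norm_sub_le _ _).trans ?_
    rw [norm_smul, norm_smul, Real.norm_of_nonneg hs.1, Real.norm_of_nonneg ht.1]
    have h1 := mul_le_mul hs.2 (hx i) (norm_nonneg _) zero_le_one
    have h2 := mul_le_mul ht.2 (hy j) (norm_nonneg _) zero_le_one
    linarith
  -- the inner difference of the Hessian
  have hess : ∀ i, ∀ s ∈ Icc (0 : ℝ) 1,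
      |∑ j, d j * hessianAt k (x i - x₀) (x₀ + s • (x i - x₀) - y j)| ≤
        (∑ j, |d j|) * (76 * E * h ^ 4) := by
    intro i s hs
    set v := x i - x₀
    set a := x₀ + s • v - y₀ with ha
    set L : Plane →ₗ[ℝ] ℝ :=
      -((8 * k 3 (‖a‖ ^ 2) * inner ℝ a v ^ 2 + 4 * k 2 (‖a‖ ^ 2) * ‖v‖ ^ 2) • innerₛₗ ℝ a +
        (8 * k 2 (‖a‖ ^ 2) * inner ℝ a v) • innerₛₗ ℝ v) with hL
    refine abs_sum_mul_le_of_taylor (x₀ := y₀) hd0 hd1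
      (fun w => hessianAt k v (x₀ + s • v - w)) L fun j => ?_
    have key := abs_hessian_remainder_le hk (v := v) (a := a) (b := -(y j - y₀)) (E := E)
      (fun t ht => (hz _ (seg i j s hs t ht)).1) (fun t ht => (hz _ (seg i j s hs t ht)).2)
    have e1 : a + -(y j - y₀) = x₀ + s • v - y j := by rw [ha]; abel
    rw [e1] at key
    have e2 : L (y j - y₀) = 8 * k 3 (‖a‖ ^ 2) * inner ℝ a v ^ 2 * inner ℝ a (-(y j - y₀)) +
        8 * k 2 (‖a‖ ^ 2) * inner ℝ a v * inner ℝ (-(y j - y₀)) v +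
        4 * k 2 (‖a‖ ^ 2) * ‖v‖ ^ 2 * inner ℝ a (-(y j - y₀)) := by
      rw [hL]
      simp only [LinearMap.neg_apply, LinearMap.add_apply, LinearMap.smul_apply, innerₛₗ_apply_apply,
        smul_eq_mul, inner_neg_right, real_inner_comm v]
      ring
    rw [e2]
    refine key.trans ?_
    rw [norm_neg]
    have : ‖v‖ ^ 2 * ‖y j - y₀‖ ^ 2 ≤ h ^ 4 := by
      calc _ ≤ h ^ 2 * h ^ 2 := by
            gcongr
            · exact hx i
            · exact hy j
        _ = h ^ 4 := by ring
    exact mul_le_mul_of_nonneg_left this (by positivity)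
  -- the outer difference
  set Ψ : Plane → ℝ := fun w => ∑ j, d j * k 0 (‖w - y j‖ ^ 2) with hΨ
  set L : Plane →ₗ[ℝ] ℝ := ∑ j, (d j * (2 * k 1 (‖x₀ - y j‖ ^ 2))) • innerₛₗ ℝ (x₀ - y j) with hL
  have e : ∑ i, ∑ j, c i * d j * k 0 (‖x i - y j‖ ^ 2) = ∑ i, c i * Ψ (x i) := by
    simp only [hΨ, Finset.mul_sum, mul_assoc]
  rw [e]
  refine abs_sum_mul_le_of_taylor (x₀ := x₀) hc0 hc1 Ψ L fun i => ?_
  set v := x i - x₀ with hv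
  have inρ : ∀ s ∈ Icc (0 : ℝ) 1, ∀ j, ‖(x₀ - y j) + s • v‖ ^ 2 ∈ Ioo 0 ρ := by
    intro s hs j
    have := (hz _ (seg i j s hs 1 (by simp))).1
    rwa [show (x₀ + s • (x i - x₀) - y₀) + (1 : ℝ) • (-(y j - y₀)) = (x₀ - y j) + s • v by
      rw [hv]; module] at this
  have d1 : ∀ s ∈ Icc (0 : ℝ) 1, HasDerivAt (fun s : ℝ => ∑ j, d j * k 0 (‖(x₀ - y j) + s • v‖ ^ 2))
      (∑ j, d j * (k 1 (‖(x₀ - y j) + s • v‖ ^ 2) * (2 * inner ℝ ((x₀ - y j) + s • v) v))) s :=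
    fun s hs => HasDerivAt.fun_sum fun j _ =>
      (hasDerivAt_profile_line hk (i := 0) (by norm_num) (inρ s hs j)).const_mul (d j)
  -- The second derivative along the segment is the weighted sum of Hessians, for which `hess` has
  -- already gained the factor from the second difference.
  have d2 : ∀ s ∈ Icc (0 : ℝ) 1, HasDerivAt (fun s : ℝ => ∑ j, d j *
      (k 1 (‖(x₀ - y j) + s • v‖ ^ 2) * (2 * inner ℝ ((x₀ - y j) + s • v) v)))
      (∑ j, d j * hessianAt k v (x₀ + s • v - y j)) s := by
    intro s hs
    refine HasDerivAt.fun_sum fun j _ => ?_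
    have K1 := hasDerivAt_profile_line hk (i := 1) (by norm_num) (inρ s hs j)
    have V := (hasDerivAt_inner_line (x₀ - y j) v v s).const_mul 2
    refine ((K1.mul V).const_mul (d j)).congr_deriv ?_
    rw [show x₀ + s • v - y j = (x₀ - y j) + s • v by abel, hessianAt, real_inner_self_eq_norm_sq]
    ring
  have key := abs_sub_sub_deriv_le d1 d2 (fun s hs => hess i s hs)
  have e1 : ∀ j, (x₀ - y j) + (1 : ℝ) • v = x i - y j := fun j => by rw [hv]; module
  have e2 : L v = ∑ j, d j * (k 1 (‖x₀ - y j‖ ^ 2) * (2 * inner ℝ (x₀ - y j) v)) := by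
    rw [hL]
    simp only [LinearMap.sum_apply, LinearMap.smul_apply, innerₛₗ_apply_apply, smul_eq_mul]
    exact Finset.sum_congr rfl fun j _ => by ring
  simp only [e1, zero_smul, add_zero, ← e2] at key
  exact key

end DoubleTaylor

/-! ### Covariances of the second-order differences -/

/-- The covariance of the second-order differences at the lattice indices `i` and `j`, for a field
with covariance function `K`. -/
def diffCov (K : Plane → Plane → ℝ) (φ : Plane → Plane) (ℓ : Fin 2) (n θ : ℕ) (i j : ℕ × ℕ) : ℝ :=
  ∑ k, ∑ l, coeff φ n θ ℓ i.1 i.2 k * coeff φ n θ ℓ j.1 j.2 l *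
    K (corner φ n θ i.1 i.2 k) (corner φ n θ j.1 j.2 l)

theorem sum_polynomial_eq_zero {ι : Type*} [Fintype ι] (c : ι → ℝ) (y : ι → Plane)
    (h0 : ∑ k, c k = 0) (h1 : ∑ k, c k • y k = 0) (b : ℕ → ℝ) {N : ℕ} (hN : N ≤ 2) :
    ∑ k, ∑ l, c k * c l * ∑ j ∈ Finset.range N, b j * ‖y k - y l‖ ^ (2 * j) = 0 := by
  have e : ∀ j ∈ Finset.range N, ∑ k, ∑ l, c k * c l * (b j * ‖y k - y l‖ ^ (2 * j)) = 0 := by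
    intro j hj
    have hj2 : j < 2 := (Finset.mem_range.1 hj).trans_le hN
    have e1 : ∑ k, ∑ l, c k * c l * (b j * ‖y k - y l‖ ^ (2 * j)) =
        b j * ∑ k, ∑ l, c k * c l * ‖y k - y l‖ ^ (2 * j) := by
      simp only [Finset.mul_sum]
      exact Finset.sum_congr rfl fun k _ => Finset.sum_congr rfl fun l _ => by ring
    rw [e1]
    interval_cases j
    · simp [← Finset.mul_sum, h0]
    · simp [sum_mul_norm_sub_sq c y h0 h1]
  simp only [Finset.mul_sum] at e ⊢
  rw [← Finset.sum_eq_zero e, Finset.sum_comm' (t' := Finset.univ) (s' := fun _ => Finset.range N)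
    (by simp)]
  refine Finset.sum_congr rfl fun k _ => ?_
  rw [Finset.sum_comm]

theorem abs_sum_sum_mul_le {ι : Type*} [Fintype ι] (c d : ι → ℝ) (a : ι → ι → ℝ) {B : ℝ}
    (h : ∀ k l, |a k l| ≤ B) :
    |∑ k, ∑ l, c k * d l * a k l| ≤ (∑ k, |c k|) * (∑ l, |d l|) * B := by
  rw [Finset.sum_mul_sum, Finset.sum_mul]
  refine (Finset.abs_sum_le_sum_abs _ _).trans (Finset.sum_le_sum fun k _ => ?_)
  rw [Finset.sum_mul]
  refine (Finset.abs_sum_le_sum_abs _ _).trans (Finset.sum_le_sum fun l _ => ?_)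
  rw [abs_mul, abs_mul]
  exact mul_le_mul_of_nonneg_left (h k l) (by positivity)

theorem abs_sub_le_norm_latticePoint_sub (n : ℕ) (i j : ℕ × ℕ) :
    |(i.1 : ℝ) - j.1| / n ≤ ‖latticePoint n i - latticePoint n j‖ ∧
      |(i.2 : ℝ) - j.2| / n ≤ ‖latticePoint n i - latticePoint n j‖ := by
  constructor
  · refine le_trans (le_of_eq ?_)
      (PiLp.norm_apply_le (p := 2) (latticePoint n i - latticePoint n j) 0)
    simp [latticePoint, ← sub_div]
  · refine le_trans (le_of_eq ?_)
      (PiLp.norm_apply_le (p := 2) (latticePoint n i - latticePoint n j) 1)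
    simp [latticePoint, ← sub_div]

/-- Two lattice indices are close if both coordinates differ by at most `√n`. -/
def Near (n : ℕ) (i j : ℕ × ℕ) : Prop :=
  ((i.1 : ℝ) - j.1) ^ 2 ≤ n ∧ ((i.2 : ℝ) - j.2) ^ 2 ≤ n

/-- The threshold `√n` leaves only `O(n)` near cells per row, while far base points are at distance
at least `n ^ (-1/2)`, which dominates the cell size `1 / n`. -/
theorem norm_latticePoint_sub_ge {n : ℕ} (hn : n ≠ 0) {i j : ℕ × ℕ} (h : ¬ Near n i j) :
    1 / (n : ℝ) ≤ ‖latticePoint n i - latticePoint n j‖ ^ 2 := by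
  have hn0 : (0 : ℝ) < n := by positivity
  have aux : ∀ a : ℝ, (n : ℝ) < a ^ 2 → |a| / n ≤ ‖latticePoint n i - latticePoint n j‖ →
      1 / (n : ℝ) ≤ ‖latticePoint n i - latticePoint n j‖ ^ 2 := by
    intro a ha hle
    refine le_trans ?_ (pow_le_pow_left₀ (by positivity) hle 2)
    rw [div_pow, sq_abs, div_le_div_iff₀ hn0 (by positivity)]
    nlinarith
  rw [Near, not_and_or, not_le, not_le] at h
  obtain ⟨h1, h2⟩ := abs_sub_le_norm_latticePoint_sub n i j
  exact h.elim (fun h => aux _ h h1) fun h => aux _ h h2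

theorem abs_sub_le_sqrt {n a b : ℕ} (h : ((a : ℝ) - b) ^ 2 ≤ n) :
    b ∈ Finset.Icc (a - n.sqrt) (a + n.sqrt) := by
  have h' : ((a : ℤ) - b) ^ 2 ≤ n := by exact_mod_cast h
  have h2 : ((a : ℤ) - b).natAbs ≤ n.sqrt := by
    rw [Nat.le_sqrt']
    zify
    simpa using h'
  rw [Finset.mem_Icc]
  omega

open Classical in
theorem card_near_le {n : ℕ} (hn : n ≠ 0) (s : Finset (ℕ × ℕ)) (i : ℕ × ℕ) :
    ((s.filter (Near n i)).card : ℝ) ≤ 9 * n := by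
  have hsub : s.filter (Near n i) ⊆ Finset.Icc (i.1 - n.sqrt) (i.1 + n.sqrt) ×ˢ
      Finset.Icc (i.2 - n.sqrt) (i.2 + n.sqrt) := by
    intro j hj
    obtain ⟨h1, h2⟩ := (Finset.mem_filter.1 hj).2
    exact Finset.mem_product.2 ⟨abs_sub_le_sqrt h1, abs_sub_le_sqrt h2⟩
  have hc := Finset.card_le_card hsub
  rw [Finset.card_product, Nat.card_Icc, Nat.card_Icc] at hc
  have h1 : 1 ≤ n.sqrt := Nat.le_sqrt'.2 (by lia)
  have h2 : n.sqrt ^ 2 ≤ n := Nat.sqrt_le' n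
  have hb : ∀ a : ℕ, a + n.sqrt + 1 - (a - n.sqrt) ≤ 3 * n.sqrt := fun a => by omega
  have : (s.filter (Near n i)).card ≤ 9 * n :=
    calc _ ≤ (3 * n.sqrt) * (3 * n.sqrt) := hc.trans (Nat.mul_le_mul (hb _) (hb _))
      _ = 9 * n.sqrt ^ 2 := by ring
      _ ≤ 9 * n := by lia
  exact_mod_cast this

namespace IsDeformation

variable {φ : Plane → Plane} {O : Set Plane}

/-- Weights scale inversely to the cell, so they are `n` times those of the rescaled cell, which are
bounded by compactness. The parameter set `{0}` is a dummy, as the weights do not depend on `s`. -/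
theorem exists_sum_abs_coeff_le (hφ : IsDeformation φ O) {θ : ℕ} (hθ : θ ≠ 0) (ℓ : Fin 2) :
    ∃ M > 0, ∀ᶠ n : ℕ in atTop, ∀ i ∈ cells n θ,
      ∑ k, |coeff φ n θ ℓ i.1 i.2 k| ≤ M * n := by
  obtain ⟨M, hM, h⟩ := hφ.exists_bound_cells θ (isCompact_singleton (x := (0 : ℝ)))
    (f := fun p => ∑ k, |p.2.weight ℓ k|) (fun s _ x hx => by
      refine tendsto_finsetSum _ fun k _ => ?_
      have := Cell.continuousAt_weight ℓ k (hφ.regular_limitCell hθ (hφ.square_subset hx))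
      exact (this.comp_of_eq continuousAt_snd rfl).abs)
  refine ⟨M, hM, ?_⟩
  filter_upwards [h, eventually_gt_atTop 0] with n hn hn0 i hi
  have hn' : (0 : ℝ) < n := by exact_mod_cast hn0
  have := (le_abs_self _).trans (hn i hi 0 rfl)
  have e : ∀ k, coeff φ n θ ℓ i.1 i.2 k = n * (scaledCell φ n θ i).weight ℓ k := by
    intro k
    have := Cell.weight_scale ℓ (corner φ n θ i.1 i.2) hn'.ne' (φ (latticePoint n i)) k
    rw [coeff_eq_weight, show (scaledCell φ n θ i).weight ℓ k = _ from this,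
      mul_inv_cancel_left₀ hn'.ne']
  simp only [e, abs_mul, abs_of_pos hn', ← Finset.mul_sum]
  rw [mul_comm]
  exact mul_le_mul_of_nonneg_right this hn'.le

theorem exists_norm_corner_sub_le (hφ : IsDeformation φ O) (θ : ℕ) :
    ∃ L > 0, ∀ n : ℕ, n ≠ 0 → ∀ i ∈ cells n θ, ∀ k,
      ‖corner φ n θ i.1 i.2 k - φ (latticePoint n i)‖ ≤ L / n := by
  obtain ⟨C, hC, h⟩ := hφ.exists_lipschitz
  refine ⟨C * (θ * 2 + 1), by positivity, fun n hn i hi k => ?_⟩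
  rw [corner_eq]
  refine (h _ (latticePoint_mem hi) _ (latticePoint_add_mem hi k)).trans ?_
  rw [add_sub_cancel_left, norm_smul, Real.norm_of_nonneg (by positivity), mul_div_assoc]
  refine mul_le_mul_of_nonneg_left ?_ hC.le
  rw [div_mul_eq_mul_div]
  gcongr
  nlinarith [norm_cornerVec_le k, Nat.cast_nonneg (α := ℝ) θ]

theorem eventually_regular_corner (hφ : IsDeformation φ O) {θ : ℕ} (hθ : θ ≠ 0) :
    ∀ᶠ n : ℕ in atTop, ∀ i ∈ cells n θ, Cell.Regular (corner φ n θ i.1 i.2) := by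
  filter_upwards [hφ.eventually_regular_scaledCell hθ, eventually_ne_atTop 0] with n h hn i hi
  exact (scaledCell_regular_iff hn θ i).1 (h i hi)

/-- In the expansion of `K` the polynomial part is annihilated and the irregular part is the energy.
The remainder is of order `n ^ 2` from the weights times `n ^ (-(2 ν + τ))` from the cell diameter.
-/
theorem exists_abs_diffCov_self_sub_le (hφ : IsDeformation φ O) {θ : ℕ} (hθ : θ ≠ 0) (ℓ : Fin 2)
    {K : Plane → Plane → ℝ} {ν β : ℝ} (hν : ν ∈ Ioo (0 : ℝ) 2) (hK : HasIrregularExpansion K ν β) :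
    ∃ C τ : ℝ, 0 ≤ C ∧ 0 < τ ∧ ∀ᶠ n : ℕ in atTop, ∀ i ∈ cells n θ,
      |diffCov K φ ℓ n θ i i -
        β * kernelFactor ν * ((n : ℝ) ^ (2 - 2 * ν) * (scaledCell φ n θ i).energy ℓ ν)| ≤
        C * (n : ℝ) ^ (2 - 2 * ν - τ) := by
  obtain ⟨b, r, τ, hτ, hKe, C, δ, hδ, hr⟩ := hK
  obtain ⟨M, hM, hcoeff⟩ := hφ.exists_sum_abs_coeff_le hθ ℓ
  obtain ⟨L, hL, hcorner⟩ := hφ.exists_norm_corner_sub_le θ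
  refine ⟨M * M * (|C| * (2 * L) ^ (2 * ν + τ)), τ, by positivity, hτ, ?_⟩
  have hsmall : ∀ᶠ n : ℕ in atTop, 2 * L / (n : ℝ) < δ :=
    (tendsto_const_div_atTop_nhds_zero_nat (2 * L)).eventually_lt_const hδ
  filter_upwards [hcoeff, hsmall, eventually_ne_atTop 0, hφ.eventually_regular_scaledCell hθ]
    with n hc hs hn hreg i hi
  have hn0 : (0 : ℝ) < n := by positivity
  have hri := (scaledCell_regular_iff hn θ i).1 (hreg i hi)
  set y : Cell := corner φ n θ i.1 i.2 with hy
  have hw : coeff φ n θ ℓ i.1 i.2 = y.weight ℓ := coeff_eq_weight φ n θ ℓ i.1 i.2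
  have hdist : ∀ k l, ‖y k - y l‖ ≤ 2 * L / n := by
    intro k l
    have h1 := hcorner n hn i hi k
    have h2 := hcorner n hn i hi l
    calc ‖y k - y l‖ = ‖(y k - φ (latticePoint n i)) - (y l - φ (latticePoint n i))‖ := by
          rw [sub_sub_sub_cancel_right]
      _ ≤ L / n + L / n := (norm_sub_le _ _).trans (add_le_add h1 h2)
      _ = _ := by ring
  have hfloor : ⌊ν⌋₊ + 1 ≤ 2 := by
    have : ⌊ν⌋₊ < 2 := (Nat.floor_lt hν.1.le).2 (by exact_mod_cast hν.2)
    lia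
  have hsplit : diffCov K φ ℓ n θ i i =
      β * kernelFactor ν * ((n : ℝ) ^ (2 - 2 * ν) * (scaledCell φ n θ i).energy ℓ ν) +
        ∑ k, ∑ l, y.weight ℓ k * y.weight ℓ l * r (y k) (y l) := by
    rw [← energy_corner_eq hn θ (hreg i hi) ℓ ν, mul_assoc β,
      ← Cell.sum_irregularTerm ℓ hν hri,
      ← zero_add (β * _), ← sum_polynomial_eq_zero (y.weight ℓ) y (Cell.sum_weight ℓ y)
      (Cell.sum_weight_smul ℓ hri) b hfloor, Finset.mul_sum, ← Finset.sum_add_distrib,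
      ← Finset.sum_add_distrib, diffCov, hw]
    refine Finset.sum_congr rfl fun k _ => ?_
    rw [Finset.mul_sum, ← Finset.sum_add_distrib, ← Finset.sum_add_distrib]
    refine Finset.sum_congr rfl fun l _ => ?_
    rw [hKe]
    ring
  rw [hsplit, add_sub_cancel_left]
  have hrb : ∀ k l, |r (y k) (y l)| ≤ |C| * (2 * L / n) ^ (2 * ν + τ) := by
    intro k l
    refine (hr _ _ ((hdist k l).trans_lt hs)).trans ?_
    have h1 : ‖y k - y l‖ ^ (2 * ν + τ) ≤ (2 * L / n) ^ (2 * ν + τ) :=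
      Real.rpow_le_rpow (norm_nonneg _) (hdist k l) (by linarith [hν.1])
    exact mul_le_mul (le_abs_self C) h1 (by positivity) (abs_nonneg C)
  refine (abs_sum_sum_mul_le _ _ _ hrb).trans ?_
  have hci := hc i hi
  rw [hw] at hci
  calc _ ≤ (M * n) * (M * n) * (|C| * (2 * L / n) ^ (2 * ν + τ)) := by gcongr
    _ = _ := by
      rw [Real.div_rpow (by positivity) hn0.le,
        show 2 - 2 * ν - τ = 2 - (2 * ν + τ) by ring, Real.rpow_sub hn0, Real.rpow_two]
      ring

theorem tendsto_sum_diffCov_self (hφ : IsDeformation φ O) {θ : ℕ} (hθ : θ ≠ 0) (ℓ : Fin 2)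
    {K : Plane → Plane → ℝ} {ν β : ℝ} (hν : ν ∈ Ioo (0 : ℝ) 2) (hK : HasIrregularExpansion K ν β) :
    Tendsto (fun n : ℕ => (∑ i ∈ cells n θ, diffCov K φ ℓ n θ i i) / (n : ℝ) ^ (4 - 2 * ν) -
      β * kernelFactor ν * meanEnergy φ ℓ n θ ν) atTop (𝓝 0) := by
  obtain ⟨C, τ, hC, hτ, h⟩ := hφ.exists_abs_diffCov_self_sub_le hθ ℓ hν hK
  have hlim : Tendsto (fun n : ℕ => C * (n : ℝ) ^ (-τ)) atTop (𝓝 0) := by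
    simpa using ((tendsto_rpow_neg_atTop hτ).comp tendsto_natCast_atTop_atTop).const_mul C
  refine squeeze_zero_norm' ?_ hlim
  filter_upwards [h, eventually_gt_atTop 0] with n hn hn0
  have hn' : (0 : ℝ) < n := by exact_mod_cast hn0
  have hp : (0 : ℝ) < (n : ℝ) ^ (4 - 2 * ν) := Real.rpow_pos_of_pos hn' _
  have e : (n : ℝ) ^ (4 - 2 * ν) = (n : ℝ) ^ 2 * (n : ℝ) ^ (2 - 2 * ν) := by
    rw [← Real.rpow_two, ← Real.rpow_add hn']
    ring_nf
  have e1 : (∑ i ∈ cells n θ, diffCov K φ ℓ n θ i i) / (n : ℝ) ^ (4 - 2 * ν) -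
      β * kernelFactor ν * meanEnergy φ ℓ n θ ν = (∑ i ∈ cells n θ, (diffCov K φ ℓ n θ i i -
        β * kernelFactor ν * ((n : ℝ) ^ (2 - 2 * ν) * (scaledCell φ n θ i).energy ℓ ν))) /
          (n : ℝ) ^ (4 - 2 * ν) := by
    have h2 : (0 : ℝ) < (n : ℝ) ^ (2 - 2 * ν) := Real.rpow_pos_of_pos hn' _
    rw [Finset.sum_sub_distrib, ← Finset.mul_sum, ← Finset.mul_sum, sub_div, meanEnergy, e]
    congr 1
    field_simp
  rw [e1, Real.norm_eq_abs, abs_div, abs_of_pos hp, div_le_iff₀ hp]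
  calc _ ≤ ∑ i ∈ cells n θ, C * (n : ℝ) ^ (2 - 2 * ν - τ) :=
        (Finset.abs_sum_le_sum_abs _ _).trans (Finset.sum_le_sum hn)
    _ = ((cells n θ).card : ℝ) * (C * (n : ℝ) ^ (2 - 2 * ν - τ)) := by
        rw [Finset.sum_const, nsmul_eq_mul]
    _ ≤ (n : ℝ) ^ 2 * (C * (n : ℝ) ^ (2 - 2 * ν - τ)) := by
        gcongr
        exact card_cells_le n θ
    _ = _ := by
        rw [e, show 2 - 2 * ν - τ = (2 - 2 * ν) + -τ by ring, Real.rpow_add hn']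
        ring

theorem exists_abs_diffCov_self_le (hφ : IsDeformation φ O) {θ : ℕ} (hθ : θ ≠ 0) (ℓ : Fin 2)
    {K : Plane → Plane → ℝ} {ν β : ℝ} (hν : ν ∈ Ioo (0 : ℝ) 2) (hK : HasIrregularExpansion K ν β) :
    ∃ C > 0, ∀ᶠ n : ℕ in atTop, ∀ i ∈ cells n θ,
      |diffCov K φ ℓ n θ i i| ≤ C * (n : ℝ) ^ (2 - 2 * ν) := by
  obtain ⟨C, τ, hC, hτ, h⟩ := hφ.exists_abs_diffCov_self_sub_le hθ ℓ hν hK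
  obtain ⟨M, hM, hE⟩ := hφ.exists_bound_cells θ (isCompact_singleton (x := ν))
    (f := fun p => Cell.energy ℓ p.1 p.2)
    (fun s _ x hx => hφ.continuousAt_energy_limitCell hθ ℓ s hx)
  refine ⟨C + |β * kernelFactor ν| * M + 1, by positivity, ?_⟩
  filter_upwards [h, hE, eventually_ge_atTop 1] with n hn hE hn0 i hi
  have hn' : (1 : ℝ) ≤ n := by exact_mod_cast hn0
  have h1 := hn i hi
  have h2 := hE i hi ν rfl
  have hp : (0 : ℝ) ≤ (n : ℝ) ^ (2 - 2 * ν) := by positivity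
  have h3 : (n : ℝ) ^ (2 - 2 * ν - τ) ≤ (n : ℝ) ^ (2 - 2 * ν) :=
    Real.rpow_le_rpow_of_exponent_le hn' (by linarith)
  have h4 : |β * kernelFactor ν * ((n : ℝ) ^ (2 - 2 * ν) * (scaledCell φ n θ i).energy ℓ ν)| ≤
      |β * kernelFactor ν| * ((n : ℝ) ^ (2 - 2 * ν) * M) := by
    rw [abs_mul, abs_mul ((n : ℝ) ^ (2 - 2 * ν)), abs_of_nonneg hp]
    gcongr
  have h5 := abs_add_le (diffCov K φ ℓ n θ i i -
    β * kernelFactor ν * ((n : ℝ) ^ (2 - 2 * ν) * (scaledCell φ n θ i).energy ℓ ν))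
    (β * kernelFactor ν * ((n : ℝ) ^ (2 - 2 * ν) * (scaledCell φ n θ i).energy ℓ ν))
  rw [sub_add_cancel] at h5
  have h6 := mul_le_mul_of_nonneg_left h3 hC
  nlinarith

/-- The weights contribute `n ^ 2`, the double second-order difference `n ^ (-4)`, and the
fourth-order bound at distance at least a multiple of `n ^ (-1/2)` contributes `n ^ (2 - ν)`. The
product is `n ^ (-ν)`. -/
theorem exists_abs_diffCov_far_le (hφ : IsDeformation φ O) {θ : ℕ} (hθ : θ ≠ 0) (ℓ : Fin 2)
    {K : Plane → Plane → ℝ} {ν : ℝ} (hν : ν < 2)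
    (hK : ∀ x y x' y', ‖x - y‖ = ‖x' - y'‖ → K x y = K x' y')
    (hD : HasFourthOrderBound K ν (φ '' unitSquare)) :
    ∃ C > 0, ∀ᶠ n : ℕ in atTop, ∀ i ∈ cells n θ, ∀ j ∈ cells n θ, ¬ Near n i j →
      |diffCov K φ ℓ n θ i j| ≤ C * (n : ℝ) ^ (-ν) := by
  have hF : IsRadial (fun z => K z 0) := fun z w h => hK _ _ _ _ (by simpa using h)
  have hne : ∃ x ∈ φ '' unitSquare, ∃ y ∈ φ '' unitSquare, x ≠ y := by
    have h0 : (0 : Plane) ∈ unitSquare := fun j => by simp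
    have h1 : (EuclideanSpace.single 0 1 : Plane) ∈ unitSquare := fun j => by
      fin_cases j <;> simp
    refine ⟨_, mem_image_of_mem _ h0, _, mem_image_of_mem _ h1, fun h => ?_⟩
    have := hφ.injOn (hφ.square_subset h0) (hφ.square_subset h1) h
    simpa using congrArg (fun z : Plane => z 0) this
  obtain ⟨k, R, ρ, C, hFk, hR, hRρ, hC, hRD, hk, hkb⟩ := hF.exists_profile_bounds
    (isCompact_unitSquare.image_of_continuousOn hφ.continuousOn)
    (convex_unitSquare.isPreconnected.image _ hφ.continuousOn) hne hD.1 hD.2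
  have hKk : ∀ x y, K x y = k 0 (‖x - y‖ ^ 2) := fun x y => by
    rw [hK x y (x - y) 0 (by simp)]
    exact hFk (x - y)
  obtain ⟨M, hM, hcoeff⟩ := hφ.exists_sum_abs_coeff_le hθ ℓ
  obtain ⟨L, hL, hcorner⟩ := hφ.exists_norm_corner_sub_le θ
  obtain ⟨c, hc, hlow⟩ := hφ.exists_norm_sub_ge
  refine ⟨M * (M * (76 * (C * (c ^ 2 / 4) ^ (ν - 2)) * L ^ 4)), by positivity, ?_⟩
  have hs1 : ∀ᶠ n : ℕ in atTop, (16 * L ^ 2 / c ^ 2) / (n : ℝ) < 1 :=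
    (tendsto_const_div_atTop_nhds_zero_nat _).eventually_lt_const one_pos
  have hs2 : ∀ᶠ n : ℕ in atTop, (R + 2 * L / (n : ℝ)) ^ 2 < ρ := by
    have : Tendsto (fun n : ℕ => (R + 2 * L / (n : ℝ)) ^ 2) atTop (𝓝 ((R + 0) ^ 2)) :=
      ((tendsto_const_div_atTop_nhds_zero_nat (2 * L)).const_add R).pow 2
    exact this.eventually_lt_const (by simpa using hRρ)
  filter_upwards [hcoeff, hφ.eventually_regular_corner hθ, hs1, hs2, eventually_ne_atTop 0]
    with n hco hreg h1 h2 hn i hi j hj hfar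
  have hn0 : (0 : ℝ) < n := by positivity
  have hri := hreg i hi
  have hrj := hreg j hj
  set x₀ := φ (latticePoint n i)
  set y₀ := φ (latticePoint n j)
  have hd : c / √n ≤ ‖x₀ - y₀‖ := by
    have h3 := norm_latticePoint_sub_ge hn hfar
    have h4 : 1 / √(n : ℝ) ≤ ‖latticePoint n i - latticePoint n j‖ := by
      rw [← Real.sqrt_one, ← Real.sqrt_div zero_le_one]
      exact Real.sqrt_le_iff.2 ⟨norm_nonneg _, by simpa using h3⟩
    calc c / √n = c * (1 / √n) := by ring
      _ ≤ c * ‖latticePoint n i - latticePoint n j‖ := by gcongr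
      _ ≤ _ := hlow _ (latticePoint_mem hj) _ (latticePoint_mem hi)
  -- The cells are small compared with their distance, so all differences met in the Taylor
  -- expansions stay away from the origin, where the profile is singular.
  have hLn : 2 * (L / n) ≤ c / √n / 2 := by
    have hsq : √(n : ℝ) * √n = n := Real.mul_self_sqrt hn0.le
    have hs0 : 0 < √(n : ℝ) := Real.sqrt_pos.2 hn0
    have h3 : 4 * L / c ≤ √n := by
      refine Real.le_sqrt_of_sq_le ?_
      rw [div_lt_one hn0] at h1
      refine le_trans (le_of_eq ?_) h1.le
      ring
    rw [div_le_iff₀ hc] at h3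
    calc 2 * (L / n) = 4 * L / (√n * √n) / 2 := by rw [hsq]; ring
      _ ≤ (√n * c) / (√n * √n) / 2 := by gcongr
      _ = _ := by field_simp
  have hz : ∀ z, ‖z - (x₀ - y₀)‖ ≤ 2 * (L / n) → ‖z‖ ^ 2 ∈ Ioo 0 ρ ∧
      |k 2 (‖z‖ ^ 2)| ≤ C * (c ^ 2 / 4) ^ (ν - 2) * (n : ℝ) ^ (2 - ν) ∧
      ‖z‖ ^ 2 * |k 3 (‖z‖ ^ 2)| ≤ C * (c ^ 2 / 4) ^ (ν - 2) * (n : ℝ) ^ (2 - ν) ∧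
      (‖z‖ ^ 2) ^ 2 * |k 4 (‖z‖ ^ 2)| ≤ C * (c ^ 2 / 4) ^ (ν - 2) * (n : ℝ) ^ (2 - ν) := by
    intro z hz
    have hlo : c / √n / 2 ≤ ‖z‖ := by
      have := norm_sub_norm_le (x₀ - y₀) z
      rw [norm_sub_rev (x₀ - y₀) z] at this
      linarith
    have hhi : ‖z‖ ≤ R + 2 * L / n := by
      have h3 := norm_sub_norm_le z (x₀ - y₀)
      have h4 := hRD x₀ (mem_image_of_mem _ (latticePoint_mem hi)) y₀
        (mem_image_of_mem _ (latticePoint_mem hj))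
      rw [mul_div_assoc]
      linarith
    have hlo2 : c ^ 2 / 4 / n ≤ ‖z‖ ^ 2 := by
      refine le_trans (le_of_eq ?_) (pow_le_pow_left₀ (by positivity) hlo 2)
      rw [div_pow, div_pow, Real.sq_sqrt hn0.le]
      ring
    have hmem : ‖z‖ ^ 2 ∈ Ioo 0 ρ :=
      ⟨lt_of_lt_of_le (by positivity) hlo2,
        (pow_le_pow_left₀ (norm_nonneg _) hhi 2).trans_lt h2⟩
    have hE : C * (‖z‖ ^ 2) ^ (ν - 2) ≤ C * (c ^ 2 / 4) ^ (ν - 2) * (n : ℝ) ^ (2 - ν) := by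
      rw [mul_assoc]
      refine mul_le_mul_of_nonneg_left ?_ hC.le
      refine (Real.rpow_le_rpow_of_nonpos (by positivity) hlo2 (by linarith)).trans (le_of_eq ?_)
      rw [Real.div_rpow (by positivity) hn0.le, show 2 - ν = -(ν - 2) by ring,
        Real.rpow_neg hn0.le, div_eq_mul_inv]
    obtain ⟨b2, b3, b4⟩ := hkb _ hmem
    exact ⟨hmem, b2.trans hE, b3.trans hE, b4.trans hE⟩
  have hwi := coeff_eq_weight φ n θ ℓ i.1 i.2
  have hwj := coeff_eq_weight φ n θ ℓ j.1 j.2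
  have key := abs_sum_sum_radial_le hk (c := coeff φ n θ ℓ i.1 i.2) (d := coeff φ n θ ℓ j.1 j.2)
    (x := corner φ n θ i.1 i.2) (y := corner φ n θ j.1 j.2)
    (by rw [hwi]; exact Cell.sum_weight ℓ _) (by rw [hwi]; exact Cell.sum_weight_smul ℓ hri)
    (by rw [hwj]; exact Cell.sum_weight ℓ _) (by rw [hwj]; exact Cell.sum_weight_smul ℓ hrj)
    (hcorner n hn i hi) (hcorner n hn j hj) hz
  simp only [diffCov, hKk]
  refine key.trans ?_
  have hci := hco i hi
  have hcj := hco j hj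
  calc _ ≤ (M * n) * ((M * n) *
        (76 * (C * (c ^ 2 / 4) ^ (ν - 2) * (n : ℝ) ^ (2 - ν)) * (L / n) ^ 4)) := by gcongr
    _ = _ := by
      rw [show 2 - ν = -ν + 2 by ring, Real.rpow_add hn0, Real.rpow_two]
      field_simp

end IsDeformation

/-! ### The Hilbert–Schmidt norm of the covariance matrix -/

/-- Nonnegativity of the variances of `U + W` and `U - W`. -/
theorem abs_covariance_le {S : Type*} [MeasurableSpace S] {P : Measure S} [IsFiniteMeasure P]
    {U W : S → ℝ} (hU : MemLp U 2 P) (hW : MemLp W 2 P) {V : ℝ} (h1 : cov[U, U; P] ≤ V)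
    (h2 : cov[W, W; P] ≤ V) : |cov[U, W; P]| ≤ V := by
  have ha : 0 ≤ cov[U + W, U + W; P] := by
    rw [covariance_self (hU.add hW).aemeasurable]
    exact variance_nonneg _ _
  have hs : 0 ≤ cov[U - W, U - W; P] := by
    rw [covariance_self (hU.sub hW).aemeasurable]
    exact variance_nonneg _ _
  rw [covariance_add_left hU hW (hU.add hW), covariance_add_right hU hU hW,
    covariance_add_right hW hU hW, covariance_comm W U] at ha
  rw [covariance_sub_sub hU hW hU hW, covariance_comm W U] at hs
  rw [abs_le]
  constructor <;> linarith

namespace IsStationaryIsotropicGaussianField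

variable {S : Type*} [MeasurableSpace S] {P : Measure S} {X : Plane → S → ℝ} {m : ℝ}
  {K : Plane → Plane → ℝ}

theorem memLp_two (hX : IsStationaryIsotropicGaussianField X P m K) (x : Plane) :
    MemLp (X x) 2 P :=
  (hX.gaussian.hasGaussianLaw_eval x).memLp_two

/-- The differences are a linear image of the values of the field at the finitely many corners. -/
theorem hasGaussianLaw_nabla (hX : IsStationaryIsotropicGaussianField X P m K)
    (φ : Plane → Plane) (n θ : ℕ) (ℓ : Fin 2) :
    HasGaussianLaw (fun ω (i : cells n θ) => nabla φ (fun x => X x ω) n θ ℓ i.1.1 i.1.2) P := by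
  classical
  set I : Finset Plane :=
    (cells n θ).biUnion fun i => Finset.univ.image fun k => corner φ n θ i.1 i.2 k
  have hI : ∀ (i : cells n θ) k, corner φ n θ i.1.1 i.1.2 k ∈ I := fun i k =>
    Finset.mem_biUnion.2 ⟨i.1, i.2, Finset.mem_image_of_mem _ (Finset.mem_univ k)⟩
  set L : (I → ℝ) →ₗ[ℝ] (cells n θ → ℝ) := LinearMap.pi fun i =>
    ∑ k, coeff φ n θ ℓ i.1.1 i.1.2 k • LinearMap.proj ⟨corner φ n θ i.1.1 i.1.2 k, hI i k⟩ with hL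
  have := (hX.gaussian.hasGaussianLaw I).map_fun (LinearMap.toContinuousLinearMap L)
  refine (congrArg (fun f => HasGaussianLaw f P) ?_).mp this
  funext ω i
  simp [hL, nabla_eq_sum]

theorem memLp_nabla (hX : IsStationaryIsotropicGaussianField X P m K) (φ : Plane → Plane)
    (n θ : ℕ) (ℓ : Fin 2) (i : ℕ × ℕ) :
    MemLp (fun ω => nabla φ (fun x => X x ω) n θ ℓ i.1 i.2) 2 P := by
  simp only [nabla_eq_sum]
  exact memLp_finsetSum _ fun k _ => (hX.memLp_two _).const_mul _

variable [IsProbabilityMeasure P]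

theorem integral_nabla (hX : IsStationaryIsotropicGaussianField X P m K) (φ : Plane → Plane)
    (n θ : ℕ) (ℓ : Fin 2) (i : ℕ × ℕ) :
    ∫ ω, nabla φ (fun x => X x ω) n θ ℓ i.1 i.2 ∂P = 0 := by
  simp only [nabla_eq_sum]
  rw [integral_finsetSum _ fun k _ => ((hX.memLp_two _).integrable (by norm_num)).const_mul _]
  simp only [integral_const_mul, hX.mean_eq, ← Finset.sum_mul, coeff_eq_weight, Cell.sum_weight,
    zero_mul]

theorem covariance_nabla (hX : IsStationaryIsotropicGaussianField X P m K) (φ : Plane → Plane)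
    (n θ : ℕ) (ℓ : Fin 2) (i j : ℕ × ℕ) :
    cov[fun ω => nabla φ (fun x => X x ω) n θ ℓ i.1 i.2,
      fun ω => nabla φ (fun x => X x ω) n θ ℓ j.1 j.2; P] = diffCov K φ ℓ n θ i j := by
  simp only [nabla_eq_sum]
  rw [covariance_fun_sum_fun_sum (fun k => (hX.memLp_two _).const_mul _)
    (fun k => (hX.memLp_two _).const_mul _)]
  refine Finset.sum_congr rfl fun k _ => Finset.sum_congr rfl fun l _ => ?_
  rw [covariance_const_mul_left, covariance_const_mul_right, hX.covariance_eq, mul_assoc]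

theorem sum_sq_diffCov_le (hX : IsStationaryIsotropicGaussianField X P m K) (φ : Plane → Plane)
    {n : ℕ} (hn : n ≠ 0) (θ : ℕ) (ℓ : Fin 2) {V W : ℝ}
    (hnear : ∀ i ∈ cells n θ, |diffCov K φ ℓ n θ i i| ≤ V)
    (hfar : ∀ i ∈ cells n θ, ∀ j ∈ cells n θ, ¬ Near n i j → |diffCov K φ ℓ n θ i j| ≤ W) :
    ∑ i ∈ cells n θ, ∑ j ∈ cells n θ, diffCov K φ ℓ n θ i j ^ 2 ≤
      (n : ℝ) ^ 2 * (9 * n * V ^ 2 + (n : ℝ) ^ 2 * W ^ 2) := by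
  classical
  have hrow : ∀ i ∈ cells n θ, ∑ j ∈ cells n θ, diffCov K φ ℓ n θ i j ^ 2 ≤
      9 * n * V ^ 2 + (n : ℝ) ^ 2 * W ^ 2 := by
    intro i hi
    have hi' : ∀ i ∈ cells n θ, diffCov K φ ℓ n θ i i ≤ V :=
      fun i hi => (le_abs_self _).trans (hnear i hi)
    rw [← Finset.sum_filter_add_sum_filter_not _ (Near n i)]
    refine add_le_add ?_ ?_
    · calc _ ≤ ∑ j ∈ (cells n θ).filter (Near n i), V ^ 2 := by
            refine Finset.sum_le_sum fun j hj => ?_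
            have hj := (Finset.mem_filter.1 hj).1
            refine sq_le_sq' (abs_le.1 ?_).1 (abs_le.1 ?_).2 <;>
            · rw [← hX.covariance_nabla]
              exact abs_covariance_le (hX.memLp_nabla φ n θ ℓ i) (hX.memLp_nabla φ n θ ℓ j)
                ((hX.covariance_nabla φ n θ ℓ i i).trans_le (hi' i hi))
                ((hX.covariance_nabla φ n θ ℓ j j).trans_le (hi' j hj))
        _ ≤ _ := by
            rw [Finset.sum_const, nsmul_eq_mul]
            exact mul_le_mul_of_nonneg_right (card_near_le hn _ i) (sq_nonneg V)
    · calc _ ≤ ∑ j ∈ (cells n θ).filter (fun j => ¬ Near n i j), W ^ 2 := by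
            refine Finset.sum_le_sum fun j hj => ?_
            obtain ⟨hj, hij⟩ := Finset.mem_filter.1 hj
            have := abs_le.1 (hfar i hi j hj hij)
            exact sq_le_sq' this.1 this.2
        _ ≤ _ := by
            rw [Finset.sum_const, nsmul_eq_mul]
            refine mul_le_mul_of_nonneg_right (le_trans ?_ (card_cells_le n θ)) (sq_nonneg W)
            exact_mod_cast Finset.card_filter_le _ _
  calc _ ≤ ∑ i ∈ cells n θ, (9 * n * V ^ 2 + (n : ℝ) ^ 2 * W ^ 2) := Finset.sum_le_sum hrow
    _ ≤ _ := by
      rw [Finset.sum_const, nsmul_eq_mul]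
      exact mul_le_mul_of_nonneg_right (card_cells_le n θ) (by positivity)

theorem exists_sum_sq_diffCov_le (hX : IsStationaryIsotropicGaussianField X P m K)
    {φ : Plane → Plane} {O : Set Plane} (hφ : IsDeformation φ O) {θ : ℕ} (hθ : θ ≠ 0) (ℓ : Fin 2)
    {ν β : ℝ} (hν : ν ∈ Ioo (0 : ℝ) 2) (hK : HasIrregularExpansion K ν β)
    (hD : HasFourthOrderBound K ν (φ '' unitSquare)) :
    ∃ C > 0, ∃ κ > 0, ∀ᶠ n : ℕ in atTop,
      ∑ i ∈ cells n θ, ∑ j ∈ cells n θ, diffCov K φ ℓ n θ i j ^ 2 ≤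
        (C * (n : ℝ) ^ (4 - 2 * ν - κ)) ^ 2 := by
  obtain ⟨A, hA, hnear⟩ := hφ.exists_abs_diffCov_self_le hθ ℓ hν hK
  obtain ⟨B, hB, hfar⟩ := hφ.exists_abs_diffCov_far_le hθ ℓ hν.2 hX.isotropic hD
  -- Near pairs contribute `n ^ (7 - 4 ν)` and far pairs `n ^ (4 - 2 ν)`. Comparison with `n ^ (8 -
  -- 4 ν - 2 κ)` requires `κ ≤ 1 / 2` and `κ ≤ 2 - ν`.
  refine ⟨3 * A + B, by positivity, min (1 / 2) (2 - ν),
    lt_min (by norm_num) (by linarith [hν.2]), ?_⟩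
  set κ := min (1 / 2) (2 - ν)
  have hκ1 : κ ≤ 1 / 2 := min_le_left _ _
  have hκ2 : κ ≤ 2 - ν := min_le_right _ _
  filter_upwards [hnear, hfar, eventually_ge_atTop 1] with n h1 h2 hn
  have hn1 : (1 : ℝ) ≤ n := by exact_mod_cast hn
  have hn0 : (0 : ℝ) < n := by linarith
  refine (hX.sum_sq_diffCov_le φ (by lia) θ ℓ h1 h2).trans ?_
  have sq_rpow : ∀ a : ℝ, ((n : ℝ) ^ a) ^ 2 = (n : ℝ) ^ (a * 2) := fun a => by
    rw [← Real.rpow_natCast, ← Real.rpow_mul hn0.le, Nat.cast_ofNat]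
  set T := ((n : ℝ) ^ (4 - 2 * ν - κ)) ^ 2 with hT
  have e1 : (n : ℝ) ^ 3 * ((n : ℝ) ^ (2 - 2 * ν)) ^ 2 ≤ T := by
    rw [hT, sq_rpow, sq_rpow, ← Real.rpow_natCast, ← Real.rpow_add hn0]
    refine Real.rpow_le_rpow_of_exponent_le hn1 ?_
    push_cast
    linarith
  have e2 : (n : ℝ) ^ 4 * ((n : ℝ) ^ (-ν)) ^ 2 ≤ T := by
    rw [hT, sq_rpow, sq_rpow, ← Real.rpow_natCast, ← Real.rpow_add hn0]
    refine Real.rpow_le_rpow_of_exponent_le hn1 ?_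
    push_cast
    linarith
  have hT0 : 0 ≤ T := sq_nonneg _
  calc _ = 9 * A ^ 2 * ((n : ℝ) ^ 3 * ((n : ℝ) ^ (2 - 2 * ν)) ^ 2) +
        B ^ 2 * ((n : ℝ) ^ 4 * ((n : ℝ) ^ (-ν)) ^ 2) := by ring
    _ ≤ 9 * A ^ 2 * T + B ^ 2 * T := by gcongr
    _ ≤ (3 * A + B) ^ 2 * T := by nlinarith [mul_nonneg (mul_nonneg hA.le hB.le) hT0]
    _ = _ := by rw [hT]; ring

end IsStationaryIsotropicGaussianField

/-! ### Almost sure convergence of the quadratic variations -/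

theorem summable_exp_neg_mul_rpow {c a : ℝ} (hc : 0 < c) (ha : 0 < a) :
    Summable fun n : ℕ => Real.exp (-c * (n : ℝ) ^ a) := by
  have h1 := (isLittleO_exp_neg_mul_rpow_atTop hc (-(2 / a))).comp_tendsto
    ((tendsto_rpow_atTop ha).comp tendsto_natCast_atTop_atTop)
  refine summable_of_isBigO_nat (Real.summable_nat_rpow.2 (by norm_num : (-2 : ℝ) < -1))
    (h1.isBigO.congr' (Eventually.of_forall fun n => rfl) (Eventually.of_forall fun n => ?_))
  simp only [Function.comp_apply]
  rw [← Real.rpow_mul (Nat.cast_nonneg n)]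
  congr 1
  field_simp

/-- Borel–Cantelli: almost surely only finitely many of the deviations exceed the vanishing levels
`ε n`. -/
theorem ae_tendsto_of_measureReal_ge_le {S : Type*} [MeasurableSpace S] {P : Measure S}
    [IsProbabilityMeasure P] {Z : ℕ → S → ℝ} {ε p : ℕ → ℝ} (hε : Tendsto ε atTop (𝓝 0))
    (hp : Summable p) (h : ∀ᶠ n in atTop, P.real {ω | ε n ≤ |Z n ω|} ≤ p n) :
    ∀ᵐ ω ∂P, Tendsto (fun n => Z n ω) atTop (𝓝 0) := by
  have hs : Summable fun n => P.real {ω | ε n ≤ |Z n ω|} := by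
    refine summable_of_isBigO_nat hp (Asymptotics.IsBigO.of_bound 1 ?_)
    filter_upwards [h] with n hn
    rw [one_mul, Real.norm_of_nonneg measureReal_nonneg]
    exact hn.trans (le_abs_self _)
  have hfin : ∑' n, P {ω | ε n ≤ |Z n ω|} ≠ ⊤ := by
    have := hs.tsum_ofReal_ne_top
    simpa [ofReal_measureReal] using this
  filter_upwards [ae_eventually_notMem hfin] with ω hω
  refine squeeze_zero_norm' ?_ hε
  filter_upwards [hω] with n hn
  exact (not_le.1 hn).le

theorem IsStationaryIsotropicGaussianField.ae_tendsto_quadVar {S : Type*} [MeasurableSpace S]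
    {P : Measure S} [IsProbabilityMeasure P] {X : Plane → S → ℝ} {m : ℝ} {K : Plane → Plane → ℝ}
    (hX : IsStationaryIsotropicGaussianField X P m K) {φ : Plane → Plane} {O : Set Plane}
    (hφ : IsDeformation φ O) {θ : ℕ} (hθ : θ ≠ 0) (ℓ : Fin 2) {ν β : ℝ} (hν : ν ∈ Ioo (0 : ℝ) 2)
    (hK : HasIrregularExpansion K ν β) (hD : HasFourthOrderBound K ν (φ '' unitSquare)) :
    ∀ᵐ ω ∂P, Tendsto (fun n : ℕ => quadVar φ (fun x => X x ω) n θ ℓ / (n : ℝ) ^ (4 - 2 * ν) -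
      β * kernelFactor ν * meanEnergy φ ℓ n θ ν) atTop (𝓝 0) := by
  obtain ⟨C, hC, κ, hκ, hHS⟩ := hX.exists_sum_sq_diffCov_le hφ hθ ℓ hν hK hD
  set Z : ℕ → S → ℝ := fun n ω => (quadVar φ (fun x => X x ω) n θ ℓ -
    ∑ i ∈ cells n θ, diffCov K φ ℓ n θ i i) / (n : ℝ) ^ (4 - 2 * ν) with hZ
  have hε : Tendsto (fun n : ℕ => (n : ℝ) ^ (-(κ / 2))) atTop (𝓝 0) :=
    (tendsto_rpow_neg_atTop (by positivity)).comp tendsto_natCast_atTop_atTop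
  have hp := ((summable_exp_neg_mul_rpow (c := 1 / (4 * C)) (a := κ / 2) (by positivity)
    (by positivity)).mul_left (2 * Real.exp (1 / 8)))
  have hbound : ∀ᶠ n : ℕ in atTop, P.real {ω | (n : ℝ) ^ (-(κ / 2)) ≤ |Z n ω|} ≤
      2 * Real.exp (1 / 8) * Real.exp (-(1 / (4 * C)) * (n : ℝ) ^ (κ / 2)) := by
    filter_upwards [hHS, eventually_gt_atTop 0] with n hn hn0
    have hn' : (0 : ℝ) < n := by exact_mod_cast hn0
    have hpow : (0 : ℝ) < (n : ℝ) ^ (4 - 2 * ν) := by positivity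
    -- The deviation level `n ^ (4 - 2 ν - κ / 2)` exceeds the Hilbert–Schmidt bound by a factor of
    -- order `n ^ (κ / 2)`, which makes the tails summable, yet it is negligible against the
    -- normalisation `n ^ (4 - 2 ν)`.
    have key := measureReal_sum_sq_sub_ge_le (hX.hasGaussianLaw_nabla φ n θ ℓ)
      (fun i => hX.integral_nabla φ n θ ℓ i.1) (H := C * (n : ℝ) ^ (4 - 2 * ν - κ))
      (by positivity) (by
        simp only [hX.covariance_nabla]
        rw [← Finset.sum_coe_sort (cells n θ)] at hn
        simpa only [← Finset.sum_coe_sort (cells n θ) fun j => diffCov K φ ℓ n θ _ j ^ 2] using hn)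
      ((n : ℝ) ^ (4 - 2 * ν - κ / 2))
    simp only [hX.covariance_nabla] at key
    have hset : {ω | (n : ℝ) ^ (-(κ / 2)) ≤ |Z n ω|} = {ω | (n : ℝ) ^ (4 - 2 * ν - κ / 2) ≤
        |∑ i : cells n θ, nabla φ (fun x => X x ω) n θ ℓ i.1.1 i.1.2 ^ 2 -
          ∑ i : cells n θ, diffCov K φ ℓ n θ i.1 i.1|} := by
      ext ω
      have e1 : ∑ i : cells n θ, nabla φ (fun x => X x ω) n θ ℓ i.1.1 i.1.2 ^ 2 =
          quadVar φ (fun x => X x ω) n θ ℓ := by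
        rw [Finset.sum_coe_sort (cells n θ)
          fun i => nabla φ (fun x => X x ω) n θ ℓ i.1 i.2 ^ 2, quadVar, ← Finset.sum_product']
        rfl
      have e2 : ∑ i : cells n θ, diffCov K φ ℓ n θ i.1 i.1 =
          ∑ i ∈ cells n θ, diffCov K φ ℓ n θ i i :=
        Finset.sum_coe_sort (cells n θ) fun i => diffCov K φ ℓ n θ i i
      rw [mem_ofPred_eq, mem_ofPred_eq, e1, e2, hZ, abs_div, abs_of_pos hpow, le_div_iff₀ hpow,
        ← Real.rpow_add hn']
      ring_nf
    rw [hset]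
    refine key.trans (le_of_eq ?_)
    rw [mul_assoc, ← Real.exp_add]
    congr 2
    rw [show 4 - 2 * ν - κ / 2 = (4 - 2 * ν - κ) + κ / 2 by ring, Real.rpow_add hn']
    have : (0 : ℝ) < (n : ℝ) ^ (4 - 2 * ν - κ) := by positivity
    field_simp
    ring
  filter_upwards [ae_tendsto_of_measureReal_ge_le hε hp hbound] with ω hω
  have := hω.add (hφ.tendsto_sum_diffCov_self hθ ℓ hν hK)
  rw [add_zero] at this
  refine this.congr fun n => ?_
  simp only [hZ]
  ring

end DeformedLattice

end

theorem theorem4p2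
    {S : Type*} [MeasurableSpace S] (P : MeasureTheory.Measure S)
    [MeasureTheory.IsProbabilityMeasure P]
    (X : DeformedLattice.Plane → S → ℝ) (m : ℝ)
    (K : DeformedLattice.Plane → DeformedLattice.Plane → ℝ)
    (ν : ℝ) (hν : ν ∈ Set.Ioo (0 : ℝ) 2) (ℓ : Fin 2)
    (β : ℝ → ℝ) (hβ : ∀ s ∈ Set.Ioo (0 : ℝ) 2, β s ≠ 0)
    (φ : DeformedLattice.Plane → DeformedLattice.Plane) (O : Set DeformedLattice.Plane)
    (hX : DeformedLattice.IsStationaryIsotropicGaussianField X P m K)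
    (hK : DeformedLattice.HasIrregularExpansion K ν (β ν))
    (hφ : DeformedLattice.IsDeformation φ O)
    (hJ : ∃ x ∈ DeformedLattice.unitSquare, DeformedLattice.scriptJ φ ν ℓ x ≠ 0)
    (hD : DeformedLattice.HasFourthOrderBound K ν (φ '' DeformedLattice.unitSquare)) :
    -- the objects in the definition of the estimator are well defined for all large `n`
    (∀ᶠ n : ℕ in Filter.atTop,
      (∀ θ ∈ ({1, 2} : Set ℕ), ∀ i₁ ∈ Finset.Icc 1 (n - θ), ∀ i₂ ∈ Finset.Icc 1 (n - θ),
        (DeformedLattice.matA φ n θ i₁ i₂).det ≠ 0 ∧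
        (DeformedLattice.matB φ n θ i₁ i₂).det ≠ 0) ∧
      (∀ s ∈ Set.Ioo (0 : ℝ) 2, DeformedLattice.fBar β φ n 1 ℓ s ≠ 0) ∧
      ContinuousOn (DeformedLattice.ratioF β φ n ℓ) (Set.Icc 0 2)) ∧
    (∀ᵐ ω ∂P, ∀ᶠ n : ℕ in Filter.atTop,
      DeformedLattice.quadVar φ (fun x => X x ω) n 2 ℓ ≠ 0) ∧
    -- every minimiser of the contrast is a strongly consistent estimator
    (∀ νhat : ℕ → S → ℝ,
      (∀ᵐ ω ∂P, ∀ᶠ n : ℕ in Filter.atTop,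
        νhat n ω ∈ Set.Icc (0 : ℝ) 2 ∧
        IsMinOn (DeformedLattice.contrast β φ (fun x => X x ω) n ℓ) (Set.Icc 0 2) (νhat n ω)) →
      ∀ᵐ ω ∂P, Filter.Tendsto (fun n => νhat n ω) Filter.atTop (𝓝 ν)) := by
  have h1 := hX.ae_tendsto_quadVar hφ one_ne_zero ℓ hν hK hD
  have h2 := hX.ae_tendsto_quadVar hφ two_ne_zero ℓ hν hK hD
  have hγ : β ν * DeformedLattice.kernelFactor ν ≠ 0 :=
    mul_ne_zero (hβ ν hν) (DeformedLattice.kernelFactor_ne_zero ν)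
  have hmain := (h1.and h2).mono fun ω hω => hφ.tendsto_argmin hν hJ hβ hγ
    (Y := fun x => X x ω) (by rintro θ (rfl | rfl); exacts [hω.1, hω.2])
  refine ⟨hφ.eventually_wellDefined hJ hβ, hmain.mono fun ω hω => hω.1, fun νhat hmin => ?_⟩
  filter_upwards [hmain, hmin] with ω hω hu
  exact hω.2 _ hu
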